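/- Let $\mathbb F=\mathbb F_q$ be a finite field with $q$ elements, $\mathfrak X$ a smooth projective geometrically connected curve over $\mathbb F$ with function field $K$, $\infty$ a closed point of $\mathfrak X$, and $A\subset K$ the ring of functions regular away from $\infty$. Let $K_\infty$ be the completion of $K$ at $\infty$ and $C_\infty$ the completed algebraic closure of $K_\infty$. Fix $r\ge 2$ and an $A$-lattice $Y\subset V=K^r$ (row vectors), i.e. a finitely generated projective $A$-submodule with $KY=V$, and put $\Gamma=\mathrm{GL}(Y)=\{\gamma\in \mathrm{GL}(r,K): Y\gamma=Y\}$. Let $\overline\Psi^r$ be the set of pairs $\omega=(U,i)$ with $0\neq U\subset V$ a $K$-subspace and $i:U\to C_\infty$ a discrete embedding, i.e. an injective $K$-linear map such that $i(L)$ has finite intersection with every ball, for each $A$-lattice $L$ in $U$. Let $\Psi^r$ be the subset where $U=V$; through $\omega_j=i(e_j)$ it is identified with the rigid analytic space of those $\omega\in C_\infty^r$ whose entries are $K_\infty$-linearly independent. The group $\mathrm{GL}(r,K)$ acts by $\gamma(U,i)=(U\gamma^{-1},\,x\mapsto i(x\gamma))$, and $C_\infty^*$ acts by $c(U,i)=(U,ci)$.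 In the strong topology on $\overline\Psi^r$ a neighbourhood base of $(U',i')$ is given by the sets of those $(U,i)$ with $U\supseteq U'$, $|i(v)-i'(v)|<\delta$ for all $v$ in a finite subset $S$ of $U'$, and $|i(v)|>R$ for all $v\in (A^r\cap U)\setminus U'$ ($S$, $\delta>0$, $R$ arbitrary). A modular form of weight $k$ and type $m$ for $\Gamma$ is a strongly continuous function $f:\overline\Psi^r\to C_\infty$ that is holomorphic on $\Psi^r$ and satisfies $f(c\omega)=c^{-k}f(\omega)$ for $c\in C_\infty^*$ and $f(\gamma\omega)=(\det\gamma)^{-m}f(\omega)$ for $\gamma\in\Gamma$. Let $\mathfrak n$ be an ideal of $A$ with $0\ne\mathfrak n\subsetneq A$, and let $d=\deg\mathfrak n=\dim_{\mathbb F}(A/\mathfrak n)$. For $\omega=(U,i)$ let $Y_\omega=i(Y\cap U)$ and, for a lattice $\Lambda$ in $C_\infty$, $e^\Lambda(z)=z\prod_{0\ne\lambda\in\Lambda}(1-z/\lambda)$. Let $\phi_{\mathfrak n}^{\omega}$ be the polynomial with $e^{\mathfrak n^{-1}Y_\omega}=\phi_{\mathfrak n}^{\omega}\circ e^{Y_\omega}$,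 and let $\Delta_{\mathfrak n}(\omega)$ be its coefficient of $X^{q^{rd}}$ (its leading coefficient if $\omega\in\Psi^r$). For $u\in\mathfrak n^{-1}Y$ let $$E_{1,u}(\omega)=\sum_{0\neq v\in U,\ v\equiv u\ (\mathrm{mod}\ Y)} i(v)^{-1}.$$ Then there exist finite systems $S\subset \mathfrak n^{-1}Y\setminus Y$ of representatives for $(\mathfrak n^{-1}Y/Y\setminus\{0\})/\mathbb F^*$, and for each such $S$ the function $h_{\mathfrak n}=\prod_{u\in S}E_{1,u}$ on $\overline\Psi^r$ has the following properties. (i) $h_{\mathfrak n}^{\,q-1}=(-1)^{rd}\Delta_{\mathfrak n}$ on $\overline\Psi^r$. (ii) $h_{\mathfrak n}$ is a modular form for $\Gamma$ of weight $(q^{rd}-1)/(q-1)$ and type $d$. (iii) It is well-defined up to a $(q-1)$-th root of unity: if $g:\overline\Psi^r\to C_\infty$ is any function that is holomorphic on $\Psi^r$ with $g^{q-1}=(-1)^{rd}\Delta_{\mathfrak n}$ on $\overline\Psi^r$, then $g=\zeta h_{\mathfrak n}$ for a constant $\zeta\in C_\infty$ with $\zeta^{q-1}=1$. In particular, another choice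 of $S$ changes $h_{\mathfrak n}$ only by such a constant. -/

import Mathlib

open scoped NNReal Matrix

noncomputable section

namespace DrinfeldForms

/-! ### The function field, its places, and the ring `A` -/

/-- `K` is the function field of a smooth projective geometrically connected curve over the
finite field `F`: a finitely generated extension of transcendence degree one in which `F` is
algebraically closed. -/
structure IsFunctionField (F K : Type*) [Field F] [Field K] [Algebra F K] : Prop where
  fg : (⊤ : IntermediateField F K).FG
  trdeg_eq_one : Algebra.trdeg F K = 1
  constants : ∀ x : K, IsAlgebraic F x → x ∈ (algebraMap F K).range

/-- A closed point of the curve with function field `K`, given by its local ring: a discrete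
valuation ring of `K` which contains `F` and has finite residue field. -/
structure Place (F K : Type*) [Field F] [Field K] [Algebra F K] where
  ring : ValuationSubring K
  algebraMap_mem : ∀ c : F, algebraMap F K c ∈ ring
  isDVR : IsDiscreteValuationRing ring
  finite_residue : Finite (IsLocalRing.ResidueField ring)

attribute [instance] Place.isDVR Place.finite_residue

section Field

variable {F K : Type*} [Field F] [Field K] [Algebra F K]

/-- The ring `A` of functions on the curve that are regular away from the point `inf`. -/
def regularRing (inf : Place F K) : Subalgebra F K where
  carrier := {x | ∀ P : Place F K, P ≠ inf → x ∈ P.ring}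
  mul_mem' ha hb P hP := mul_mem (ha P hP) (hb P hP)
  add_mem' ha hb P hP := add_mem (ha P hP) (hb P hP)
  algebraMap_mem' c P _ := P.algebraMap_mem c

/-- The cardinality `q_∞` of the residue field is at least two. -/
theorem Place.one_lt_card (inf : Place F K) :
    1 < (Nat.card (IsLocalRing.ResidueField inf.ring) : ℝ≥0) := by
  exact_mod_cast Finite.one_lt_card

/-- The absolute value `|x| = q_∞ ^ (- ord_∞ x)` on `K`, where `q_∞` is the cardinality of the
residue field at `inf`. -/
def Place.abv (inf : Place F K) : AbsoluteValue K ℝ :=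
  (IsDiscreteValuationRing.maximalIdeal inf.ring).adicAbv inf.one_lt_card

/-! ### The fields `K_∞` and `C_∞` -/

/-- The completion `K_∞` of `K`. -/
abbrev Kinf (inf : Place F K) : Type _ := inf.abv.Completion

theorem Kinf.isNonarchimedean (inf : Place F K) :
    IsNonarchimedean (norm : Kinf inf → ℝ) := by
  intro x y
  induction x, y using UniformSpace.Completion.induction_on₂ with
  | hp =>
    exact isClosed_le (continuous_norm.comp (continuous_fst.add continuous_snd))
      ((continuous_norm.comp continuous_fst).max (continuous_norm.comp continuous_snd))
  | ih a b =>
    rw [← UniformSpace.Completion.coe_add, UniformSpace.Completion.norm_coe,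
      UniformSpace.Completion.norm_coe, UniformSpace.Completion.norm_coe]
    exact IsDedekindDomain.HeightOneSpectrum.isNonarchimedean_adicAbv
      (IsDiscreteValuationRing.maximalIdeal inf.ring) inf.one_lt_card a.ofAbs b.ofAbs

instance Kinf.isUltrametricDist (inf : Place F K) : IsUltrametricDist (Kinf inf) :=
  IsUltrametricDist.isUltrametricDist_of_forall_norm_add_le_max_norm (Kinf.isNonarchimedean inf)

theorem Kinf.exists_norm_ne_one (inf : Place F K) : ∃ x : Kinf inf, x ≠ 0 ∧ ‖x‖ ≠ 1 := by
  obtain ⟨a, ha, h0⟩ := Submodule.exists_mem_ne_zero_of_ne_bot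
    (IsDiscreteValuationRing.maximalIdeal inf.ring).ne_bot
  have h1 : ‖((WithAbs.toAbs inf.abv (a : K) : WithAbs inf.abv) : Kinf inf)‖ < 1 := by
    rw [UniformSpace.Completion.norm_coe]
    exact ((IsDiscreteValuationRing.maximalIdeal inf.ring).adicAbv_coe_lt_one_iff
      (K := K) inf.one_lt_card a).2 ha
  refine ⟨((WithAbs.toAbs inf.abv (a : K) : WithAbs inf.abv) : Kinf inf), ?_, h1.ne⟩
  intro h
  have h2 := congrArg norm h
  rw [UniformSpace.Completion.norm_coe, norm_zero] at h2
  have h3 : inf.abv (a : K) = 0 := h2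
  rw [AbsoluteValue.eq_zero] at h3
  exact h0 (Subtype.ext h3)

instance Kinf.nontriviallyNormedField (inf : Place F K) : NontriviallyNormedField (Kinf inf) :=
  NontriviallyNormedField.ofNormNeOne (Kinf.exists_norm_ne_one inf)

/-- The algebraic closure of `K_∞`. -/
def AlgCl (inf : Place F K) : Type _ := AlgebraicClosure (Kinf inf)

instance (inf : Place F K) : Field (AlgCl inf) :=
  inferInstanceAs (Field (AlgebraicClosure (Kinf inf)))

instance (inf : Place F K) : Algebra (Kinf inf) (AlgCl inf) :=
  inferInstanceAs (Algebra (Kinf inf) (AlgebraicClosure (Kinf inf)))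

instance (inf : Place F K) : IsAlgClosure (Kinf inf) (AlgCl inf) :=
  inferInstanceAs (IsAlgClosure (Kinf inf) (AlgebraicClosure (Kinf inf)))

instance (inf : Place F K) : Algebra.IsAlgebraic (Kinf inf) (AlgCl inf) :=
  IsAlgClosure.isAlgebraic

/-- The unique extension of the absolute value of `K_∞` to its algebraic closure. -/
instance (inf : Place F K) : NormedField (AlgCl inf) :=
  spectralNorm.normedField (Kinf inf) (AlgCl inf)

/-- The completed algebraic closure `C_∞` of `K_∞`. -/
def Cinf (inf : Place F K) : Type _ := UniformSpace.Completion (AlgCl inf)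

instance (inf : Place F K) : NormedField (Cinf inf) :=
  inferInstanceAs (NormedField (UniformSpace.Completion (AlgCl inf)))

instance (inf : Place F K) : CompleteSpace (Cinf inf) :=
  inferInstanceAs (CompleteSpace (UniformSpace.Completion (AlgCl inf)))

/-- The inclusion of `K` in `C_∞`. -/
def toCinf (inf : Place F K) : K →+* Cinf inf :=
  (UniformSpace.Completion.coeRingHom : AlgCl inf →+* UniformSpace.Completion (AlgCl inf)).comp
    ((algebraMap (Kinf inf) (AlgCl inf)).comp
      ((UniformSpace.Completion.coeRingHom : WithAbs inf.abv →+* inf.abv.Completion).comp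
        (WithAbs.equiv inf.abv).symm.toRingHom))

instance (inf : Place F K) : Algebra K (Cinf inf) := (toCinf inf).toAlgebra

/-- The inclusion of `K` in `C_∞` respects absolute values. -/
theorem norm_algebraMap_Cinf (inf : Place F K) (x : K) :
    ‖algebraMap K (Cinf inf) x‖ = inf.abv x := by
  have h1 : ‖algebraMap K (Cinf inf) x‖ = ‖algebraMap (Kinf inf) (AlgCl inf)
      ((WithAbs.toAbs inf.abv x : WithAbs inf.abv) : Kinf inf)‖ :=
    UniformSpace.Completion.norm_coe (E := AlgCl inf) _
  have h2 : ‖algebraMap (Kinf inf) (AlgCl inf)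
      ((WithAbs.toAbs inf.abv x : WithAbs inf.abv) : Kinf inf)‖ =
      ‖((WithAbs.toAbs inf.abv x : WithAbs inf.abv) : Kinf inf)‖ :=
    spectralNorm_extends (K := Kinf inf) (L := AlgCl inf) _
  rw [h1, h2, UniformSpace.Completion.norm_coe]
  rfl

/-! ### Lattices -/

/-- `L` is an `A`-lattice in the `K`-subspace `U` of `K ^ r`: a finitely generated projective
`A`-submodule with `K L = U`. -/
structure IsLattice {inf : Place F K} {r : ℕ} (L : Submodule (regularRing inf) (Fin r → K))
    (U : Submodule K (Fin r → K)) : Prop where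
  fg : L.FG
  projective : Module.Projective (regularRing inf) L
  span_eq : Submodule.span K (L : Set (Fin r → K)) = U

/-- An `A`-submodule of `C_∞` is discrete if it has finite intersection with every ball. -/
def IsDiscrete {inf : Place F K} (L : Submodule (regularRing inf) (Cinf inf)) : Prop :=
  ∀ R : ℝ, ((L : Set (Cinf inf)) ∩ Metric.closedBall 0 R).Finite

/-- The image `i (L ∩ U)` in `C_∞`, for a `K`-linear map `i` on the subspace `U`. -/
def latticeImage {inf : Place F K} {r : ℕ} (U : Submodule K (Fin r → K)) (i : U →ₗ[K] Cinf inf)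
    (L : Submodule (regularRing inf) (Fin r → K)) : Submodule (regularRing inf) (Cinf inf) :=
  (L.comap (U.subtype.restrictScalars (regularRing inf))).map
    (i.restrictScalars (regularRing inf))

/-- The module `n⁻¹ L = {x | n x ⊆ L}`, for a nonzero ideal `n` of `A` and an `A`-submodule `L`
of a `K`-vector space. -/
def idealInv {inf : Place F K} {M : Type*} [AddCommGroup M] [Module (regularRing inf) M]
    (n : Ideal (regularRing inf)) (L : Submodule (regularRing inf) M) :
    Submodule (regularRing inf) M where
  carrier := {x | ∀ a ∈ n, a • x ∈ L}
  add_mem' hx hy a ha := by rw [smul_add]; exact add_mem (hx a ha) (hy a ha)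
  zero_mem' a _ := by rw [smul_zero]; exact zero_mem L
  smul_mem' c x hx a ha := by rw [smul_comm]; exact L.smul_mem c (hx a ha)

/-- The degree of an ideal of `A`. -/
def degree {inf : Place F K} (n : Ideal (regularRing inf)) : ℕ :=
  Module.finrank F (regularRing inf ⧸ n)

/-! ### The space of discrete embeddings, its actions and its strong topology -/

/-- The space `Ψ̄ ^ r` of pairs `(U, i)`, where `U ≠ 0` is a `K`-subspace of `K ^ r` and
`i : U → C_∞` is a discrete embedding. -/
structure PsiBar (inf : Place F K) (r : ℕ) where
  U : Submodule K (Fin r → K)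
  ne_bot : U ≠ ⊥
  i : U →ₗ[K] Cinf inf
  injective : Function.Injective i
  discrete : ∀ L, IsLattice L U → IsDiscrete (latticeImage U i L)

variable {inf : Place F K} {r : ℕ}

/-- The `A`-lattice `Y_ω = i (Y ∩ U)` in `C_∞` attached to `ω = (U, i)`. -/
def PsiBar.lattice (ω : PsiBar inf r) (Y : Submodule (regularRing inf) (Fin r → K)) :
    Submodule (regularRing inf) (Cinf inf) :=
  latticeImage ω.U ω.i Y

theorem IsDiscrete.smul {L : Submodule (regularRing inf) (Cinf inf)} (hL : IsDiscrete L)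
    {c : Cinf inf} (hc : c ≠ 0) {L' : Submodule (regularRing inf) (Cinf inf)}
    (h : ∀ x ∈ L', ∃ y ∈ L, x = c * y) : IsDiscrete L' := by
  intro R
  refine ((hL (R / ‖c‖)).image fun y => c * y).subset ?_
  rintro x ⟨hx, hxR⟩
  obtain ⟨y, hy, rfl⟩ := h x hx
  refine ⟨y, ⟨hy, ?_⟩, rfl⟩
  rw [mem_closedBall_zero_iff, norm_mul] at hxR
  rw [mem_closedBall_zero_iff, le_div_iff₀ (norm_pos_iff.2 hc), mul_comm]
  exact hxR

/-- The scaling `c (U, i) = (U, c i)` by `c ∈ C_∞ \ {0}`. -/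
def PsiBar.scale (c : (Cinf inf)ˣ) (ω : PsiBar inf r) : PsiBar inf r where
  U := ω.U
  ne_bot := ω.ne_bot
  i := (LinearMap.mulLeft K (c : Cinf inf)).comp ω.i
  injective x y h := ω.injective (mul_left_cancel₀ c.ne_zero h)
  discrete L hL := by
    refine (ω.discrete L hL).smul c.ne_zero ?_
    rintro _ ⟨v, hv, rfl⟩
    exact ⟨ω.i v, ⟨v, hv, rfl⟩, rfl⟩

/-- Right multiplication `x ↦ x γ` on the space `K ^ r` of row vectors. -/
def rightMul (γ : GL (Fin r) K) : (Fin r → K) →ₗ[K] (Fin r → K) :=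
  Matrix.vecMulLinear (γ : Matrix (Fin r) (Fin r) K)

theorem rightMul_inv_rightMul (γ : GL (Fin r) K) (x : Fin r → K) :
    rightMul γ⁻¹ (rightMul γ x) = x := by
  have h : (γ : Matrix (Fin r) (Fin r) K) * ((γ⁻¹ : GL (Fin r) K) : Matrix (Fin r) (Fin r) K) = 1 :=
    Units.mul_inv γ
  simp only [rightMul, Matrix.vecMulLinear_apply, Matrix.vecMul_vecMul, h, Matrix.vecMul_one]

theorem rightMul_rightMul_inv (γ : GL (Fin r) K) (x : Fin r → K) :
    rightMul γ (rightMul γ⁻¹ x) = x := by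
  have h := rightMul_inv_rightMul γ⁻¹ x
  rwa [inv_inv] at h

/-- `x ↦ x γ` as a linear automorphism of `K ^ r`. -/
def rightMulEquiv (γ : GL (Fin r) K) : (Fin r → K) ≃ₗ[K] (Fin r → K) :=
  LinearEquiv.ofLinearMap (rightMul γ) (rightMul γ⁻¹)
    (LinearMap.ext (rightMul_rightMul_inv γ)) (LinearMap.ext (rightMul_inv_rightMul γ))

theorem IsLattice.map_rightMul {γ : GL (Fin r) K} {U : Submodule K (Fin r → K)}
    {L : Submodule (regularRing inf) (Fin r → K)} (hL : IsLattice L (U.comap (rightMul γ))) :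
    IsLattice (L.map ((rightMul γ).restrictScalars (regularRing inf))) U where
  fg := hL.fg.map _
  projective := by
    have := hL.projective
    exact Module.Projective.of_equiv (((rightMulEquiv γ).restrictScalars
      (regularRing inf)).submoduleMap L)
  span_eq := by
    have h1 : ((L.map ((rightMul γ).restrictScalars (regularRing inf)) :
        Submodule (regularRing inf) (Fin r → K)) : Set (Fin r → K)) = rightMul γ '' L := rfl
    rw [h1, Submodule.span_image, hL.span_eq, Submodule.map_comap_eq_of_surjective]
    exact fun x => ⟨rightMul γ⁻¹ x, rightMul_rightMul_inv γ x⟩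

/-- The left action `γ (U, i) = (U γ⁻¹, i ∘ r_γ)` of `GL (r, K)`, where `r_γ x = x γ`; here
`U γ⁻¹` is written as `{x | x γ ∈ U}`. -/
def PsiBar.act (γ : GL (Fin r) K) (ω : PsiBar inf r) : PsiBar inf r where
  U := ω.U.comap (rightMul γ)
  ne_bot h := by
    obtain ⟨u, hu, hu0⟩ := Submodule.exists_mem_ne_zero_of_ne_bot ω.ne_bot
    have h1 : rightMul γ⁻¹ u ∈ ω.U.comap (rightMul γ) := by
      rw [Submodule.mem_comap, rightMul_rightMul_inv]; exact hu
    rw [h, Submodule.mem_bot] at h1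
    rw [← rightMul_rightMul_inv γ u, h1, map_zero] at hu0
    exact hu0 rfl
  i := ω.i.comp ((rightMul γ).restrict (p := ω.U.comap (rightMul γ)) (q := ω.U) fun _ hx => hx)
  injective x y h := by
    have h1 := congrArg Subtype.val (ω.injective h)
    have h2 : rightMul γ x.1 = rightMul γ y.1 := h1
    refine Subtype.ext ?_
    rw [← rightMul_inv_rightMul γ x.1, h2, rightMul_inv_rightMul]
  discrete L hL := by
    refine (ω.discrete _ hL.map_rightMul).smul one_ne_zero ?_
    rintro _ ⟨v, hv, rfl⟩
    exact ⟨ω.i ⟨rightMul γ v.1, v.2⟩, ⟨⟨rightMul γ v.1, v.2⟩, ⟨v.1, hv, rfl⟩, rfl⟩,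
      (one_mul _).symm⟩

/-- The lattice `A ^ r` in `K ^ r`. -/
def stdLattice (inf : Place F K) (r : ℕ) : Set (Fin r → K) :=
  {v | ∀ j, v j ∈ regularRing inf}

/-- Basic strong neighbourhood of `ω = (U', i')`: the points `(U, i)` with `U' ⊆ U` such that
`i` is `δ`-close to `i'` on the finite set `S ⊆ U'`, and `|i v| > R` for all lattice vectors
`v ∈ U \ U'`. -/
def PsiBar.nhd (ω : PsiBar inf r) (S : Finset ω.U) (δ R : ℝ) : Set (PsiBar inf r) :=
  {η | ∃ h : ω.U ≤ η.U,
    (∀ v ∈ S, ‖η.i (Submodule.inclusion h v) - ω.i v‖ < δ) ∧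
    ∀ v : η.U, (v : Fin r → K) ∈ stdLattice inf r → (v : Fin r → K) ∉ ω.U → R < ‖η.i v‖}

theorem PsiBar.nhd_mono (ω : PsiBar inf r) {S T : Finset ω.U} {δ ε R Q : ℝ} (hS : S ⊆ T)
    (hδ : ε ≤ δ) (hR : R ≤ Q) : ω.nhd T ε Q ⊆ ω.nhd S δ R := by
  rintro η ⟨h, h1, h2⟩
  exact ⟨h, fun v hv => (h1 v (hS hv)).trans_le hδ, fun v hv hv' => hR.trans_lt (h2 v hv hv')⟩

open Classical in
/-- The strong topology: a set is open if it contains with each point one of its basic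
neighbourhoods. -/
instance PsiBar.strongTopology : TopologicalSpace (PsiBar inf r) where
  IsOpen W := ∀ ω ∈ W, ∃ S : Finset ω.U, ∃ δ > 0, ∃ R : ℝ, ω.nhd S δ R ⊆ W
  isOpen_univ _ _ := ⟨∅, 1, one_pos, 0, Set.subset_univ _⟩
  isOpen_inter W W' hW hW' ω hω := by
    obtain ⟨S, δ, hδ, R, h⟩ := hW ω hω.1
    obtain ⟨S', δ', hδ', R', h'⟩ := hW' ω hω.2
    exact ⟨S ∪ S', min δ δ', lt_min hδ hδ', max R R', Set.subset_inter
      ((ω.nhd_mono Finset.subset_union_left (min_le_left _ _) (le_max_left _ _)).trans h)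
      ((ω.nhd_mono Finset.subset_union_right (min_le_right _ _) (le_max_right _ _)).trans h')⟩
  isOpen_sUnion s hs ω hω := by
    obtain ⟨W, hW, hωW⟩ := hω
    obtain ⟨S, δ, hδ, R, h⟩ := hs W hW ω hωW
    exact ⟨S, δ, hδ, R, h.trans (Set.subset_sUnion_of_mem hW)⟩

/-! ### Holomorphic functions on the open stratum, and modular forms -/

/-- The coordinates `ω_j = i (e_j)` of a point of the open stratum `Ψ ^ r`. -/
def PsiBar.coord (ω : PsiBar inf r) (h : ω.U = ⊤) (j : Fin r) : Cinf inf :=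
  ω.i ⟨Pi.single j 1, h ▸ Submodule.mem_top⟩

/-- The affinoid subset of `C_∞ ^ r` of all `ω` with `|ω_j| ≤ q ^ N` for all `j` and
`|∑ a_j ω_j| ≥ q ^ (-N) max |a_j|` for all `a ∈ K ^ r` (equivalently, by density, for all
`a ∈ K_∞ ^ r`). These affinoids form the standard admissible covering of `Ψ ^ r`. -/
def affinoid (inf : Place F K) (r N : ℕ) : Set (Fin r → Cinf inf) :=
  {ω | (∀ j, ‖ω j‖ ≤ (Nat.card F : ℝ) ^ N) ∧
    ∀ (a : Fin r → K) (j : Fin r), inf.abv (a j) ≤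
      (Nat.card F : ℝ) ^ N * ‖∑ k, algebraMap K (Cinf inf) (a k) * ω k‖}

/-- `f` is holomorphic on `Ψ ^ r` (in the sense of rigid analysis): on each of the standard
affinoids it is a uniform limit of rational functions without poles there. -/
def IsHolomorphic (f : PsiBar inf r → Cinf inf) : Prop :=
  ∀ N : ℕ, ∀ ε > (0 : ℝ), ∃ P Q : MvPolynomial (Fin r) (Cinf inf),
    ∀ (ω : PsiBar inf r) (h : ω.U = ⊤), ω.coord h ∈ affinoid inf r N →
      MvPolynomial.eval (ω.coord h) Q ≠ 0 ∧
      ‖f ω - MvPolynomial.eval (ω.coord h) P / MvPolynomial.eval (ω.coord h) Q‖ < ε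

/-- `γ` belongs to the group `Γ = GL(Y)`, that is, `Y γ = Y`. -/
def MemGamma (Y : Submodule (regularRing inf) (Fin r → K)) (γ : GL (Fin r) K) : Prop :=
  Y.map ((rightMul γ).restrictScalars (regularRing inf)) = Y

/-- Modular forms of weight `k` and type `m` for `Γ = GL(Y)`, as functions on `Ψ̄ ^ r`. -/
structure IsModularForm (Y : Submodule (regularRing inf) (Fin r → K)) (k m : ℤ)
    (f : PsiBar inf r → Cinf inf) : Prop where
  holomorphic : IsHolomorphic f
  weight : ∀ (c : (Cinf inf)ˣ) (ω : PsiBar inf r), f (ω.scale c) = (c : Cinf inf) ^ (-k) * f ω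
  type : ∀ γ : GL (Fin r) K, MemGamma Y γ → ∀ ω : PsiBar inf r,
    f (ω.act γ) = algebraMap K (Cinf inf) (γ : Matrix (Fin r) (Fin r) K).det ^ (-m) * f ω
  continuous : Continuous f

/-! ### Exponential functions, discriminant forms, partial Eisenstein series -/

/-- The exponential function `e^Λ(z) = z ∏' (1 - z / λ)` of a lattice `Λ` in `C_∞`. -/
def expLattice (Λ : Submodule (regularRing inf) (Cinf inf)) (z : Cinf inf) : Cinf inf :=
  z * ∏' l : {l : Cinf inf // l ∈ Λ ∧ l ≠ 0}, (1 - z / (l : Cinf inf))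

/-- `φ` is the polynomial of the isogeny which corresponds to the inclusion `Λ ⊆ n⁻¹ Λ`:
`e^{n⁻¹ Λ} = φ ∘ e^Λ`. -/
def IsIsogeny (n : Ideal (regularRing inf)) (Λ : Submodule (regularRing inf) (Cinf inf))
    (φ : Polynomial (Cinf inf)) : Prop :=
  ∀ z : Cinf inf, expLattice (idealInv n Λ) z = φ.eval (expLattice Λ z)

open Classical in
/-- The polynomial `φ_n` of the isogeny attached to the lattice `Λ`. -/
def isogenyPoly (n : Ideal (regularRing inf)) (Λ : Submodule (regularRing inf) (Cinf inf)) :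
    Polynomial (Cinf inf) :=
  if h : ∃ φ, IsIsogeny n Λ φ then h.choose else 0

/-- The discriminant form `Δ_n`: the coefficient of `X ^ (q ^ (r deg n))` in `φ_n`, which is the
leading coefficient if the lattice `Y_ω` has rank `r`. -/
def discriminantForm (Y : Submodule (regularRing inf) (Fin r → K)) (n : Ideal (regularRing inf))
    (ω : PsiBar inf r) : Cinf inf :=
  (isogenyPoly n (ω.lattice Y)).coeff (Nat.card F ^ (r * degree n))

/-- The partial Eisenstein series `E_{k, u}(ω) = ∑' i(v)⁻ᵏ`, where the sum is over the nonzero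
`v ∈ U` with `v ≡ u` modulo `Y`. -/
def partialEisenstein (Y : Submodule (regularRing inf) (Fin r → K)) (k : ℕ) (u : Fin r → K)
    (ω : PsiBar inf r) : Cinf inf :=
  ∑' v : {v : ω.U // (v : Fin r → K) - u ∈ Y ∧ v ≠ 0}, (ω.i (v : ω.U) ^ k)⁻¹

/-- `S` is a system of representatives for `(n⁻¹ Y / Y \ {0}) / F^*`. -/
structure IsRepSystem (Y : Submodule (regularRing inf) (Fin r → K)) (n : Ideal (regularRing inf))
    (S : Finset (Fin r → K)) : Prop where
  mem : ∀ u ∈ S, u ∈ idealInv n Y ∧ u ∉ Y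
  existsUnique : ∀ u ∈ idealInv n Y, u ∉ Y → ∃! s, s ∈ S ∧ ∃ c : F, c ≠ 0 ∧ u - c • s ∈ Y

/-- The product `h_n` of the `E_{1, u}` over the system of representatives `S`. -/
def rootForm (Y : Submodule (regularRing inf) (Fin r → K)) (S : Finset (Fin r → K))
    (ω : PsiBar inf r) : Cinf inf :=
  ∏ u ∈ S, partialEisenstein Y 1 u ω

end Field

end DrinfeldForms

end

noncomputable section

namespace DrinfeldForms

set_option linter.unusedSectionVars false
set_option linter.overlappingInstances false

/-! ### Places and the absolute value at infinity -/

section Places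

variable {F K : Type*} [Field F] [Field K] [Algebra F K]

/-! Write `Λ = Y_ω`. Everything rests on one computation. For a finite additive subgroup `G` of a
field, `∏ (X - g)` is additive up to constants, so its derivative is constant, and the sum of `1 /
(u + g)` over a nontrivial coset is the inverse of the exponential of `G` at `u`. In an ultrametric
field the truncation of a discrete group to a ball is a finite group, so the identity passes to the
limit: `E_{1,u}(ω) = 1 / e^Λ(i(u))` when `u ∈ U`, and more generally `e^{n⁻¹Λ} = e^Λ ∏ (1 - e^Λ
E_{1,u}(ω))` over the nonzero classes `u` of `n⁻¹Y / Y` (`discreteExp_eq_mul_prod`). A class that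
misses `U` has `E_{1,u}(ω) = 0` and contributes the factor one.

Root of the discriminant. Since `E_{1,cu} = c⁻¹ E_{1,u}` for `c ∈ F^*` and `∏ (1 - x / c) = 1 -
x^(q-1)`, grouping the classes into lines gives `φ_n = X ∏_{s ∈ S} (1 - E_{1,s}^(q-1) X^(q-1))`
(`isogenyPoly_eq`). As `|S| (q - 1) + 1 = q^(rd)`, the coefficient in question is `(-1)^|S|
h^(q-1)`, and `|S| = 1 + q + ... + q^(rd-1)` is a sum of `rd` terms with `(-1)^(q^i) = -1` in `F`,
so the sign is `(-1)^(rd)`.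

Modularity. The weight is termwise. For the type, `γ` permutes the classes, and one needs the factor
by which `∏_S e(u)` changes when an `F`-linear automorphism `g` of a finite `F`-space is applied and
`e` is homogeneous of degree one: it is `det g` (`IsProjectiveSystem.prod_apply`), as is checked on
one-entry diagonal matrices and transvections. Here `e = 1 / E_{1,u}` and the space is `n⁻¹Y / Y`,
which is `(A / n)^r` because `Y` becomes free over the localization of `A` at the elements
invertible modulo `n`. The determinant of `γ` is a unit of `A`, hence a constant `δ`, and the
`F`-determinant of `γ` on `(A / n)^r` is the norm of `δ` from `A / n`, that is `δ^d`. Continuity and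
holomorphy follow from estimates of the single terms `1 / i(v)`, uniform in a strong neighbourhood
and in an affinoid respectively.

Uniqueness. At the boundary both functions vanish, because some class of `n⁻¹Y / Y` misses `U`. On
the open stratum `g / h` takes values in the `(q-1)`-th roots of unity, which are the elements of
`F^*` and have mutual distance one. So for `ζ` the ratio at one point, `f = g - ζh` is at every
point either zero or of norm `|h|`, which is bounded below on each affinoid. The missing
connectedness is supplied by `IsHolomorphic.eq_zero_of_eq_zero`: on the line through two points,
replace `f` by a rational approximation `P / Q` and consider the Gauss norms of `P` and `Q` on discs
of radius `s`. The ratio is either small or large at each radius, depends continuously on `s ∈ [0,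
1]`, equals `|P / Q|` at the centre for `s = 0`, and no longer depends on the centre for `s = 1`. -/

theorem Place.abv_add_le (inf : Place F K) (x y : K) :
    inf.abv (x + y) ≤ max (inf.abv x) (inf.abv y) :=
  IsDedekindDomain.HeightOneSpectrum.isNonarchimedean_adicAbv
    (IsDiscreteValuationRing.maximalIdeal inf.ring) inf.one_lt_card x y

theorem Place.abv_coe_lt_one_iff (inf : Place F K) (x : inf.ring) :
    inf.abv (x : K) < 1 ↔ x ∈ IsLocalRing.maximalIdeal inf.ring :=
  (IsDiscreteValuationRing.maximalIdeal inf.ring).adicAbv_coe_lt_one_iff (K := K) inf.one_lt_card x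

theorem Place.abv_le_one_iff (inf : Place F K) (x : K) : inf.abv x ≤ 1 ↔ x ∈ inf.ring := by
  constructor
  · intro h
    by_contra hx
    have hx0 : x ≠ 0 := by rintro rfl; exact hx inf.ring.zero_mem
    have hinv : x⁻¹ ∈ inf.ring := (inf.ring.mem_or_inv_mem x).resolve_left hx
    have h1 : inf.abv ((⟨x⁻¹, hinv⟩ : inf.ring) : K) < 1 := by
      rw [inf.abv_coe_lt_one_iff]
      rw [IsLocalRing.mem_maximalIdeal, mem_nonunits_iff]
      intro hu
      obtain ⟨b, hb⟩ := isUnit_iff_exists_inv.1 hu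
      have hb' : x⁻¹ * (b : K) = 1 := congrArg Subtype.val hb
      have : (b : K) = x := by
        field_simp at hb'
        exact hb'
      exact hx (this ▸ b.2)
    have h2 : inf.abv x⁻¹ < 1 := h1
    rw [map_inv₀] at h2
    have h3 : 0 < inf.abv x := inf.abv.pos hx0
    have := (inv_lt_one₀ h3).1 h2
    linarith
  · intro h
    exact (IsDiscreteValuationRing.maximalIdeal inf.ring).adicAbv_coe_le_one (K := K)
      inf.one_lt_card (⟨x, h⟩ : inf.ring)

theorem Place.exists_uniformizer (inf : Place F K) :
    ∃ π : K, π ≠ 0 ∧ inf.abv π < 1 ∧ ∀ x, inf.abv x < 1 → inf.abv x ≤ inf.abv π := by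
  obtain ⟨p, hp⟩ := IsDiscreteValuationRing.exists_irreducible inf.ring
  have hm := (IsDiscreteValuationRing.irreducible_iff_uniformizer p).1 hp
  refine ⟨p, fun h => hp.ne_zero (Subtype.ext h), ?_, fun x hx => ?_⟩
  · rw [inf.abv_coe_lt_one_iff, hm]; exact Ideal.mem_span_singleton_self p
  · have hx' : x ∈ inf.ring := (inf.abv_le_one_iff x).1 hx.le
    have h1 := (inf.abv_coe_lt_one_iff ⟨x, hx'⟩).1 hx
    rw [hm, Ideal.mem_span_singleton] at h1
    obtain ⟨y, hy⟩ := h1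
    have h2 : x = p * y := congrArg Subtype.val hy
    rw [h2, map_mul]
    exact mul_le_of_le_one_right (inf.abv.nonneg _) ((inf.abv_le_one_iff _).2 y.2)

theorem Place.abv_algebraMap_le_one (inf : Place F K) (c : F) : inf.abv (algebraMap F K c) ≤ 1 :=
  (inf.abv_le_one_iff _).2 (inf.algebraMap_mem c)

theorem Place.abv_algebraMap (inf : Place F K) {c : F} (hc : c ≠ 0) :
    inf.abv (algebraMap F K c) = 1 := by
  refine le_antisymm (inf.abv_algebraMap_le_one c) ?_
  have h := inf.abv_algebraMap_le_one c⁻¹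
  rw [map_inv₀, map_inv₀] at h
  exact (inv_le_one₀ (inf.abv.pos (by simpa using hc))).1 h

/-- The unit ball of `K` modulo a smaller ball around zero is finite. -/
theorem Place.exists_finite_net (inf : Place F K) {η : ℝ} (hη : 0 < η) :
    ∃ T : Finset K, (∀ a ∈ T, inf.abv a ≤ 1) ∧
      ∀ x, inf.abv x ≤ 1 → ∃ a ∈ T, inf.abv (x - a) ≤ η := by
  classical
  obtain ⟨π, hπ0, hπ1, hπ⟩ := inf.exists_uniformizer
  have key : ∀ k : ℕ, ∃ T : Finset K, (∀ a ∈ T, inf.abv a ≤ 1) ∧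
      ∀ x, inf.abv x ≤ 1 → ∃ a ∈ T, inf.abv (x - a) ≤ inf.abv π ^ k := by
    intro k
    induction k with
    | zero =>
      refine ⟨{0}, by simp, fun x hx => ⟨0, by simp, by simpa using hx⟩⟩
    | succ k ih =>
      obtain ⟨T, hT1, hT2⟩ := ih
      have := Fintype.ofFinite (IsLocalRing.ResidueField inf.ring)
      let rep : IsLocalRing.ResidueField inf.ring → K :=
        fun c => ((IsLocalRing.residue_surjective c).choose : inf.ring)
      -- One more `π`-adic digit, taken from representatives of the residue field, refines the net.
      refine ⟨Finset.image (fun p : K × IsLocalRing.ResidueField inf.ring =>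
        p.1 + π ^ k * rep p.2) (T ×ˢ Finset.univ), ?_, ?_⟩
      · intro a ha
        obtain ⟨⟨b, c⟩, hbc, rfl⟩ := Finset.mem_image.1 ha
        refine (inf.abv_add_le _ _).trans (max_le (hT1 b (Finset.mem_product.1 hbc).1) ?_)
        rw [map_mul, map_pow]
        exact mul_le_one₀ (pow_le_one₀ (inf.abv.nonneg _) hπ1.le) (inf.abv.nonneg _)
          ((inf.abv_le_one_iff _).2 (Subtype.mem _))
      · intro x hx
        obtain ⟨b, hb, hxb⟩ := hT2 x hx
        have hpos : 0 < inf.abv π ^ k := pow_pos (inf.abv.pos hπ0) k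
        have h1 : inf.abv ((x - b) / π ^ k) ≤ 1 := by
          rw [map_div₀, map_pow]
          exact (div_le_one hpos).2 hxb
        let z : inf.ring := ⟨_, (inf.abv_le_one_iff _).1 h1⟩
        let w : inf.ring := (IsLocalRing.residue_surjective (IsLocalRing.residue inf.ring z)).choose
        have hw : IsLocalRing.residue inf.ring w = IsLocalRing.residue inf.ring z :=
          (IsLocalRing.residue_surjective (IsLocalRing.residue inf.ring z)).choose_spec
        refine ⟨b + π ^ k * rep (IsLocalRing.residue inf.ring z),
          Finset.mem_image.2 ⟨(b, _), Finset.mem_product.2 ⟨hb, Finset.mem_univ _⟩, rfl⟩, ?_⟩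
        have h2 : z - w ∈ IsLocalRing.maximalIdeal inf.ring := by
          rw [← IsLocalRing.residue_eq_zero_iff, map_sub, hw, sub_self]
        have h3 := hπ _ ((inf.abv_coe_lt_one_iff _).2 h2)
        have h4 : x - (b + π ^ k * rep (IsLocalRing.residue inf.ring z)) =
            π ^ k * ((z - w : inf.ring) : K) := by
          have : ((z - w : inf.ring) : K) = (x - b) / π ^ k - w := rfl
          rw [this]
          have h5 : π ^ k ≠ 0 := pow_ne_zero k hπ0
          field_simp
          simp only [rep, w]
          ring
        rw [h4, map_mul, map_pow, pow_succ]
        exact mul_le_mul_of_nonneg_left h3 hpos.le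
  obtain ⟨k, hk⟩ := exists_pow_lt_of_lt_one hη hπ1
  obtain ⟨T, hT1, hT2⟩ := key k
  exact ⟨T, hT1, fun x hx => (hT2 x hx).imp fun a ha => ⟨ha.1, ha.2.trans hk.le⟩⟩

/-- In transcendence degree one a single transcendental `y` is a transcendence basis, so `K` is
algebraic over `F(y)`, and finite generation makes the extension finite. -/
theorem IsFunctionField.finiteDimensional (hK : IsFunctionField F K) {y : K}
    (hy : Transcendental F y) : FiniteDimensional (IntermediateField.adjoin F {y}) K := by
  have h1 : AlgebraicIndependent F (fun _ : Unit => y) := by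
    rw [algebraicIndependent_unique_type_iff]; exact hy
  have h2 : IsTranscendenceBasis F (fun _ : Unit => y) := by
    refine h1.isTranscendenceBasis_of_lift_trdeg_le_of_finite ?_
    simp [hK.trdeg_eq_one]
  have h3 : Algebra.IsAlgebraic (IntermediateField.adjoin F {y}) K := by
    have := h2.isAlgebraic_field
    rwa [Set.range_const] at this
  have h4 : Algebra.EssFiniteType F K := IntermediateField.fg_top_iff.1 hK.fg
  have h5 : Algebra.EssFiniteType (IntermediateField.adjoin F {y}) K :=
    Algebra.EssFiniteType.of_comp F _ _
  exact Algebra.finite_of_essFiniteType_of_isAlgebraic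

end Places

/-! ### Finite quotients of subrings of a function field -/

section FunctionField

open Polynomial

variable {F K : Type*} [Field F] [Field K] [Algebra F K]

/-- Elements of `B` that are `F`-independent modulo `y` are independent over `F(y)`: in a relation
with coefficients in `F[y]` the constant terms vanish modulo `y`, and dividing the relation by `y`
lowers the degrees. Hence the dimension of `B / (y)` is at most `[K : F(y)]`. -/
theorem finite_quotient_span {B : Type*} [CommRing B] [Algebra F B] [Algebra B K]
    [IsScalarTower F B K] (hinj : Function.Injective (algebraMap B K)) (y : B)
    (hy : Transcendental F (algebraMap B K y))
    [FiniteDimensional (IntermediateField.adjoin F {algebraMap B K y}) K] :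
    Module.Finite F (B ⧸ Ideal.span {y}) := by
  set t := algebraMap B K y with ht
  have ht0 : t ≠ 0 := by
    intro h; rw [h] at hy; exact hy (isAlgebraic_zero)
  have hrank : Module.rank F (B ⧸ Ideal.span {y}) ≤
      Module.finrank (IntermediateField.adjoin F {t}) K := by
    refine rank_le fun s hs => ?_
    choose x hx using fun i : s => Ideal.Quotient.mk_surjective (I := Ideal.span {y}) (i : B ⧸ _)
    have key : ∀ N : ℕ, ∀ P : s → F[X], (∀ i, (P i).natDegree < N) →
        ∑ i, aeval t (P i) * algebraMap B K (x i) = 0 → ∀ i, P i = 0 := by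
      intro N
      induction N with
      | zero => intro P hP _ i; exact absurd (hP i) (Nat.not_lt_zero _)
      | succ N ih =>
        intro P hP hsum
        have hdec : ∀ i, P i = X * (P i).divX + C ((P i).coeff 0) := fun i => by
          rw [X_mul]; exact ((P i).divX_mul_X_add).symm
        have hev : ∀ i, aeval t (P i) = t * aeval t (P i).divX + algebraMap F K ((P i).coeff 0) := by
          intro i
          conv_lhs => rw [hdec i]
          rw [map_add, map_mul, aeval_X, aeval_C]
        have h0 : ∑ i, (P i).coeff 0 • (i : B ⧸ Ideal.span {y}) = 0 := by
          have hB : ∑ i, algebraMap F B ((P i).coeff 0) * x i =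
              -(y * ∑ i, aeval y (P i).divX * x i) := by
            apply hinj
            rw [map_neg, map_mul, map_sum, map_sum, eq_neg_iff_add_eq_zero, Finset.mul_sum,
              ← Finset.sum_add_distrib, ← hsum]
            refine Finset.sum_congr rfl fun i _ => ?_
            rw [hev, map_mul, map_mul, ← aeval_algebraMap_apply, ← ht,
              ← IsScalarTower.algebraMap_apply]
            ring
          have hq := congrArg (Ideal.Quotient.mk (Ideal.span {y})) hB
          rw [map_neg, map_mul, Ideal.Quotient.eq_zero_iff_mem.2 (Ideal.mem_span_singleton_self y),
            zero_mul, neg_zero, map_sum] at hq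
          rw [← hq]
          refine Finset.sum_congr rfl fun i _ => ?_
          rw [map_mul, hx, Algebra.smul_def]
          rfl
        have hc : ∀ i, (P i).coeff 0 = 0 := by
          rw [Fintype.linearIndependent_iff] at hs
          exact hs _ h0
        by_cases hN : N = 0
        · subst hN
          intro i
          have := hP i
          rw [eq_C_of_natDegree_eq_zero (p := P i) (by omega), hc i, C_0]
        have h1 : ∀ i, (P i).divX = 0 := by
          refine ih (fun i => (P i).divX) (fun i => ?_) ?_
          · have := hP i
            rw [natDegree_divX_eq_natDegree_tsub_one]
            omega
          · have : t * ∑ i, aeval t (P i).divX * algebraMap B K (x i) = 0 := by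
              rw [← hsum, Finset.mul_sum]
              refine Finset.sum_congr rfl fun i _ => ?_
              rw [hev, hc i, map_zero, add_zero, mul_assoc]
            exact (mul_eq_zero.1 this).resolve_left ht0
        intro i
        rw [hdec i, h1 i, hc i]; simp
    have hind : LinearIndependent (IntermediateField.adjoin F {t})
        (fun i => algebraMap B K (x i)) := by
      rw [Fintype.linearIndependent_iff]
      intro g hg
      choose p q hpq using fun i => IntermediateField.mem_adjoin_simple_iff F _ |>.1 (g i).2
      by_contra hne
      push Not at hne
      obtain ⟨i₀, hi₀⟩ := hne
      have hq : ∀ i, aeval t (q i) ≠ 0 ∨ (g i : K) = 0 := by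
        intro i
        by_cases h : aeval t (q i) = 0
        · right; rw [hpq i, h, div_zero]
        · left; exact h
      classical
      -- clear denominators
      let q' : s → F[X] := fun i => if aeval t (q i) = 0 then 1 else q i
      let p' : s → F[X] := fun i => if aeval t (q i) = 0 then 0 else p i
      have hq' : ∀ i, aeval t (q' i) ≠ 0 := by
        intro i; by_cases h : aeval t (q i) = 0 <;> simp [q', h]
      have hp' : ∀ i, (g i : K) = aeval t (p' i) / aeval t (q' i) := by
        intro i; by_cases h : aeval t (q i) = 0
        · simp [q', p', h]; simpa [h] using hpq i
        · simp only [q', p', h, if_false]; exact hpq i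
      have hsum : ∑ i, aeval t (p' i * ∏ j ∈ Finset.univ.erase i, q' j) *
          algebraMap B K (x i) = 0 := by
        have h1 := congrArg (fun z => (∏ j, aeval t (q' j)) * z) hg
        simp only [mul_zero, Finset.mul_sum] at h1
        rw [← h1]
        refine Finset.sum_congr rfl fun i _ => ?_
        rw [IntermediateField.smul_def, smul_eq_mul, hp' i, map_mul, map_prod,
          ← Finset.mul_prod_erase Finset.univ _ (Finset.mem_univ i)]
        have := hq' i
        field_simp
      have h2 := key (Finset.univ.sup (fun i => (p' i * ∏ j ∈ Finset.univ.erase i, q' j).natDegree)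
        + 1) (fun i => p' i * ∏ j ∈ Finset.univ.erase i, q' j)
        (fun i => Nat.lt_succ_of_le (Finset.le_sup (f := fun i =>
          (p' i * ∏ j ∈ Finset.univ.erase i, q' j).natDegree) (Finset.mem_univ i))) hsum i₀
      rcases mul_eq_zero.1 h2 with h3 | h3
      · apply hi₀
        apply Subtype.ext
        rw [hp', h3]; simp
      · obtain ⟨j, _, hj⟩ := Finset.prod_eq_zero_iff.1 h3
        exact hq' j (by rw [hj, map_zero])
    simpa using hind.fintype_card_le_finrank
  rw [← Module.rank_lt_aleph0_iff]
  exact hrank.trans_lt (Cardinal.natCast_lt_aleph0)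

/-- The image of `I` modulo `(f)` is finite, and the kernel `(f)` has one generator. -/
theorem ideal_fg_of_finite_quotient {B : Type*} [CommRing B] {I : Ideal B} {f : B} (hf : f ∈ I)
    [Finite (B ⧸ Ideal.span {f})] : I.FG := by
  have hker : LinearMap.ker (Submodule.mkQ (Ideal.span {f} : Ideal B)) = Ideal.span {f} :=
    Submodule.ker_mkQ _
  refine Submodule.fg_of_fg_map_of_fg_inf_ker (Submodule.mkQ (Ideal.span {f} : Ideal B)) ?_ ?_
  · have : Module.Finite B (B ⧸ Ideal.span {f}) := inferInstance
    have hfin : Finite (Submodule.map (Submodule.mkQ (Ideal.span {f} : Ideal B)) I) := inferInstance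
    exact Module.Finite.iff_fg.1 inferInstance
  · rw [hker, inf_eq_right.2 ((Ideal.span_singleton_le_iff_mem I).2 hf)]
    exact ⟨{f}, by simp [Ideal.span]⟩

end FunctionField

/-! ### Poles, constants, and discreteness of `A` -/

section RegularRing

open Polynomial

variable {F K : Type*} [Field F] [Finite F] [Field K] [Algebra F K]

/-- An algebraic `f` is a nonzero constant, hence a unit; a transcendental one falls under
`finite_quotient_span`. -/
theorem IsFunctionField.finite_quotient (hK : IsFunctionField F K) {B : Type*} [CommRing B]
    [Algebra F B] [Algebra B K] [IsScalarTower F B K]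
    (hinj : Function.Injective (algebraMap B K)) {f : B} (hf : f ≠ 0) :
    Finite (B ⧸ Ideal.span {f}) := by
  by_cases ha : IsAlgebraic F (algebraMap B K f)
  · obtain ⟨c, hc⟩ := hK.constants _ ha
    have hfc : f = algebraMap F B c := hinj (by rw [← hc, ← IsScalarTower.algebraMap_apply])
    have hc0 : c ≠ 0 := by rintro rfl; rw [map_zero] at hfc; exact hf hfc
    have hu : IsUnit f := by rw [hfc]; exact (isUnit_iff_ne_zero.2 hc0).map _
    have : Subsingleton (B ⧸ Ideal.span {f}) :=
      Ideal.Quotient.subsingleton_iff.2 (Ideal.span_singleton_eq_top.2 hu)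
    infer_instance
  · have := hK.finiteDimensional ha
    have := finite_quotient_span hinj f ha
    exact Module.finite_of_finite F

theorem IsFunctionField.isNoetherianRing (hK : IsFunctionField F K) {B : Type*} [CommRing B]
    [Algebra F B] [Algebra B K] [IsScalarTower F B K]
    (hinj : Function.Injective (algebraMap B K)) : IsNoetherianRing B := by
  refine isNoetherianRing_iff_ideal_fg B |>.2 fun I => ?_
  by_cases hI : I = ⊥
  · rw [hI]; exact Submodule.fg_bot
  · obtain ⟨f, hfI, hf⟩ := Submodule.exists_mem_ne_zero_of_ne_bot hI
    have := hK.finite_quotient hinj hf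
    exact ideal_fg_of_finite_quotient hfI

/-- A nonconstant function has a pole. -/
theorem IsFunctionField.exists_pole (hK : IsFunctionField F K) {x : K} (hx : Transcendental F x) :
    ∃ P : Place F K, x ∉ P.ring := by
  set y := x⁻¹ with hy
  have hx0 : x ≠ 0 := by rintro rfl; exact hx isAlgebraic_zero
  have hyt : Transcendental F y := fun h => hx (by simpa [hy] using h.inv)
  let R : Subring K := (Algebra.adjoin F {y}).toSubring
  let y' : R := ⟨y, Algebra.self_mem_adjoin_singleton F y⟩
  -- An equation `y p(y) = 1` would be an algebraic relation for `y`.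
  have hI : (Ideal.span {y'} : Ideal R) ≠ ⊤ := by
    rw [Ne, Ideal.span_singleton_eq_top, isUnit_iff_exists_inv]
    rintro ⟨⟨b, hb⟩, h⟩
    have h1 : y * b = 1 := congrArg Subtype.val h
    have hb' : b ∈ Algebra.adjoin F {y} := hb
    rw [Algebra.adjoin_singleton_eq_range_aeval] at hb'
    obtain ⟨p, rfl⟩ := hb'
    have h2 : aeval y (X * p - 1) = 0 := by
      rw [map_sub, map_mul, aeval_X, map_one, sub_eq_zero]; exact h1
    have h3 := (transcendental_iff.1 hyt) _ h2
    have h4 := congrArg (fun q => coeff q 0) h3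
    simp at h4
  -- Chevalley: some valuation ring contains `F[y]` and has `y` in its maximal ideal. It is
  -- Noetherian with finite residue field because it is a ring between `F` and `K`, so it is a
  -- place, and `x = y⁻¹` is a pole there.
  obtain ⟨V, hRV, hV⟩ := Ideal.image_subset_nonunits_valuationSubring _ hI
  have hF : ∀ c : F, algebraMap F K c ∈ V := fun c =>
    hRV (show algebraMap F K c ∈ Algebra.adjoin F {y} from Subalgebra.algebraMap_mem _ c)
  have hyV : y ∈ V.nonunits := hV ⟨y', Ideal.mem_span_singleton_self y', rfl⟩
  let _ : Algebra F V := RingHom.toAlgebra ((algebraMap F K).codRestrict V.toSubring hF)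
  have : IsScalarTower F V K := IsScalarTower.of_algebraMap_eq fun c => rfl
  have hinj : Function.Injective (algebraMap V K) := Subtype.val_injective
  have := hK.isNoetherianRing hinj
  have hyVmem : y ∈ V := V.nonunits_le hyV
  have hym : (⟨y, hyVmem⟩ : V) ∈ IsLocalRing.maximalIdeal V := by
    obtain ⟨h1, h2⟩ := ValuationSubring.mem_nonunits_iff_exists_mem_maximalIdeal.1 hyV
    exact h2
  have hy0 : (⟨y, hyVmem⟩ : V) ≠ 0 := fun h => inv_ne_zero hx0 (congrArg Subtype.val h)
  have hnf : ¬ IsField V := by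
    intro h
    have h1 := IsLocalRing.isField_iff_maximalIdeal_eq.1 h
    rw [h1, Submodule.mem_bot] at hym
    exact hy0 hym
  have hvr : ValuationRing V := inferInstance
  have hdvr : IsDiscreteValuationRing V := by
    have h := (IsDiscreteValuationRing.TFAE V hnf).out 0 1
    exact h.2 hvr
  have hfin : Finite (IsLocalRing.ResidueField V) := by
    have := hK.finite_quotient hinj hy0
    have hle : Ideal.span {(⟨y, hyVmem⟩ : V)} ≤ IsLocalRing.maximalIdeal V :=
      (Ideal.span_singleton_le_iff_mem _).2 hym
    exact Finite.of_surjective _ (Ideal.Quotient.factor_surjective hle)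
  refine ⟨⟨V, hF, hdvr, hfin⟩, fun hxV => ?_⟩
  have hxV' : x ∈ V := hxV
  rw [IsLocalRing.mem_maximalIdeal, mem_nonunits_iff] at hym
  exact hym (isUnit_iff_exists_inv.2 ⟨⟨x, hxV'⟩, Subtype.ext (inv_mul_cancel₀ hx0)⟩)

variable {inf : Place F K}

/-- A function that is regular everywhere is constant. -/
theorem mem_range_of_abv_le_one (hK : IsFunctionField F K) {x : K} (hx : x ∈ regularRing inf)
    (h : inf.abv x ≤ 1) : x ∈ (algebraMap F K).range := by
  refine hK.constants x ?_
  by_contra hxt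
  obtain ⟨P, hP⟩ := hK.exists_pole hxt
  by_cases hPi : P = inf
  · rw [hPi] at hP; exact hP ((inf.abv_le_one_iff x).1 h)
  · exact hP (hx P hPi)

/-- With absolute value below one, `x` would have no pole and be a nonzero constant, but those have
absolute value one. -/
theorem one_le_abv (hK : IsFunctionField F K) {x : K} (hx : x ∈ regularRing inf) (h0 : x ≠ 0) :
    1 ≤ inf.abv x := by
  by_contra h
  push Not at h
  obtain ⟨c, rfl⟩ := mem_range_of_abv_le_one hK hx h.le
  have hc : c ≠ 0 := by rintro rfl; exact h0 (map_zero _)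
  rw [inf.abv_algebraMap hc] at h
  exact lt_irrefl _ h

/-- After scaling the ball into the unit ball, elements assigned to the same point of a fine finite
net differ by an element of `A` of absolute value below one, so they coincide. -/
theorem finite_regularRing_abv_le (hK : IsFunctionField F K) (R : ℝ) :
    {x : K | x ∈ regularRing inf ∧ inf.abv x ≤ R}.Finite := by
  obtain ⟨π, hπ0, hπ1, hπ⟩ := inf.exists_uniformizer
  have hpos := inf.abv.pos hπ0
  obtain ⟨k, hk⟩ := pow_unbounded_of_one_lt R ((one_lt_inv₀ hpos).2 hπ1)
  -- distinct elements of the ball differ by at least one in absolute value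
  obtain ⟨T, -, hT⟩ := inf.exists_finite_net (η := inf.abv π ^ (k + 1)) (pow_pos hpos _)
  have hmem : ∀ x : {x : K | x ∈ regularRing inf ∧ inf.abv x ≤ R}, ∃ a ∈ T,
      inf.abv ((x : K) * π ^ k - a) ≤ inf.abv π ^ (k + 1) := by
    intro x
    refine hT _ ?_
    rw [map_mul, map_pow]
    calc inf.abv x * inf.abv π ^ k ≤ (inf.abv π)⁻¹ ^ k * inf.abv π ^ k :=
          mul_le_mul_of_nonneg_right (x.2.2.trans hk.le) (pow_pos hpos k).le
      _ = 1 := by rw [inv_pow, inv_mul_cancel₀ (pow_pos hpos k).ne']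
  choose a haT ha using hmem
  refine Set.finite_coe_iff.1 ?_
  refine Finite.of_injective (fun x => (⟨a x, haT x⟩ : T)) fun x y hxy => ?_
  have hxy' : a x = a y := congrArg Subtype.val hxy
  by_contra hne
  have h1 : inf.abv (((x : K) - y) * π ^ k) ≤ inf.abv π ^ (k + 1) := by
    have h2 : ((x : K) - y) * π ^ k = ((x : K) * π ^ k - a x) + -((y : K) * π ^ k - a y) := by
      rw [hxy']; ring
    rw [h2]
    refine (inf.abv_add_le _ _).trans (max_le (ha x) ?_)
    rw [AbsoluteValue.map_neg]; exact ha y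
  have h3 : 1 ≤ inf.abv ((x : K) - y) := one_le_abv hK (sub_mem x.2.1 y.2.1)
    (sub_ne_zero.2 fun h => hne (Subtype.ext h))
  rw [map_mul, map_pow, pow_succ] at h1
  nlinarith [pow_pos hpos k]

end RegularRing

/-! ### `A` as a Dedekind domain, and approximation of `K` by `A` -/

section Dedekind

open Polynomial

variable {F K : Type*} [Field F] [Finite F] [Field K] [Algebra F K] {inf : Place F K}

theorem mem_valuationSubring_of_isIntegral (R : Subalgebra F K) (V : ValuationSubring K)
    (h : ∀ x ∈ R, x ∈ V) {z : K} (hz : IsIntegral R z) : z ∈ V := by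
  let _ : Algebra R V := RingHom.toAlgebra (R.val.toRingHom.codRestrict V.toSubring fun x => h x x.2)
  have : IsScalarTower R V K := IsScalarTower.of_algebraMap_eq fun c => rfl
  have h1 : IsIntegral V z := hz.tower_top
  obtain ⟨y, hy⟩ := IsIntegrallyClosed.isIntegral_iff.1 h1
  rw [← hy]; exact y.2

theorem mem_regularRing_of_isIntegral {z : K} (hz : IsIntegral (regularRing inf) z) :
    z ∈ regularRing inf := fun P hP =>
  mem_valuationSubring_of_isIntegral (regularRing inf) P.ring (fun _ hx => hx P hP) hz

theorem IsFunctionField.isAlgebraic_adjoin (hK : IsFunctionField F K) {y : K}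
    (hy : Transcendental F y) : Algebra.IsAlgebraic (Algebra.adjoin F {y}) K := by
  have h1 : AlgebraicIndependent F (fun _ : Unit => y) := by
    rw [algebraicIndependent_unique_type_iff]; exact hy
  have h2 : IsTranscendenceBasis F (fun _ : Unit => y) := by
    refine h1.isTranscendenceBasis_of_lift_trdeg_le_of_finite ?_
    simp [hK.trdeg_eq_one]
  have := h2.isAlgebraic
  rwa [Set.range_const] at this

/-- `K` is algebraic over `F[t]`, so every `z` has a multiple by a nonzero element of `F[t]` that is
integral over `F[t]`; such a multiple lies in every valuation ring containing `F[t]`, hence in `A`.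
-/
theorem isFractionRing_regularRing (hK : IsFunctionField F K) {t : K} (ht : t ∈ regularRing inf)
    (htr : Transcendental F t) : IsFractionRing (regularRing inf) K := by
  refine IsFractionRing.of_field _ _ fun z => ?_
  have := hK.isAlgebraic_adjoin htr
  have hle : Algebra.adjoin F {t} ≤ regularRing inf := by
    rw [Algebra.adjoin_le_iff, Set.singleton_subset_iff]; exact ht
  obtain ⟨y, hy0, hy⟩ := (Algebra.IsAlgebraic.isAlgebraic (R := Algebra.adjoin F {t}) z).exists_integral_multiple
  have hmem : (y : K) * z ∈ regularRing inf := fun P hP =>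
    mem_valuationSubring_of_isIntegral _ P.ring (fun x hx => hle hx P hP)
      (by rwa [Algebra.smul_def] at hy)
  have hy0' : (y : K) ≠ 0 := fun h => hy0 (Subtype.ext h)
  refine ⟨⟨_, hmem⟩, ⟨y, hle y.2⟩, ?_⟩
  change z = (y * z) / y
  field_simp

/-- Quotients by nonzero primes are finite domains, hence fields, and an intersection of valuation
rings is integrally closed. -/
theorem isDedekindDomain_regularRing (hK : IsFunctionField F K) {t : K}
    (ht : t ∈ regularRing inf) (htr : Transcendental F t) :
    IsDedekindDomain (regularRing inf) := by
  have hinj : Function.Injective (algebraMap (regularRing inf) K) := Subtype.val_injective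
  have h1 : IsNoetherianRing (regularRing inf) := hK.isNoetherianRing hinj
  have h2 := isFractionRing_regularRing hK ht htr
  have h3 : Ring.DimensionLEOne (regularRing inf) := by
    refine ⟨fun {p} hp hpr => ?_⟩
    obtain ⟨f, hfp, hf⟩ := Submodule.exists_mem_ne_zero_of_ne_bot hp
    have := hK.finite_quotient hinj hf
    have hle : Ideal.span {f} ≤ p := (Ideal.span_singleton_le_iff_mem _).2 hfp
    have hfin : Finite (regularRing inf ⧸ p) :=
      Finite.of_surjective _ (Ideal.Quotient.factor_surjective hle)
    exact Ideal.Quotient.maximal_of_isField _ (Finite.isField_of_domain _)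
  have h4 : IsDedekindRing (regularRing inf) :=
    (isDedekindRing_iff (regularRing inf) K).2 ⟨h1, h3, fun {x} hx =>
      ⟨⟨x, mem_regularRing_of_isIntegral hx⟩, rfl⟩⟩
  exact { h4 with }

/-- A proper ideal contains no nonzero constant. The resulting nonconstant `t` is the auxiliary
function that most later lemmas carry along: its powers have unbounded absolute value. -/
theorem exists_transcendental_of_ideal (hK : IsFunctionField F K)
    {n : Ideal (regularRing inf)} (hn0 : n ≠ ⊥) (hn1 : n ≠ ⊤) :
    ∃ t ∈ regularRing inf, Transcendental F t := by
  obtain ⟨f, hfn, hf⟩ := Submodule.exists_mem_ne_zero_of_ne_bot hn0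
  refine ⟨f, f.2, fun ha => hn1 ?_⟩
  obtain ⟨c, hc⟩ := hK.constants _ ha
  have hfc : f = algebraMap F (regularRing inf) c := Subtype.ext hc.symm
  have hc0 : c ≠ 0 := by rintro rfl; rw [map_zero] at hfc; exact hf hfc
  exact Ideal.eq_top_of_isUnit_mem _ hfn (by rw [hfc]; exact (isUnit_iff_ne_zero.2 hc0).map _)

theorem one_lt_abv (hK : IsFunctionField F K) {t : K} (ht : t ∈ regularRing inf)
    (htr : Transcendental F t) : 1 < inf.abv t := by
  by_contra h
  push Not at h
  obtain ⟨c, rfl⟩ := mem_range_of_abv_le_one hK ht h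
  exact htr (isAlgebraic_algebraMap c)

/-- Coefficients have absolute value at most one, so the leading term dominates. -/
theorem abv_aeval {t : K} (ht : 1 < inf.abv t) {p : F[X]} (hp : p ≠ 0) :
    inf.abv (aeval t p) = inf.abv t ^ p.natDegree := by
  have hna : IsNonarchimedean inf.abv := inf.abv_add_le
  induction hn : p.natDegree generalizing p with
  | zero =>
    rw [eq_C_of_natDegree_eq_zero hn] at hp ⊢
    rw [aeval_C, inf.abv_algebraMap (by simpa using hp), pow_zero]
  | succ n ih =>
    have hd : p.divX.natDegree = n := by rw [natDegree_divX_eq_natDegree_tsub_one]; omega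
    have hd0 : p.divX ≠ 0 := by
      intro h
      have := p.divX_mul_X_add
      rw [h, zero_mul, zero_add] at this
      rw [← this, natDegree_C] at hn
      omega
    have h1 : inf.abv (aeval t (p.divX * X)) = inf.abv t ^ (n + 1) := by
      rw [map_mul, aeval_X, map_mul, ih hd0 hd, pow_succ]
    have h2 : inf.abv (aeval t (C (p.coeff 0))) < inf.abv (aeval t (p.divX * X)) := by
      rw [h1, aeval_C]
      exact (inf.abv_algebraMap_le_one _).trans_lt (one_lt_pow₀ ht (Nat.succ_ne_zero n))
    conv_lhs => rw [← p.divX_mul_X_add]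
    rw [map_add, hna.add_eq_max_of_ne h2.ne', max_eq_left h2.le, h1]

/-- Every element of `K` is within bounded distance of the ring `A`. -/
theorem exists_abv_sub_le (hK : IsFunctionField F K) {t : K} (ht : t ∈ regularRing inf)
    (htr : Transcendental F t) :
    ∃ C : ℝ, ∀ x : K, ∃ a ∈ regularRing inf, inf.abv (x - a) ≤ C := by
  classical
  have h1 := one_lt_abv hK ht htr
  have hfd := hK.finiteDimensional htr
  have hfr := isFractionRing_regularRing hK ht htr
  let e := Module.finBasis (IntermediateField.adjoin F {t}) K
  -- A common denominator `b` moves an `F(t)`-basis of `K` into `A`, which reduces the claim to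
  -- approximating elements of `F(t)` by polynomials in `t`.
  obtain ⟨b, hb⟩ := IsLocalization.exist_integer_multiples_of_finite
    (nonZeroDivisors (regularRing inf)) e
  have hb0 : ((b : regularRing inf) : K) ≠ 0 := fun h =>
    nonZeroDivisors.coe_ne_zero b (Subtype.ext h)
  choose w hw using hb
  -- Division with remainder: the fractional part `(p % q) / q` has absolute value at most one by
  -- comparison of degrees.
  have happ : ∀ c : IntermediateField.adjoin F {t}, ∃ d ∈ regularRing inf,
      inf.abv ((c : K) - d) ≤ 1 := by
    intro c
    obtain ⟨p, q, hpq⟩ := (IntermediateField.mem_adjoin_simple_iff F _).1 c.2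
    by_cases hq : q = 0
    · refine ⟨0, zero_mem _, ?_⟩
      rw [hpq, hq]; simp
    have hqt : aeval t q ≠ 0 := fun h => hq (transcendental_iff.1 htr _ h)
    refine ⟨aeval t (p / q), ?_, ?_⟩
    · have hle : Algebra.adjoin F {t} ≤ regularRing inf := by
        rw [Algebra.adjoin_le_iff, Set.singleton_subset_iff]; exact ht
      exact hle (aeval_mem_adjoin_singleton F t)
    · have h2 : (c : K) - aeval t (p / q) = aeval t (p % q) / aeval t q := by
        rw [hpq]
        have : p = q * (p / q) + p % q := (EuclideanDomain.div_add_mod p q).symm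
        conv_lhs => enter [1, 1]; rw [this]
        rw [map_add, map_mul]
        field_simp
        ring
      rw [h2]
      by_cases hr : p % q = 0
      · rw [hr]; simp
      rw [map_div₀, abv_aeval h1 hq, abv_aeval h1 hr]
      refine div_le_one_of_le₀ (pow_le_pow_right₀ h1.le ?_) (by positivity)
      exact natDegree_le_natDegree (EuclideanDomain.mod_lt p hq).le
  have hna : IsNonarchimedean inf.abv := inf.abv_add_le
  refine ⟨∑ j, inf.abv (w j : K), fun x => ?_⟩
  choose d hd1 hd2 using fun j => happ (e.repr (x / (b : regularRing inf)) j)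
  refine ⟨∑ j, d j * w j, sum_mem fun j _ => mul_mem (hd1 j) (w j).2, ?_⟩
  have hx : x = ∑ j, (e.repr (x / (b : regularRing inf)) j : K) * w j := by
    have h3 := e.sum_repr (x / (b : regularRing inf))
    have h4 := congrArg (fun z => ((b : regularRing inf) : K) * z) h3
    rw [mul_div_cancel₀ _ hb0] at h4
    refine h4.symm.trans ?_
    rw [Finset.mul_sum]
    refine Finset.sum_congr rfl fun j _ => ?_
    have h5 : (w j : K) = (b : regularRing inf) * e j := by
      have := hw j
      rw [Algebra.smul_def] at this
      exact this
    rw [h5, IntermediateField.smul_def, smul_eq_mul]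
    ring
  have h6 : x - ∑ j, d j * (w j : K) =
      ∑ j, ((e.repr (x / (b : regularRing inf)) j : K) - d j) * w j := by
    conv_lhs => rw [hx]
    rw [← Finset.sum_sub_distrib]
    refine Finset.sum_congr rfl fun j _ => (sub_mul _ _ _).symm
  rw [h6]
  refine (inf.abv.sum_le _ _).trans (Finset.sum_le_sum fun j _ => ?_)
  rw [map_mul]
  exact mul_le_of_le_one_left (inf.abv.nonneg _) (hd2 j)

end Dedekind

/-! ### Residue field and value group of `C_∞` -/

section CompletedClosure

open Polynomial

variable {F K : Type*} [Field F] [Finite F] [Field K] [Algebra F K] {inf : Place F K}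

/-- The inclusion of the algebraic closure of `K_∞` in `C_∞`. -/
def algClToCinf (inf : Place F K) : AlgCl inf →+* Cinf inf :=
  (UniformSpace.Completion.coeRingHom : AlgCl inf →+* UniformSpace.Completion (AlgCl inf))

theorem norm_algClToCinf (x : AlgCl inf) : ‖algClToCinf inf x‖ = ‖x‖ :=
  UniformSpace.Completion.norm_coe (E := AlgCl inf) x

theorem AlgCl.norm_add_le (x y : AlgCl inf) : ‖x + y‖ ≤ max ‖x‖ ‖y‖ :=
  isNonarchimedean_spectralNorm (K := Kinf inf) (L := AlgCl inf) x y

instance : IsUltrametricDist (Cinf inf) := by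
  refine IsUltrametricDist.isUltrametricDist_of_forall_norm_add_le_max_norm fun x y => ?_
  change UniformSpace.Completion (AlgCl inf) at x
  change UniformSpace.Completion (AlgCl inf) at y
  change ‖x + y‖ ≤ max ‖x‖ ‖y‖
  induction x, y using UniformSpace.Completion.induction_on₂ with
  | hp =>
    exact isClosed_le (continuous_norm.comp (continuous_fst.add continuous_snd))
      ((continuous_norm.comp continuous_fst).max (continuous_norm.comp continuous_snd))
  | ih a b =>
    rw [← UniformSpace.Completion.coe_add, UniformSpace.Completion.norm_coe,
      UniformSpace.Completion.norm_coe, UniformSpace.Completion.norm_coe]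
    exact AlgCl.norm_add_le a b

instance : Algebra F (Cinf inf) := ((algebraMap K (Cinf inf)).comp (algebraMap F K)).toAlgebra

instance : IsScalarTower F K (Cinf inf) := IsScalarTower.of_algebraMap_eq fun _ => rfl

theorem norm_algebraMap_const {c : F} (hc : c ≠ 0) : ‖algebraMap F (Cinf inf) c‖ = 1 := by
  rw [IsScalarTower.algebraMap_apply F K, norm_algebraMap_Cinf, inf.abv_algebraMap hc]

instance : IsAlgClosed (AlgCl inf) := IsAlgClosure.isAlgClosed (Kinf inf)

/-- The roots of `X^(p^m) - X` form a field: the nonzero ones have norm one because a power of the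
norm is one, and a difference of two roots is again a root. -/
theorem exists_separated_finset (inf : Place F K) (M : ℕ) : ∃ T : Finset (Cinf inf), M ≤ T.card ∧
    (∀ x ∈ T, ‖x‖ ≤ 1) ∧ ∀ x ∈ T, ∀ y ∈ T, x ≠ y → ‖x - y‖ = 1 := by
  classical
  obtain ⟨p, hp⟩ := CharP.exists F
  have hpp : p.Prime := (CharP.char_is_prime_or_zero F p).resolve_right
    (CharP.char_ne_zero_of_finite F p)
  have : Fact p.Prime := ⟨hpp⟩
  let f : F →+* AlgCl inf := (algebraMap (Kinf inf) (AlgCl inf)).comp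
      ((UniformSpace.Completion.coeRingHom : WithAbs inf.abv →+* inf.abv.Completion).comp
        ((WithAbs.equiv inf.abv).symm.toRingHom.comp (algebraMap F K)))
  have hchar : CharP (AlgCl inf) p := charP_of_injective_ringHom f.injective p
  have hroot : ∀ m : ℕ, ∀ x : AlgCl inf, x ^ p ^ m = x → x ≠ 0 → m ≠ 0 → ‖x‖ = 1 := by
    intro m x hx hx0 hm
    have h1 : ‖x‖ ^ p ^ m = ‖x‖ := by rw [← norm_pow, hx]
    have h2 : 1 < p ^ m := Nat.one_lt_pow hm hpp.one_lt
    obtain ⟨k, hk⟩ := Nat.exists_eq_add_of_lt h2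
    rw [show p ^ m = (k + 1) + 1 by omega, pow_succ] at h1
    have h3 : ‖x‖ ^ (k + 1) = 1 := by
      have := norm_pos_iff.2 hx0
      exact mul_right_cancel₀ this.ne' (by rw [h1, one_mul])
    exact (pow_eq_one_iff_of_nonneg (norm_nonneg _) (Nat.succ_ne_zero k)).1 h3
  have hM : M ≤ p ^ (M + 1) := ((Nat.lt_pow_self hpp.one_lt).le.trans
    (Nat.pow_le_pow_right hpp.pos (Nat.le_succ M)))
  let P : (AlgCl inf)[X] := X ^ p ^ (M + 1) - X
  have hdeg : P.natDegree = p ^ (M + 1) :=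
    FiniteField.X_pow_card_pow_sub_X_natDegree_eq _ (Nat.succ_ne_zero M) hpp.one_lt
  have hP0 : P ≠ 0 := FiniteField.X_pow_card_pow_sub_X_ne_zero _ (Nat.succ_ne_zero M) hpp.one_lt
  have hsep : P.Separable := galois_poly_separable p _ (dvd_pow_self p (Nat.succ_ne_zero M))
  have hcard : P.roots.toFinset.card = p ^ (M + 1) := by
    rw [Multiset.toFinset_card_of_nodup (nodup_roots hsep), ← hdeg]
    exact splits_iff_card_roots.1 (IsAlgClosed.splits P)
  have hmem : ∀ x, x ∈ P.roots.toFinset → x ^ p ^ (M + 1) = x := by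
    intro x hx
    rw [Multiset.mem_toFinset, mem_roots hP0, IsRoot.def] at hx
    simpa [P, sub_eq_zero] using hx
  refine ⟨P.roots.toFinset.image (algClToCinf inf), ?_, ?_, ?_⟩
  · rw [Finset.card_image_of_injective _ (algClToCinf inf).injective, hcard]; exact hM
  · intro x hx
    obtain ⟨a, ha, rfl⟩ := Finset.mem_image.1 hx
    rw [norm_algClToCinf]
    by_cases h0 : a = 0
    · rw [h0, norm_zero]; exact zero_le_one
    · exact (hroot _ a (hmem a ha) h0 (Nat.succ_ne_zero M)).le
  · intro x hx y hy hxy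
    obtain ⟨a, ha, rfl⟩ := Finset.mem_image.1 hx
    obtain ⟨b, hb, rfl⟩ := Finset.mem_image.1 hy
    rw [← map_sub, norm_algClToCinf]
    refine hroot (M + 1) _ ?_ ?_ (Nat.succ_ne_zero M)
    · rw [sub_pow_char_pow, hmem a ha, hmem b hb]
    · intro h; exact hxy (by rw [sub_eq_zero.1 h])

/-- An `m`-th root of `π⁻¹` has norm above one but below `b / a` for large `m`, so some power of it
has norm strictly between `a` and `b`. -/
theorem exists_norm_between (inf : Place F K) {a b : ℝ} (ha : 0 < a) (hab : a < b) :
    ∃ x : Cinf inf, a < ‖x‖ ∧ ‖x‖ < b := by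
  obtain ⟨π, hπ0, hπ1, -⟩ := inf.exists_uniformizer
  have hpos := inf.abv.pos hπ0
  obtain ⟨m, hm⟩ := pow_unbounded_of_one_lt (inf.abv π)⁻¹ ((one_lt_div ha).2 hab)
  have hinv : 1 < (inf.abv π)⁻¹ := (one_lt_inv₀ hpos).2 hπ1
  have hm0 : 0 < m := by
    rcases Nat.eq_zero_or_pos m with rfl | h
    · rw [pow_zero] at hm; linarith
    · exact h
  let w : AlgCl inf := algebraMap (Kinf inf) (AlgCl inf)
    ((WithAbs.toAbs inf.abv π⁻¹ : WithAbs inf.abv) : Kinf inf)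
  obtain ⟨y, hy⟩ := IsAlgClosed.exists_pow_nat_eq w hm0
  have hw : ‖w‖ = (inf.abv π)⁻¹ := by
    have h1 := norm_algClToCinf w
    have h2 : algClToCinf inf w = algebraMap K (Cinf inf) π⁻¹ := rfl
    rw [← h1, h2, norm_algebraMap_Cinf, map_inv₀]
  have hyn : ‖y‖ ^ m = (inf.abv π)⁻¹ := by rw [← norm_pow, hy, hw]
  have hy1 : 1 < ‖y‖ := by
    by_contra h
    push Not at h
    have := pow_le_one₀ (n := m) (norm_nonneg y) h
    linarith
  have hy2 : ‖y‖ < b / a := lt_of_pow_lt_pow_left₀ m (div_pos (ha.trans hab) ha).le (by rw [hyn]; exact hm)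
  obtain ⟨k, hk⟩ := exists_mem_Ico_zpow ha hy1
  refine ⟨algClToCinf inf (y ^ (k + 1)), ?_, ?_⟩
  · rw [norm_algClToCinf, norm_zpow]; exact hk.2
  · rw [norm_algClToCinf, norm_zpow, zpow_add_one₀ (zero_lt_one.trans hy1).ne']
    calc ‖y‖ ^ k * ‖y‖ ≤ a * ‖y‖ := by gcongr; exact hk.1
      _ < a * (b / a) := by gcongr
      _ = b := by field_simp

end CompletedClosure

/-! ### Exponential functions of finite additive groups -/

section FiniteExponential

open Polynomial

variable {C : Type*} [Field C]

open Classical in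
/-- The exponential function `z ∏ (1 - z / g)` of a finite set `G`, usually a subgroup. -/
def finExp (G : Finset C) (z : C) : C := z * ∏ g ∈ G.erase 0, (1 - z / g)

/-- `∏ (X - g)` is additive if `G` is a finite subgroup. -/
theorem prod_sub_add {G : Finset C} (h0 : (0 : C) ∈ G) (hG : ∀ x ∈ G, ∀ y ∈ G, x - y ∈ G)
    (y : C) : (∏ g ∈ G, (X - Polynomial.C g)).comp (X + Polynomial.C y) =
      (∏ g ∈ G, (X - Polynomial.C g)) + Polynomial.C (∏ g ∈ G, (y - g)) := by
  set f : C[X] := ∏ g ∈ G, (X - Polynomial.C g) with hf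
  have hneg : ∀ x ∈ G, -x ∈ G := fun x hx => by simpa using hG 0 h0 x hx
  have hadd : ∀ x ∈ G, ∀ y ∈ G, x + y ∈ G := fun x hx y hy => by
    simpa using hG x hx (-y) (hneg y hy)
  have hmonic : f.Monic := monic_prod_of_monic _ _ fun g _ => monic_X_sub_C g
  have hdeg : f.natDegree = G.card := by
    rw [hf, natDegree_prod_of_monic _ _ fun g _ => monic_X_sub_C g]; simp
  have hmonic' : (f.comp (X + Polynomial.C y)).Monic := hmonic.comp_X_add_C y
  have hdeg' : (f.comp (X + Polynomial.C y)).natDegree = G.card := by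
    rw [natDegree_comp, natDegree_X_add_C, mul_one, hdeg]
  have hpos : 0 < G.card := Finset.card_pos.2 ⟨0, h0⟩
  -- Both polynomials are monic of degree `|G|`, so the difference has smaller degree, and it
  -- vanishes at all points of `G` by translation invariance.
  have h1 : f.comp (X + Polynomial.C y) - f - Polynomial.C (∏ g ∈ G, (y - g)) = 0 := by
    refine eq_zero_of_degree_lt_of_eval_finset_eq_zero G ?_ ?_
    · refine (degree_sub_le _ _).trans_lt (max_lt ?_ ?_)
      · refine (degree_sub_lt_left ?_ hmonic'.ne_zero ?_).trans_eq ?_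
        · rw [degree_eq_natDegree hmonic'.ne_zero, degree_eq_natDegree hmonic.ne_zero, hdeg, hdeg']
        · rw [hmonic'.leadingCoeff, hmonic.leadingCoeff]
        · rw [degree_eq_natDegree hmonic'.ne_zero, hdeg']
      · exact degree_C_le.trans_lt (by exact_mod_cast hpos)
    · intro x hx
      have h2 : eval x f = 0 := by
        rw [hf, eval_prod]
        exact Finset.prod_eq_zero hx (by simp)
      have h3 : eval (x + y) f = ∏ g ∈ G, (y - g) := by
        rw [hf, eval_prod]
        refine Finset.prod_bij' (fun g _ => g - x) (fun g _ => g + x)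
          (fun g hg => hG g hg x hx) (fun g hg => hadd g hg x hx) (by simp) (by simp) ?_
        intro g _
        simp only [eval_sub, eval_X, eval_C]; ring
      rw [eval_sub, eval_sub, eval_comp, eval_add, eval_X, eval_C, h3, h2, eval_C]
      ring
  rw [sub_sub, sub_eq_zero] at h1
  exact h1

open Classical in
theorem prod_sub_eq_mul_finExp {G : Finset C} (h0 : (0 : C) ∈ G) (z : C) :
    ∏ g ∈ G, (z - g) = (∏ g ∈ G.erase 0, -g) * finExp G z := by
  rw [finExp, ← Finset.mul_prod_erase G _ h0, sub_zero, mul_left_comm, ← Finset.prod_mul_distrib]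
  congr 1
  refine Finset.prod_congr rfl fun g hg => ?_
  have : g ≠ 0 := Finset.ne_of_mem_erase hg
  field_simp
  ring

open Classical in
theorem prod_neg_ne_zero (G : Finset C) : (∏ g ∈ G.erase 0, -g) ≠ 0 :=
  Finset.prod_ne_zero_iff.2 fun _ hg => neg_ne_zero.2 (Finset.ne_of_mem_erase hg)

theorem finExp_add {G : Finset C} (h0 : (0 : C) ∈ G) (hG : ∀ x ∈ G, ∀ y ∈ G, x - y ∈ G)
    (x y : C) : finExp G (x + y) = finExp G x + finExp G y := by
  classical
  have h1 := congrArg (eval x) (prod_sub_add h0 hG y)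
  rw [eval_comp, eval_add, eval_X, eval_C, eval_add, eval_C, eval_prod, eval_prod] at h1
  simp only [eval_sub, eval_X, eval_C] at h1
  rw [prod_sub_eq_mul_finExp h0, prod_sub_eq_mul_finExp h0, prod_sub_eq_mul_finExp h0,
    ← mul_add] at h1
  exact mul_left_cancel₀ (prod_neg_ne_zero G) h1

theorem finExp_ne_zero {G : Finset C} (h0 : (0 : C) ∈ G) {x : C} (hx : x ∉ G) :
    finExp G x ≠ 0 := by
  classical
  intro h
  have h1 := prod_sub_eq_mul_finExp h0 x
  rw [h, mul_zero, Finset.prod_eq_zero_iff] at h1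
  obtain ⟨g, hg, hgx⟩ := h1
  exact hx (by rwa [sub_eq_zero.1 hgx])

theorem finExp_sub {G : Finset C} (h0 : (0 : C) ∈ G) (hG : ∀ x ∈ G, ∀ y ∈ G, x - y ∈ G)
    (x y : C) : finExp G (x - y) = finExp G x - finExp G y := by
  rw [eq_sub_iff_add_eq, ← finExp_add h0 hG, sub_add_cancel]

/-- The left side is the logarithmic derivative of `f = ∏ (X - g)` at `x`. By additivity `f'` is
constant, equal to `f'(0) = ∏_{g ≠ 0} (-g)`, which is also the factor between `f` and the
exponential. -/
theorem sum_inv_add_eq {G : Finset C} (h0 : (0 : C) ∈ G) (hG : ∀ x ∈ G, ∀ y ∈ G, x - y ∈ G)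
    {x : C} (hx : x ∉ G) : ∑ g ∈ G, (x + g)⁻¹ = (finExp G x)⁻¹ := by
  classical
  set f : C[X] := ∏ g ∈ G, (X - Polynomial.C g) with hf
  have hder : ∀ y, eval y (derivative f) = ∑ g ∈ G, ∏ h ∈ G.erase g, (y - h) := by
    intro y
    rw [hf, derivative_prod_finset, eval_finsetSum]
    refine Finset.sum_congr rfl fun g _ => ?_
    rw [derivative_X_sub_C, mul_one, eval_prod]
    simp
  have hconst : eval x (derivative f) = eval 0 (derivative f) := by
    have h1 := congrArg derivative (prod_sub_add h0 hG x)
    rw [← hf, derivative_comp, derivative_add, derivative_add, derivative_X, derivative_C,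
      derivative_C, add_zero, add_zero, one_mul] at h1
    have h2 := congrArg (eval 0) h1
    rwa [eval_comp, eval_add, eval_X, eval_C, zero_add] at h2
  have h00 : eval 0 (derivative f) = ∏ g ∈ G.erase 0, -g := by
    rw [hder, Finset.sum_eq_single 0]
    · simp
    · intro g hg hg0
      exact Finset.prod_eq_zero (i := 0) (Finset.mem_erase.2 ⟨hg0.symm, h0⟩) (sub_zero _)
    · intro h; exact absurd h0 h
  have hneg : ∑ g ∈ G, (x + g)⁻¹ = ∑ g ∈ G, (x - g)⁻¹ := by
    refine Finset.sum_bij' (fun g _ => -g) (fun g _ => -g) (fun g hg => by simpa using hG 0 h0 g hg)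
      (fun g hg => by simpa using hG 0 h0 g hg) (by simp) (by simp) (by simp)
  have hprod : ∏ g ∈ G, (x - g) ≠ 0 :=
    Finset.prod_ne_zero_iff.2 fun g hg h => hx (by rwa [sub_eq_zero.1 h])
  have hlog : (∑ g ∈ G, (x - g)⁻¹) * ∏ g ∈ G, (x - g) = eval x (derivative f) := by
    rw [hder, Finset.sum_mul]
    refine Finset.sum_congr rfl fun g hg => ?_
    have hne : x - g ≠ 0 := fun h => hx (by rwa [sub_eq_zero.1 h])
    rw [← Finset.mul_prod_erase G _ hg, ← mul_assoc, inv_mul_cancel₀ hne, one_mul]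
  rw [hconst, h00, prod_sub_eq_mul_finExp h0] at hlog
  rw [hneg]
  refine eq_inv_of_mul_eq_one_left (mul_left_cancel₀ (prod_neg_ne_zero G) ?_)
  rw [mul_one]
  exact (mul_left_comm _ _ _).trans hlog

/-- The product is `e(u - z) / e(u) = 1 - e(z) / e(u)` by additivity, and `1 / e(u)` is the sum of
inverses over the coset. -/
theorem prod_coset_eq {G : Finset C} (h0 : (0 : C) ∈ G) (hG : ∀ x ∈ G, ∀ y ∈ G, x - y ∈ G)
    {u : C} (hu : u ∉ G) (z : C) :
    ∏ g ∈ G, (1 - z / (u + g)) = 1 - finExp G z * ∑ g ∈ G, (u + g)⁻¹ := by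
  classical
  have hne : ∀ g ∈ G, u + g ≠ 0 := fun g hg h => hu (by
    rw [eq_neg_of_add_eq_zero_left h]; simpa using hG 0 h0 g hg)
  have hsymm : ∀ w : C, ∏ g ∈ G, (w + g) = ∏ g ∈ G, (w - g) := fun w =>
    Finset.prod_bij' (fun g _ => -g) (fun g _ => -g) (fun g hg => by simpa using hG 0 h0 g hg)
      (fun g hg => by simpa using hG 0 h0 g hg) (by simp) (by simp) (by simp)
  have h1 : ∏ g ∈ G, (1 - z / (u + g)) = (∏ g ∈ G, (u - z + g)) / ∏ g ∈ G, (u + g) := by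
    rw [← Finset.prod_div_distrib]
    refine Finset.prod_congr rfl fun g hg => ?_
    have := hne g hg
    field_simp
    ring
  rw [h1, hsymm, hsymm, prod_sub_eq_mul_finExp h0, prod_sub_eq_mul_finExp h0,
    mul_div_mul_left _ _ (prod_neg_ne_zero G), finExp_sub h0 hG, sum_inv_add_eq h0 hG hu,
    sub_div, div_self (finExp_ne_zero h0 hu), div_eq_mul_inv]

/-- The exponential function of a group in terms of that of a subgroup and the sums of inverses
over the nontrivial cosets. -/
theorem finExp_eq_mul_prod {J : Type*} [Fintype J] {G G' : Finset C} (h0 : (0 : C) ∈ G)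
    (hG : ∀ x ∈ G, ∀ y ∈ G, x - y ∈ G) (D : J → Finset C)
    (hdisj : ∀ i j, i ≠ j → Disjoint (D i) (D j)) (hGD : ∀ j, Disjoint G (D j))
    (hG' : ∀ x, x ∈ G' ↔ x ∈ G ∨ ∃ j, x ∈ D j)
    (hD : ∀ j, D j = ∅ ∨ ∃ u, u ∉ G ∧ ∀ x, x ∈ D j ↔ x - u ∈ G) (z : C) :
    finExp G' z = finExp G z * ∏ j, (1 - finExp G z * ∑ g ∈ D j, g⁻¹) := by
  classical
  have h1 : G'.erase 0 = (G.erase 0) ∪ Finset.univ.biUnion D := by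
    ext x
    simp only [Finset.mem_erase, Finset.mem_union, Finset.mem_biUnion, Finset.mem_univ, true_and,
      hG']
    constructor
    · rintro ⟨hx, h | h⟩
      · exact Or.inl ⟨hx, h⟩
      · exact Or.inr h
    · rintro (⟨hx, h⟩ | ⟨j, hj⟩)
      · exact ⟨hx, Or.inl h⟩
      · refine ⟨?_, Or.inr ⟨j, hj⟩⟩
        rintro rfl
        exact Finset.disjoint_left.1 (hGD j) h0 hj
  have h2 : Disjoint (G.erase 0) (Finset.univ.biUnion D) :=
    (Finset.disjoint_biUnion_right _ _ _).2 fun j _ =>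
      (hGD j).mono_left (Finset.erase_subset _ _)
  -- An empty `D j` gives one on both sides; this case is needed for classes that miss the subspace
  -- `U`.
  have h3 : ∀ j, ∏ g ∈ D j, (1 - z / g) = 1 - finExp G z * ∑ g ∈ D j, g⁻¹ := by
    intro j
    rcases hD j with h | ⟨u, hu, h⟩
    · rw [h]; simp
    · have h4 : D j = G.image (fun g => u + g) := by
        ext x
        rw [h, Finset.mem_image]
        constructor
        · intro hx; exact ⟨x - u, hx, by ring⟩
        · rintro ⟨g, hg, rfl⟩; simpa using hg
      have hinj : Set.InjOn (fun g => u + g) (G : Set C) := fun a _ b _ hab => add_left_cancel hab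
      rw [h4, Finset.prod_image hinj, Finset.sum_image hinj, prod_coset_eq h0 hG hu]
  rw [finExp, h1, Finset.prod_union h2, ← mul_assoc, Finset.prod_biUnion fun i _ j _ hij =>
    hdisj i j hij, Finset.prod_congr rfl fun j _ => h3 j]
  rfl

end FiniteExponential

/-! ### Exponential functions of discrete groups -/

section InfiniteExponential

open Filter Topology

theorem norm_sub_le_max_of_ultrametric {R : Type*} [SeminormedAddGroup R] [IsUltrametricDist R]
    (x y : R) : ‖x - y‖ ≤ max ‖x‖ ‖y‖ := by
  have := IsUltrametricDist.norm_add_le_max x (-y)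
  rwa [norm_neg, ← sub_eq_add_neg] at this

/-- Expanding the product reduces the claim to finite products `∏_{i ∈ s} a_i` tending to zero as
`s` varies. Only finitely many `a_i` have norm at least one, so all such products are bounded by a
constant `B`, and a product containing one very small factor is small. -/
theorem multipliable_one_add_of_tendsto_cofinite {ι R : Type*} [NormedField R]
    [IsUltrametricDist R] [CompleteSpace R] {a : ι → R} (ha : Tendsto a cofinite (𝓝 0)) :
    Multipliable fun i => 1 + a i := by
  classical
  refine multipliable_one_add_of_summable_prod ?_
  refine NonarchimedeanAddGroup.summable_of_tendsto_cofinite_zero ?_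
  have hfin : ∀ ε > 0, {i | ε ≤ ‖a i‖}.Finite := by
    intro ε hε
    have h1 := (Metric.tendsto_nhds.1 ha) ε hε
    rw [eventually_cofinite] at h1
    simpa using h1
  rw [Metric.tendsto_nhds]
  intro ε hε
  rw [eventually_cofinite]
  set T := (hfin 1 one_pos).toFinset with hT
  set B := ∏ i ∈ T, max 1 ‖a i‖ with hB
  have hone : ∀ t : Finset ι, 1 ≤ ∏ j ∈ t, max 1 ‖a j‖ := fun t =>
    Finset.prod_induction _ (1 ≤ ·) (fun _ _ => one_le_mul_of_one_le_of_one_le) le_rfl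
      fun _ _ => le_max_left _ _
  have hB1 : 1 ≤ B := hone T
  have hB0 : 0 < B := by linarith
  have hT' := hfin (min 1 (ε / B)) (by positivity)
  refine (Finset.finite_toSet (hT'.toFinset.powerset)).subset ?_
  intro s hs
  simp only [dist_zero_right, not_lt, Set.mem_ofPred_eq] at hs
  simp only [Finset.coe_powerset, Set.mem_preimage, Set.mem_powerset_iff]
  by_contra hns
  obtain ⟨i, his, hi⟩ := Set.not_subset.1 hns
  have his' : i ∈ s := his
  have hi' : ‖a i‖ < min 1 (ε / B) := by simpa using hi
  have h1 : ∏ j ∈ s.erase i, ‖a j‖ ≤ B := by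
    calc ∏ j ∈ s.erase i, ‖a j‖ ≤ ∏ j ∈ s.erase i, max 1 ‖a j‖ :=
          Finset.prod_le_prod (fun _ _ => norm_nonneg _) fun _ _ => le_max_right _ _
      _ ≤ ∏ j ∈ s.erase i ∪ T, max 1 ‖a j‖ := by
          rw [← Finset.prod_sdiff (Finset.subset_union_left (s₂ := T))]
          exact le_mul_of_one_le_left (zero_le_one.trans (hone _)) (hone _)
      _ = B := by
          refine (Finset.prod_subset Finset.subset_union_right fun j _ hj => ?_).symm
          have : ‖a j‖ < 1 := by simpa [hT] using hj
          exact max_eq_left this.le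
  have h2 : ‖∏ j ∈ s, a j‖ < ε := by
    rw [norm_prod, ← Finset.mul_prod_erase s _ his']
    calc ‖a i‖ * ∏ j ∈ s.erase i, ‖a j‖ ≤ ‖a i‖ * B := by gcongr
      _ < ε / B * B := by gcongr; exact hi'.trans_le (min_le_right _ _)
      _ = ε := by field_simp
  exact absurd hs (not_le.2 h2)

variable {C : Type*} [NormedField C]

/-- A subset of a normed field that has finite intersection with every ball. -/
def IsDiscreteSet (L : Set C) : Prop := ∀ R : ℝ, (L ∩ Metric.closedBall 0 R).Finite

theorem IsDiscreteSet.mono {L M : Set C} (hL : IsDiscreteSet L) (h : M ⊆ L) : IsDiscreteSet M :=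
  fun R => (hL R).subset (Set.inter_subset_inter_left _ h)

/-- The elements of norm at most `R` of a discrete set. -/
def IsDiscreteSet.ball {L : Set C} (hL : IsDiscreteSet L) (R : ℝ) : Finset C := (hL R).toFinset

theorem IsDiscreteSet.mem_ball {L : Set C} (hL : IsDiscreteSet L) {R : ℝ} {x : C} :
    x ∈ hL.ball R ↔ x ∈ L ∧ ‖x‖ ≤ R := by
  simp [IsDiscreteSet.ball]

theorem IsDiscreteSet.tendsto_inv {ι : Type*} {L : Set C} (hL : IsDiscreteSet L) {f : ι → C}
    (hf : Function.Injective f) (hfL : ∀ i, f i ∈ L) :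
    Tendsto (fun i => (f i)⁻¹) cofinite (𝓝 0) := by
  rw [Metric.tendsto_nhds]
  intro ε hε
  rw [eventually_cofinite]
  refine ((hL ε⁻¹).preimage hf.injOn).subset fun i hi => ?_
  simp only [dist_zero_right, not_lt, Set.mem_ofPred_eq, norm_inv] at hi
  refine ⟨hfL i, ?_⟩
  rw [mem_closedBall_zero_iff]
  by_cases h0 : ‖f i‖ = 0
  · rw [h0]; positivity
  · have : 0 < ‖f i‖ := lt_of_le_of_ne (norm_nonneg _) (Ne.symm h0)
    exact (le_inv_comm₀ hε this).1 hi

variable [IsUltrametricDist C] [CompleteSpace C]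

open Classical in
/-- The exponential function `z ∏' (1 - z / l)` of a discrete set. -/
def discreteExp (L : Set C) (z : C) : C :=
  z * ∏' l : {l : C // l ∈ L ∧ l ≠ 0}, (1 - z / (l : C))

theorem IsDiscreteSet.multipliable {L : Set C} (hL : IsDiscreteSet L) (z : C) :
    Multipliable fun l : {l : C // l ∈ L ∧ l ≠ 0} => (1 - z / (l : C)) := by
  have h : Tendsto (fun l : {l : C // l ∈ L ∧ l ≠ 0} => -(z * (l : C)⁻¹)) cofinite (𝓝 0) := by
    simpa using ((hL.tendsto_inv (f := fun l : {l : C // l ∈ L ∧ l ≠ 0} => (l : C))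
      Subtype.val_injective fun l => l.2.1).const_mul z).neg
  simpa [sub_eq_add_neg, div_eq_mul_inv] using multipliable_one_add_of_tendsto_cofinite h

/-- The truncations to balls exhaust `L`. For a subgroup they are finite subgroups by the
ultrametric inequality, so identities for finite groups pass to the limit. -/
theorem IsDiscreteSet.tendsto_finExp {L : Set C} (hL : IsDiscreteSet L) (z : C) :
    Tendsto (fun N : ℕ => finExp (hL.ball N) z) atTop (𝓝 (discreteExp L z)) := by
  classical
  refine Tendsto.const_mul z ?_
  have h1 : Tendsto (fun N : ℕ => ((hL.ball N).erase 0).subtype (fun l => l ∈ L ∧ l ≠ 0)) atTop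
      atTop := by
    refine tendsto_atTop_finset_of_monotone ?_ ?_
    · intro M N hMN x hx
      simp only [Finset.mem_subtype, Finset.mem_erase, hL.mem_ball] at hx ⊢
      exact ⟨hx.1, hx.2.1, hx.2.2.trans (by exact_mod_cast hMN)⟩
    · intro x
      obtain ⟨N, hN⟩ := exists_nat_ge ‖(x : C)‖
      refine ⟨N, ?_⟩
      simp only [Finset.mem_subtype, Finset.mem_erase, hL.mem_ball]
      exact ⟨x.2.2, x.2.1, hN⟩
  refine ((hL.multipliable z).hasProd.comp h1).congr fun N => ?_
  simp only [Function.comp]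
  refine Finset.prod_subtype_of_mem (fun l => 1 - z / l) fun x hx => ?_
  rw [Finset.mem_erase, hL.mem_ball] at hx
  exact ⟨hx.2.1, hx.1⟩

theorem IsDiscreteSet.summable {L : Set C} (hL : IsDiscreteSet L) :
    Summable fun l : L => (l : C)⁻¹ :=
  NonarchimedeanAddGroup.summable_of_tendsto_cofinite_zero
    (hL.tendsto_inv Subtype.val_injective fun l => l.2)

theorem IsDiscreteSet.tendsto_sum {L : Set C} (hL : IsDiscreteSet L) :
    Tendsto (fun N : ℕ => ∑ l ∈ hL.ball N, l⁻¹) atTop (𝓝 (∑' l : L, (l : C)⁻¹)) := by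
  classical
  have h1 : Tendsto (fun N : ℕ => (hL.ball N).subtype (· ∈ L)) atTop atTop := by
    refine tendsto_atTop_finset_of_monotone ?_ ?_
    · intro M N hMN x hx
      simp only [Finset.mem_subtype, hL.mem_ball] at hx ⊢
      exact ⟨hx.1, hx.2.trans (by exact_mod_cast hMN)⟩
    · intro x
      obtain ⟨N, hN⟩ := exists_nat_ge ‖(x : C)‖
      exact ⟨N, by simp only [Finset.mem_subtype, hL.mem_ball]; exact ⟨x.2, hN⟩⟩
  refine (hL.summable.hasSum.comp h1).congr fun N => ?_
  simp only [Function.comp]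
  exact Finset.sum_subtype_of_mem (fun l => l⁻¹) fun x hx => (hL.mem_ball.1 hx).1

section Subgroup

variable {L : AddSubgroup C} (hL : IsDiscreteSet (L : Set C))
include hL

theorem IsDiscreteSet.zero_mem_ball {R : ℝ} (hR : 0 ≤ R) : (0 : C) ∈ hL.ball R :=
  hL.mem_ball.2 ⟨L.zero_mem, by simpa using hR⟩

theorem IsDiscreteSet.sub_mem_ball (R : ℝ) : ∀ x ∈ hL.ball R, ∀ y ∈ hL.ball R,
    x - y ∈ hL.ball R := by
  intro x hx y hy
  rw [hL.mem_ball] at *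
  exact ⟨L.sub_mem hx.1 hy.1, (norm_sub_le_max_of_ultrametric x y).trans (max_le hx.2 hy.2)⟩

theorem discreteExp_add (x y : C) :
    discreteExp (L : Set C) (x + y) = discreteExp (L : Set C) x + discreteExp (L : Set C) y := by
  refine tendsto_nhds_unique (hL.tendsto_finExp (x + y)) ?_
  refine ((hL.tendsto_finExp x).add (hL.tendsto_finExp y)).congr fun N => ?_
  exact (finExp_add (hL.zero_mem_ball N.cast_nonneg) (hL.sub_mem_ball N) x y).symm

/-- By the ultrametric inequality, truncating a coset beyond the norm of a representative gives a
coset of the truncated group. -/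
theorem mem_coset_ball {u x : C} {R : ℝ} (hu : ‖u‖ ≤ R) :
    (x - u ∈ L ∧ ‖x‖ ≤ R) ↔ x - u ∈ hL.ball R := by
  rw [hL.mem_ball]
  refine and_congr_right fun _ => ⟨fun h => ?_, fun h => ?_⟩
  · exact (norm_sub_le_max_of_ultrametric x u).trans (max_le h hu)
  · have := IsUltrametricDist.norm_add_le_max (x - u) u
    rw [sub_add_cancel] at this
    exact this.trans (max_le h hu)

theorem IsDiscreteSet.coset (u : C) : IsDiscreteSet {x | x - u ∈ L} := by
  intro R
  refine ((hL.ball (max R ‖u‖)).finite_toSet.image (fun x => x + u)).subset ?_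
  rintro x ⟨hx, hxR⟩
  rw [mem_closedBall_zero_iff] at hxR
  exact ⟨x - u, (mem_coset_ball hL (le_max_right _ _)).1 ⟨hx, hxR.trans (le_max_left _ _)⟩,
    sub_add_cancel _ _⟩

/-- The sum of the inverses over a nontrivial coset is the inverse of the exponential function. -/
theorem discreteExp_mul_tsum_inv {u : C} (hu : u ∉ L) :
    discreteExp (L : Set C) u * ∑' x : {x | x - u ∈ L}, (x : C)⁻¹ = 1 := by
  classical
  refine tendsto_nhds_unique ((hL.tendsto_finExp u).mul (hL.coset u).tendsto_sum) ?_
  refine tendsto_const_nhds.congr' ?_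
  obtain ⟨M, hM⟩ := exists_nat_ge ‖u‖
  filter_upwards [eventually_ge_atTop M] with N hN
  have huN : ‖u‖ ≤ (N : ℝ) := hM.trans (by exact_mod_cast hN)
  have hunot : u ∉ hL.ball N := fun h => hu (hL.mem_ball.1 h).1
  have h0 := hL.zero_mem_ball (N.cast_nonneg (α := ℝ))
  have h1 : (hL.coset u).ball N = (hL.ball N).image (fun g => u + g) := by
    ext x
    rw [(hL.coset u).mem_ball, Finset.mem_image, Set.mem_ofPred_eq, mem_coset_ball hL huN]
    constructor
    · intro hx; exact ⟨x - u, hx, by ring⟩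
    · rintro ⟨g, hg, rfl⟩; simpa using hg
  rw [h1, Finset.sum_image fun a _ b _ hab => add_left_cancel hab,
    sum_inv_add_eq h0 (hL.sub_mem_ball N) hunot, mul_inv_cancel₀ (finExp_ne_zero h0 hunot)]

theorem discreteExp_ne_zero {u : C} (hu : u ∉ L) : discreteExp (L : Set C) u ≠ 0 :=
  left_ne_zero_of_mul_eq_one (discreteExp_mul_tsum_inv hL hu)

/-- The exponential function of a discrete group in terms of that of a subgroup of finite index and
the sums of inverses over the nontrivial cosets. -/
theorem discreteExp_eq_mul_prod {J : Type*} [Fintype J] {L' : Set C} (hL' : IsDiscreteSet L')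
    (D : J → Set C) (hdisj : ∀ i j, i ≠ j → Disjoint (D i) (D j))
    (hLD : ∀ j, Disjoint (L : Set C) (D j)) (hmem : ∀ x, x ∈ L' ↔ x ∈ L ∨ ∃ j, x ∈ D j)
    (hD : ∀ j, D j = ∅ ∨ ∃ u, u ∉ L ∧ D j = {x | x - u ∈ L}) (z : C) :
    discreteExp L' z = discreteExp (L : Set C) z *
      ∏ j, (1 - discreteExp (L : Set C) z * ∑' g : D j, (g : C)⁻¹) := by
  classical
  have hDd : ∀ j, IsDiscreteSet (D j) := fun j =>
    hL'.mono fun x hx => (hmem x).2 (Or.inr ⟨j, hx⟩)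
  -- From radius `M` on, every nonempty truncated coset is a full coset of the truncated group, so
  -- the finite identity applies.
  have hbd : ∃ M : ℕ, ∀ j, D j = ∅ ∨ ∃ u, u ∉ L ∧ D j = {x | x - u ∈ L} ∧ ‖u‖ ≤ M := by
    have h1 : ∀ j, ∃ M : ℕ, D j = ∅ ∨ ∃ u, u ∉ L ∧ D j = {x | x - u ∈ L} ∧ ‖u‖ ≤ M := by
      intro j
      rcases hD j with h | ⟨u, hu, h⟩
      · exact ⟨0, Or.inl h⟩
      · obtain ⟨M, hM⟩ := exists_nat_ge ‖u‖
        exact ⟨M, Or.inr ⟨u, hu, h, hM⟩⟩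
    choose M hM using h1
    refine ⟨Finset.univ.sup M, fun j => (hM j).imp_right ?_⟩
    rintro ⟨u, hu, h, huM⟩
    exact ⟨u, hu, h, huM.trans (by exact_mod_cast Finset.le_sup (f := M) (Finset.mem_univ j))⟩
  obtain ⟨M, hM⟩ := hbd
  refine tendsto_nhds_unique (hL'.tendsto_finExp z) ?_
  refine ((hL.tendsto_finExp z).mul (tendsto_finsetProd _ fun j _ =>
    (((hL.tendsto_finExp z).mul (hDd j).tendsto_sum).const_sub 1))).congr' ?_
  filter_upwards [eventually_ge_atTop M] with N hN
  refine (finExp_eq_mul_prod (hL.zero_mem_ball N.cast_nonneg) (hL.sub_mem_ball N)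
    (fun j => (hDd j).ball N) ?_ ?_ ?_ ?_ z).symm
  · intro i j hij
    rw [Finset.disjoint_left]
    intro x hx hx'
    exact Set.disjoint_left.1 (hdisj i j hij) ((hDd i).mem_ball.1 hx).1 ((hDd j).mem_ball.1 hx').1
  · intro j
    rw [Finset.disjoint_left]
    intro x hx hx'
    exact Set.disjoint_left.1 (hLD j) (hL.mem_ball.1 hx).1 ((hDd j).mem_ball.1 hx').1
  · intro x
    rw [hL'.mem_ball, hmem, hL.mem_ball]
    simp only [IsDiscreteSet.mem_ball, SetLike.mem_coe]
    rw [or_and_right, exists_and_right]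
  · intro j
    rcases hM j with h | ⟨u, hu, h, huM⟩
    · left
      ext x
      simp [IsDiscreteSet.mem_ball, h]
    · right
      refine ⟨u, fun h' => hu (hL.mem_ball.1 h').1, fun x => ?_⟩
      rw [(hDd j).mem_ball, h, Set.mem_ofPred_eq,
        mem_coset_ball hL (huM.trans (by exact_mod_cast hN))]

end Subgroup

end InfiniteExponential

/-! ### Gauss norms of polynomials on discs -/

section DiscNorm

open Polynomial Filter Topology

variable {C : Type*} [NormedField C]

/-- The norm `max |p_k| s ^ k` of a polynomial on the disc of radius `s` around zero. -/
def discNorm (P : C[X]) (s : ℝ) : ℝ :=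
  (Finset.range (P.natDegree + 1)).sup' ⟨0, by simp⟩ fun k => ‖P.coeff k‖ * s ^ k

theorem continuous_discNorm (P : C[X]) : Continuous (discNorm P) := by
  refine Continuous.finset_sup'_apply _ fun k _ => ?_
  fun_prop

theorem coeff_le_discNorm (P : C[X]) {s : ℝ} (k : ℕ) (hs : 0 ≤ s) :
    ‖P.coeff k‖ * s ^ k ≤ discNorm P s := by
  by_cases hk : k < P.natDegree + 1
  · exact Finset.le_sup' (fun k => ‖P.coeff k‖ * s ^ k) (Finset.mem_range.2 hk)
  · rw [coeff_eq_zero_of_natDegree_lt (by omega), norm_zero, zero_mul]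
    refine le_trans ?_ (Finset.le_sup' (fun k => ‖P.coeff k‖ * s ^ k)
      (Finset.mem_range.2 (Nat.succ_pos _)))
    positivity

theorem discNorm_nonneg (P : C[X]) {s : ℝ} (hs : 0 ≤ s) : 0 ≤ discNorm P s :=
  le_trans (by positivity) (coeff_le_discNorm P 0 hs)

theorem discNorm_zero (P : C[X]) : discNorm P 0 = ‖P.eval 0‖ := by
  rw [← coeff_zero_eq_eval_zero]
  refine le_antisymm (Finset.sup'_le _ _ fun k _ => ?_) ?_
  · rcases Nat.eq_zero_or_pos k with rfl | hk
    · simp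
    · rw [zero_pow hk.ne', mul_zero]; exact norm_nonneg _
  · simpa using coeff_le_discNorm P 0 le_rfl

variable [IsUltrametricDist C]

theorem norm_eval_le_discNorm (P : C[X]) {s : ℝ} {t : C} (ht : ‖t‖ ≤ s) :
    ‖P.eval t‖ ≤ discNorm P s := by
  have hs : 0 ≤ s := (norm_nonneg t).trans ht
  rw [eval_eq_sum_range]
  refine IsUltrametricDist.norm_sum_le_of_forall_le_of_nonneg (discNorm_nonneg P hs) fun k _ => ?_
  rw [norm_mul, norm_pow]
  refine le_trans ?_ (coeff_le_discNorm P k hs)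
  gcongr

/-- Induction by division: if `P = P(t₀) + (X - t₀) Q`, then `s |Q(t)| = |P(t) - P(t₀)|` at the
remaining points, so `Q` is bounded by `M / s` there. The coefficients of `P` are recovered from
those of `P(t₀)`, `X Q` and `t₀ Q`. -/
theorem coeff_le_of_separated {s : ℝ} (hs : 0 < s) (n : ℕ) : ∀ (P : C[X]) (T : Finset C) (M : ℝ),
    T.card = n → P.natDegree < n → (∀ t ∈ T, ‖t‖ ≤ s) →
    (∀ t ∈ T, ∀ u ∈ T, t ≠ u → ‖t - u‖ = s) → (∀ t ∈ T, ‖P.eval t‖ ≤ M) →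
    ∀ k, ‖P.coeff k‖ * s ^ k ≤ M := by
  classical
  induction n with
  | zero => intro P T M _ h; exact absurd h (Nat.not_lt_zero _)
  | succ n ih =>
    intro P T M hT hP hTs hsep hM k
    obtain ⟨t₀, ht₀⟩ : T.Nonempty := Finset.card_pos.1 (by omega)
    have hM0 : 0 ≤ M := (norm_nonneg _).trans (hM t₀ ht₀)
    by_cases hdeg : P.natDegree = 0
    · rw [eq_C_of_natDegree_eq_zero hdeg] at hM ⊢
      rcases Nat.eq_zero_or_pos k with rfl | hk
      · simpa using hM t₀ ht₀
      · rw [coeff_C_of_ne_zero hk.ne', norm_zero, zero_mul]; exact hM0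
    set Q := P /ₘ (X - Polynomial.C t₀) with hQ
    have hdec : P = Polynomial.C (P.eval t₀) + (X - Polynomial.C t₀) * Q := by
      conv_lhs => rw [← modByMonic_add_div P (X - Polynomial.C t₀), modByMonic_X_sub_C_eq_C_eval]
    have hQdeg : Q.natDegree < n := by
      rw [hQ, natDegree_divByMonic P (monic_X_sub_C t₀), natDegree_X_sub_C]; omega
    have hQc : ∀ k, ‖Q.coeff k‖ * s ^ k ≤ M / s := by
      refine ih Q (T.erase t₀) (M / s) (by rw [Finset.card_erase_of_mem ht₀]; omega) hQdeg
        (fun t ht => hTs t (Finset.mem_of_mem_erase ht))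
        (fun t ht u hu => hsep t (Finset.mem_of_mem_erase ht) u (Finset.mem_of_mem_erase hu)) ?_
      intro t ht
      have htT := Finset.mem_of_mem_erase ht
      have h1 : P.eval t - P.eval t₀ = (t - t₀) * Q.eval t := by
        have h2 := congrArg (eval t) hdec
        rw [eval_add, eval_C, eval_mul, eval_sub, eval_X, eval_C] at h2
        rw [h2]; ring
      have h3 : s * ‖Q.eval t‖ ≤ M := by
        rw [← hsep t htT t₀ ht₀ (Finset.ne_of_mem_erase ht), ← norm_mul, ← h1]
        exact (norm_sub_le_max_of_ultrametric _ _).trans (max_le (hM t htT) (hM t₀ ht₀))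
      rw [le_div_iff₀ hs, mul_comm]; exact h3
    have hprev : ‖(X * Q).coeff k‖ * s ^ k ≤ M := by
      rcases k with _ | k
      · simp [hM0]
      · rw [coeff_X_mul, pow_succ, ← mul_assoc]
        calc ‖Q.coeff k‖ * s ^ k * s ≤ M / s * s := by gcongr; exact hQc k
          _ = M := by field_simp
    have hsame : ‖t₀ * Q.coeff k‖ * s ^ k ≤ M := by
      rw [norm_mul, mul_assoc]
      calc ‖t₀‖ * (‖Q.coeff k‖ * s ^ k) ≤ s * (M / s) :=
            mul_le_mul (hTs t₀ ht₀) (hQc k) (by positivity) hs.le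
        _ = M := by field_simp
    have hconst : ‖(Polynomial.C (P.eval t₀)).coeff k‖ * s ^ k ≤ M := by
      rcases Nat.eq_zero_or_pos k with rfl | hk
      · simpa using hM t₀ ht₀
      · rw [coeff_C_of_ne_zero hk.ne', norm_zero, zero_mul]; exact hM0
    have hcoef : P.coeff k = (Polynomial.C (P.eval t₀)).coeff k +
        ((X * Q).coeff k - t₀ * Q.coeff k) := by
      conv_lhs => rw [hdec]
      rw [coeff_add, sub_mul, coeff_sub, coeff_C_mul]
    rw [hcoef]
    have h1 := IsUltrametricDist.norm_add_le_max ((Polynomial.C (P.eval t₀)).coeff k)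
      ((X * Q).coeff k - t₀ * Q.coeff k)
    have h2 := norm_sub_le_max_of_ultrametric ((X * Q).coeff k) (t₀ * Q.coeff k)
    have hpos : 0 ≤ s ^ k := by positivity
    calc _ ≤ max ‖(Polynomial.C (P.eval t₀)).coeff k‖ (max ‖(X * Q).coeff k‖ ‖t₀ * Q.coeff k‖) *
          s ^ k := by gcongr; exact h1.trans (max_le_max le_rfl h2)
      _ ≤ M := by
        rw [max_mul_of_nonneg _ _ hpos, max_mul_of_nonneg _ _ hpos]
        exact max_le hconst (max_le hprev hsame)

theorem discNorm_le_of_separated {s M : ℝ} (hs : 0 < s) {P : C[X]} {T : Finset C}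
    (hP : P.natDegree < T.card) (hTs : ∀ t ∈ T, ‖t‖ ≤ s)
    (hsep : ∀ t ∈ T, ∀ u ∈ T, t ≠ u → ‖t - u‖ = s) (hM : ∀ t ∈ T, ‖P.eval t‖ ≤ M) :
    discNorm P s ≤ M :=
  Finset.sup'_le _ _ fun k _ => coeff_le_of_separated hs T.card P T M rfl hP hTs hsep hM k

end DiscNorm

/-! ### Rational functions on a line: small values cannot turn into large ones -/

section Line

open Polynomial Filter Topology

variable {F K : Type*} [Field F] [Finite F] [Field K] [Algebra F K] {inf : Place F K}

/-- Finitely many polynomials attain their norm on a disc in a common point. -/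
theorem exists_norm_eval_eq_discNorm {ι : Type*} [Fintype ι] (P : ι → (Cinf inf)[X])
    {σ : Cinf inf} (hσ : σ ≠ 0) : ∃ t, ‖t‖ ≤ ‖σ‖ ∧ ∀ i, ‖(P i).eval t‖ = discNorm (P i) ‖σ‖ := by
  classical
  have hs : 0 < ‖σ‖ := norm_pos_iff.2 hσ
  obtain ⟨T, hTcard, hT1, hTsep⟩ := exists_separated_finset inf (∑ i, (P i).natDegree + 1)
  have hinj : Function.Injective (fun x : Cinf inf => σ * x) := mul_right_injective₀ hσ
  set T' := T.image (fun x => σ * x) with hT'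
  have hT's : ∀ t ∈ T', ‖t‖ ≤ ‖σ‖ := by
    intro t ht
    obtain ⟨x, hx, rfl⟩ := Finset.mem_image.1 ht
    rw [norm_mul]
    exact mul_le_of_le_one_right hs.le (hT1 x hx)
  have hT'sep : ∀ t ∈ T', ∀ u ∈ T', t ≠ u → ‖t - u‖ = ‖σ‖ := by
    intro t ht u hu htu
    obtain ⟨x, hx, rfl⟩ := Finset.mem_image.1 ht
    obtain ⟨y, hy, rfl⟩ := Finset.mem_image.1 hu
    rw [← mul_sub, norm_mul, hTsep x hx y hy (fun h => htu (by rw [h])), mul_one]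
  -- By `discNorm_le_of_separated` a polynomial stays below its norm in at most as many of the
  -- separated points as its degree. With more points than the sum of the degrees, some point is
  -- good for all the polynomials at once.
  let bad : ι → Finset (Cinf inf) := fun i => T'.filter fun t => ‖(P i).eval t‖ < discNorm (P i) ‖σ‖
  have hbad : ∀ i, (bad i).card ≤ (P i).natDegree := by
    intro i
    by_contra h
    push Not at h
    have hne : (bad i).Nonempty := Finset.card_pos.1 (by omega)
    have h1 := discNorm_le_of_separated hs h (fun t ht => hT's t (Finset.mem_filter.1 ht).1)
      (fun t ht u hu => hT'sep t (Finset.mem_filter.1 ht).1 u (Finset.mem_filter.1 hu).1)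
      (M := (bad i).sup' hne fun t => ‖(P i).eval t‖)
      (fun t ht => Finset.le_sup' (fun t => ‖(P i).eval t‖) ht)
    rw [Finset.le_sup'_iff] at h1
    obtain ⟨t, ht, h2⟩ := h1
    exact absurd (Finset.mem_filter.1 ht).2 (not_lt.2 h2)
  have hlt : (Finset.univ.biUnion bad).card < T'.card := by
    rw [hT', Finset.card_image_of_injective _ hinj]
    calc _ ≤ ∑ i, (bad i).card := Finset.card_biUnion_le
      _ ≤ ∑ i, (P i).natDegree := Finset.sum_le_sum fun i _ => hbad i
      _ < T.card := by omega
  obtain ⟨t, ht, htb⟩ := Finset.exists_mem_notMem_of_card_lt_card hlt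
  refine ⟨t, hT's t ht, fun i => le_antisymm (norm_eval_le_discNorm _ (hT's t ht)) ?_⟩
  by_contra h
  push Not at h
  exact htb (Finset.mem_biUnion.2 ⟨i, Finset.mem_univ i, Finset.mem_filter.2 ⟨ht, h⟩⟩)

/-- The norm is the maximum of `|P|` on the closed unit disc, and every point of an ultrametric disc
is a centre. -/
theorem discNorm_comp_le (P : (Cinf inf)[X]) {x y : Cinf inf} (hxy : ‖y - x‖ ≤ 1) :
    discNorm (P.comp (X + C y)) 1 ≤ discNorm (P.comp (X + C x)) 1 := by
  obtain ⟨t, ht, h⟩ := exists_norm_eval_eq_discNorm (fun _ : Unit => P.comp (X + C y))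
    (σ := (1 : Cinf inf)) one_ne_zero
  rw [norm_one] at ht h
  rw [← h ()]
  have h1 : (P.comp (X + C y)).eval t = (P.comp (X + C x)).eval (t + (y - x)) := by
    simp only [eval_comp, eval_add, eval_X, eval_C]
    congr 1; ring
  rw [h1]
  exact norm_eval_le_discNorm _ ((IsUltrametricDist.norm_add_le_max _ _).trans (max_le ht hxy))

/-- The radii at which the norm of `P` is at most `ε` times that of `Q`, and those at which it is at
least `B` times, form closed sets, disjoint on the nonnegative radii. They cover `[0, 1]`: values of
the norm of `C_∞` are dense, and at such a radius a generic point attains the norms of `P`, `Q` and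
all `L j` simultaneously, so that it satisfies the constraint `|L j (0)| ≤ |L j (t)|` and the
hypothesis applies. As `[0, 1]` is connected, radius zero and radius one belong to the same set. -/
theorem discNorm_dichotomy {ι : Type*} [Fintype ι] (P Q : (Cinf inf)[X])
    (L : ι → (Cinf inf)[X]) {ε B : ℝ} (hεB : ε < B) (hQ : Q.eval 0 ≠ 0)
    (h : ∀ t : Cinf inf, ‖t‖ ≤ 1 → (∀ j, ‖(L j).eval 0‖ ≤ ‖(L j).eval t‖) →
      ‖P.eval t‖ ≤ ε * ‖Q.eval t‖ ∨ B * ‖Q.eval t‖ ≤ ‖P.eval t‖) :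
    ‖P.eval 0‖ ≤ ε * ‖Q.eval 0‖ ↔ discNorm P 1 ≤ ε * discNorm Q 1 := by
  have hQpos : ∀ s : ℝ, 0 ≤ s → 0 < discNorm Q s := fun s hs => by
    refine lt_of_lt_of_le (norm_pos_iff.2 hQ) ?_
    have := coeff_le_discNorm Q 0 hs
    rwa [pow_zero, mul_one, coeff_zero_eq_eval_zero] at this
  let U : Set ℝ := {s | discNorm P s ≤ ε * discNorm Q s}
  let V : Set ℝ := {s | B * discNorm Q s ≤ discNorm P s}
  have hU : IsClosed U := isClosed_le (continuous_discNorm P)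
    (continuous_const.mul (continuous_discNorm Q))
  have hV : IsClosed V := isClosed_le (continuous_const.mul (continuous_discNorm Q))
    (continuous_discNorm P)
  have hnorms : ∀ σ : Cinf inf, σ ≠ 0 → ‖σ‖ ≤ 1 → ‖σ‖ ∈ U ∪ V := by
    intro σ hσ hσ1
    obtain ⟨t, ht, hgen⟩ := exists_norm_eval_eq_discNorm
      (fun o : Option (Option ι) => o.elim P fun o => o.elim Q L) hσ
    have hP := hgen none
    have hQ' := hgen (some none)
    have hL := fun j => hgen (some (some j))
    simp only [Option.elim] at hP hQ' hL
    rcases h t (ht.trans hσ1) (fun j => by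
      rw [hL j]; exact norm_eval_le_discNorm _ (by rw [norm_zero]; exact norm_nonneg σ)) with h1 | h1
    · left; rw [hP, hQ'] at h1; exact h1
    · right; rw [hP, hQ'] at h1; exact h1
  have hcover : Set.Icc (0 : ℝ) 1 ⊆ U ∪ V := by
    have h1 : Set.Ioo (0 : ℝ) 1 ⊆ closure (U ∪ V) := by
      intro s hs
      rw [Metric.mem_closure_iff]
      intro δ hδ
      obtain ⟨σ, h1, h2⟩ := exists_norm_between inf (a := s) (b := min 1 (s + δ)) hs.1
        (lt_min hs.2 (by linarith))
      refine ⟨‖σ‖, hnorms σ (norm_pos_iff.1 (hs.1.trans h1)) (h2.le.trans (min_le_left _ _)), ?_⟩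
      have := h2.trans_le (min_le_right _ _)
      rw [Real.dist_eq, abs_lt]; constructor <;> linarith
    rw [(hU.union hV).closure_eq] at h1
    have h2 := closure_mono h1
    rwa [closure_Ioo (zero_ne_one' ℝ), (hU.union hV).closure_eq] at h2
  have hdisj : ∀ s : ℝ, 0 ≤ s → s ∈ U → s ∈ V → False := by
    intro s hs h1 h2
    have h3 : B * discNorm Q s ≤ ε * discNorm Q s := le_trans h2 h1
    have := hQpos s hs
    nlinarith
  have hconn := isPreconnected_closed_iff.1 (isPreconnected_Icc (a := (0 : ℝ)) (b := 1)) U V hU hV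
    hcover
  have h0 : (0 : ℝ) ∈ Set.Icc (0 : ℝ) 1 := ⟨le_rfl, zero_le_one⟩
  have h1 : (1 : ℝ) ∈ Set.Icc (0 : ℝ) 1 := ⟨zero_le_one, le_rfl⟩
  rw [← discNorm_zero, ← discNorm_zero]
  have hcase : ∀ a ∈ Set.Icc (0 : ℝ) 1, ∀ b ∈ Set.Icc (0 : ℝ) 1, a ∈ U → b ∈ U := by
    intro a ha b hb haU
    rcases hcover hb with hbU | hbV
    · exact hbU
    · obtain ⟨s, hs, hsU, hsV⟩ := hconn ⟨a, ha, haU⟩ ⟨b, hb, hbV⟩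
      exact (hdisj s hs.1 hsU hsV).elim
  exact ⟨hcase 0 h0 1 h1, hcase 1 h1 0 h0⟩

/-- A rational function on a line that is either small or large at every generic point near two
points at distance one is small at both points or at neither. -/
theorem norm_eval_le_of_line {ι : Type*} [Fintype ι] (P Q : (Cinf inf)[X])
    (L : ι → (Cinf inf)[X]) {ε B : ℝ} (hεB : ε < B) {x y : Cinf inf} (hxy : ‖x - y‖ ≤ 1)
    (hQx : Q.eval x ≠ 0) (hQy : Q.eval y ≠ 0)
    (h : ∀ z, z = x ∨ z = y → ∀ t : Cinf inf, ‖t‖ ≤ 1 →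
      (∀ j, ‖(L j).eval z‖ ≤ ‖(L j).eval (t + z)‖) →
      ‖P.eval (t + z)‖ ≤ ε * ‖Q.eval (t + z)‖ ∨ B * ‖Q.eval (t + z)‖ ≤ ‖P.eval (t + z)‖)
    (hx : ‖P.eval x‖ ≤ ε * ‖Q.eval x‖) : ‖P.eval y‖ ≤ ε * ‖Q.eval y‖ := by
  have key : ∀ z, (z = x ∨ z = y) →
      (‖P.eval z‖ ≤ ε * ‖Q.eval z‖ ↔
        discNorm (P.comp (X + C z)) 1 ≤ ε * discNorm (Q.comp (X + C z)) 1) := by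
    intro z hz
    have := discNorm_dichotomy (P.comp (X + C z)) (Q.comp (X + C z))
      (fun j => (L j).comp (X + C z)) hεB
      (by rw [eval_comp]; rcases hz with rfl | rfl <;> simpa)
      (by simpa [eval_comp] using h z hz)
    simpa [eval_comp] using this
  -- The unit discs around `x` and `y` coincide; this is where the two points are compared.
  have heq : ∀ R : (Cinf inf)[X], discNorm (R.comp (X + C x)) 1 = discNorm (R.comp (X + C y)) 1 :=
    fun R => le_antisymm (discNorm_comp_le R hxy) (discNorm_comp_le R (by rwa [norm_sub_rev]))
  rw [key y (Or.inr rfl), ← heq, ← heq, ← key x (Or.inl rfl)]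
  exact hx

end Line

/-! ### Discrete embeddings, heights, and points of the affinoids -/

section Lattices

variable {F K : Type*} [Field F] [Finite F] [Field K] [Algebra F K] {inf : Place F K} {r : ℕ}

theorem norm_sum_algebraMap_mul_le {κ : Type*} [Fintype κ] (b : κ → Cinf inf) (β : κ → K) {C : ℝ}
    (hC : 0 ≤ C) (hβ : ∀ k, inf.abv (β k) ≤ C) :
    ‖∑ k, algebraMap K (Cinf inf) (β k) * b k‖ ≤ C * ∑ k, ‖b k‖ := by
  refine IsUltrametricDist.norm_sum_le_of_forall_le_of_nonneg (by positivity) fun k _ => ?_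
  rw [norm_mul, norm_algebraMap_Cinf]
  exact mul_le_mul (hβ k) (Finset.single_le_sum (f := fun k => ‖b k‖) (fun _ _ => norm_nonneg _)
    (Finset.mem_univ k)) (norm_nonneg _) hC

theorem sum_sub_decomposition {κ : Type*} [Fintype κ] (b : κ → Cinf inf) (a α : κ → K) {x y : K}
    (hy : y ≠ 0) : ∑ k, algebraMap K (Cinf inf) (α k) * b k =
      algebraMap K (Cinf inf) (x / y) * ∑ k, algebraMap K (Cinf inf) (a k) * b k -
      ∑ k, algebraMap K (Cinf inf) (x * (a k / y) - α k) * b k := by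
  rw [Finset.mul_sum, ← Finset.sum_sub_distrib]
  refine Finset.sum_congr rfl fun k _ => ?_
  rw [← mul_assoc, ← map_mul, ← sub_mul, ← map_sub]
  congr 2
  field_simp
  ring

theorem exists_abv_le_of_finite {κ : Type*} [Fintype κ] {Φ : Set (κ → K)} (hΦ : Φ.Finite) :
    ∃ H : ℝ, ∀ α ∈ Φ, ∀ k, inf.abv (α k) ≤ H := by
  have h1 : ∀ k, ∃ H : ℝ, ∀ α ∈ Φ, inf.abv (α k) ≤ H := fun k => by
    obtain ⟨H, hH⟩ := (hΦ.image fun α => inf.abv (α k)).bddAbove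
    exact ⟨H, fun α hα => hH ⟨α, hα, rfl⟩⟩
  choose H hH using h1
  obtain ⟨M, hM⟩ := (Set.finite_range H).bddAbove
  exact ⟨M, fun α hα k => (hH k α hα).trans (hM ⟨k, rfl⟩)⟩

/-- Vectors of `C_∞` whose `A`-combinations are discrete are independent over `K_∞`, in a
quantitative form. -/
theorem exists_lower_bound (hK : IsFunctionField F K) {t : K} (ht : t ∈ regularRing inf)
    (htr : Transcendental F t) {κ : Type*} [Fintype κ] (b : κ → Cinf inf)
    (hb : ∀ R : ℝ, {α : κ → K | (∀ k, α k ∈ regularRing inf) ∧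
      ‖∑ k, algebraMap K (Cinf inf) (α k) * b k‖ ≤ R}.Finite) :
    ∃ c > 0, ∀ (a : κ → K) (j : κ),
      c * inf.abv (a j) ≤ ‖∑ k, algebraMap K (Cinf inf) (a k) * b k‖ := by
  classical
  obtain ⟨C, hC⟩ := exists_abv_sub_le hK ht htr
  have hC0 : 0 ≤ C := by
    obtain ⟨a, -, ha⟩ := hC 0
    exact (inf.abv.nonneg _).trans ha
  have h1 := one_lt_abv hK ht htr
  obtain ⟨H, hH⟩ := exists_abv_le_of_finite (inf := inf) (hb (max 1 (C * ∑ k, ‖b k‖)))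
  -- The scale `|t|^m` exceeds both the rounding error `C` and the height `H` of all integral
  -- vectors with small combination.
  obtain ⟨m, hm⟩ := pow_unbounded_of_one_lt (max C H) h1
  refine ⟨(inf.abv t ^ m)⁻¹, by positivity, fun a j => ?_⟩
  by_contra hlt
  push Not at hlt
  obtain ⟨l, -, hl⟩ := Finset.exists_max_image Finset.univ (fun k => inf.abv (a k))
    ⟨j, Finset.mem_univ j⟩
  have hpos : 0 < inf.abv (a l) := by
    have h2 : 0 < (inf.abv t ^ m)⁻¹ * inf.abv (a j) := (norm_nonneg _).trans_lt hlt
    exact (pos_of_mul_pos_right h2 (by positivity)).trans_le (hl j (Finset.mem_univ j))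
  have hal : a l ≠ 0 := by
    intro h; rw [h, map_zero] at hpos; exact lt_irrefl _ hpos
  -- Normalize `a` by its largest entry, multiply by `t ^ m` and round to `A`. If `a` violated the
  -- bound, the combination of `α` would be small, forcing `|α l| ≤ H`, while `α l` lies within `C`
  -- of `t ^ m`.
  choose α hα hαC using fun k => hC (t ^ m * (a k / a l))
  have hmem : ‖∑ k, algebraMap K (Cinf inf) (α k) * b k‖ ≤ max 1 (C * ∑ k, ‖b k‖) := by
    rw [sum_sub_decomposition b a α (x := t ^ m) hal]
    refine (norm_sub_le_max_of_ultrametric _ _).trans (max_le_max ?_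
      (norm_sum_algebraMap_mul_le b _ hC0 hαC))
    rw [norm_mul, norm_algebraMap_Cinf, map_div₀, map_pow]
    calc inf.abv t ^ m / inf.abv (a l) * ‖∑ k, algebraMap K (Cinf inf) (a k) * b k‖
        ≤ inf.abv t ^ m / inf.abv (a l) * ((inf.abv t ^ m)⁻¹ * inf.abv (a l)) := by
          gcongr
          exact hlt.le.trans (by gcongr; exact hl j (Finset.mem_univ j))
      _ = 1 := by
          have : (0 : ℝ) < inf.abv t ^ m := by positivity
          field_simp
  have h2 : inf.abv (α l) ≤ H := hH α ⟨hα, hmem⟩ l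
  have h3 : inf.abv (t ^ m) ≤ max C H := by
    have h4 := inf.abv_add_le (t ^ m * (a l / a l) - α l) (α l)
    rw [sub_add_cancel, div_self hal, mul_one] at h4
    refine h4.trans (max_le_max ?_ h2)
    have := hαC l
    rwa [div_self hal, mul_one] at this
  rw [map_pow] at h3
  exact absurd hm (not_lt.2 h3)

/-- The lattice spanned by a basis of a subspace. -/
theorem isLattice_span {κ : Type*} [Finite κ] {U : Submodule K (Fin r → K)}
    (b : Module.Basis κ K U) :
    IsLattice (Submodule.span (regularRing inf) (Set.range fun k => (b k : Fin r → K))) U where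
  fg := Submodule.fg_span (Set.finite_range _)
  projective := by
    have h1 : LinearIndependent K (fun k => (b k : Fin r → K)) :=
      b.linearIndependent.map' U.subtype (Submodule.ker_subtype U)
    have h2 : LinearIndependent (regularRing inf) (fun k => (b k : Fin r → K)) :=
      h1.restrict_scalars (by
        intro x y hxy
        apply Subtype.ext
        simpa [Subalgebra.smul_def] using hxy)
    exact Module.Projective.of_basis (Module.Basis.span h2)
  span_eq := by
    rw [Submodule.span_span_of_tower, Set.range_comp' Subtype.val b]
    have := congrArg (Submodule.map U.subtype) b.span_eq
    rw [Submodule.map_span, Submodule.map_top, Submodule.range_subtype] at this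
    exact this

theorem PsiBar.i_eq_sum {κ : Type*} [Fintype κ] (ω : PsiBar inf r) (b : Module.Basis κ K ω.U)
    (v : ω.U) : ω.i v = ∑ k, algebraMap K (Cinf inf) (b.repr v k) * ω.i (b k) := by
  conv_lhs => rw [← b.sum_repr v]
  rw [map_sum]
  refine Finset.sum_congr rfl fun k _ => ?_
  rw [map_smul, Algebra.smul_def]

theorem PsiBar.exists_lower_bound_basis (hK : IsFunctionField F K) {t : K}
    (ht : t ∈ regularRing inf) (htr : Transcendental F t) (ω : PsiBar inf r) {κ : Type*} [Fintype κ]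
    (b : Module.Basis κ K ω.U) :
    ∃ c > 0, ∀ (v : ω.U) (k : κ), c * inf.abv (b.repr v k) ≤ ‖ω.i v‖ := by
  obtain ⟨c, hc, h⟩ := exists_lower_bound hK ht htr (fun k => ω.i (b k)) (fun R => by
    have h1 := ω.discrete _ (isLattice_span (inf := inf) b) R
    refine Set.Finite.of_finite_image (f := fun α : κ → K =>
      ∑ k, algebraMap K (Cinf inf) (α k) * ω.i (b k)) (h1.subset ?_) ?_
    · rintro _ ⟨α, ⟨hα, hαR⟩, rfl⟩
      have hsum : ω.i (∑ k, α k • b k) = ∑ k, algebraMap K (Cinf inf) (α k) * ω.i (b k) := by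
        rw [map_sum]
        exact Finset.sum_congr rfl fun k _ => by rw [map_smul, Algebra.smul_def]
      refine ⟨⟨∑ k, α k • b k, ?_, hsum⟩, by simpa using hαR⟩
      refine Submodule.mem_comap.2 ?_
      rw [map_sum]
      refine sum_mem fun k _ => ?_
      exact Submodule.smul_mem _ (⟨α k, hα k⟩ : regularRing inf)
        (Submodule.subset_span ⟨k, rfl⟩)
    · intro α _ β _ hαβ
      have hsum : ∀ α : κ → K, ω.i (∑ k, α k • b k) =
          ∑ k, algebraMap K (Cinf inf) (α k) * ω.i (b k) := by
        intro α
        rw [map_sum]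
        exact Finset.sum_congr rfl fun k _ => by rw [map_smul, Algebra.smul_def]
      have h2 : ω.i (∑ k, α k • b k) = ω.i (∑ k, β k • b k) := by
        rw [hsum, hsum]; exact hαβ
      have h3 := ω.injective h2
      funext k
      have h4 := congrArg (fun v => b.repr v k) h3
      simpa only [b.repr_sum_self] using h4)
  refine ⟨c, hc, fun v k => ?_⟩
  rw [ω.i_eq_sum b v]
  exact h _ k

theorem abv_sum_le {κ : Type*} (s : Finset κ) (f : κ → K) {C : ℝ} (hC : 0 ≤ C)
    (h : ∀ k ∈ s, inf.abv (f k) ≤ C) : inf.abv (∑ k ∈ s, f k) ≤ C := by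
  classical
  induction s using Finset.induction_on with
  | empty => simpa using hC
  | insert a s ha ih =>
    rw [Finset.sum_insert ha]
    exact (inf.abv_add_le _ _).trans (max_le (h a (Finset.mem_insert_self _ _))
      (ih fun k hk => h k (Finset.mem_insert_of_mem hk)))

theorem PsiBar.exists_lower_bound (hK : IsFunctionField F K) {t : K}
    (ht : t ∈ regularRing inf) (htr : Transcendental F t) (ω : PsiBar inf r) :
    ∃ c > 0, ∀ (v : ω.U) (j : Fin r), c * inf.abv ((v : Fin r → K) j) ≤ ‖ω.i v‖ := by
  let b := Module.finBasis K ω.U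
  obtain ⟨c, hc, h⟩ := ω.exists_lower_bound_basis hK ht htr b
  set M := 1 + ∑ k, ∑ j, inf.abv ((b k : Fin r → K) j) with hM
  have hM0 : 0 < M := by
    have : 0 ≤ ∑ k, ∑ j, inf.abv ((b k : Fin r → K) j) :=
      Finset.sum_nonneg fun _ _ => Finset.sum_nonneg fun _ _ => inf.abv.nonneg _
    linarith
  refine ⟨c / M, by positivity, fun v j => ?_⟩
  have h1 : (v : Fin r → K) j = ∑ k, b.repr v k * (b k : Fin r → K) j := by
    conv_lhs => rw [← b.sum_repr v]
    rw [Submodule.coe_sum, Finset.sum_apply]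
    rfl
  have h2 : inf.abv ((v : Fin r → K) j) ≤ ‖ω.i v‖ / c * M := by
    rw [h1]
    refine abv_sum_le _ _ (by positivity) fun k _ => ?_
    rw [map_mul]
    refine mul_le_mul ?_ ?_ (inf.abv.nonneg _) (by positivity)
    · rw [le_div_iff₀ hc, mul_comm]; exact h v k
    · have h3 := Finset.single_le_sum (f := fun j => inf.abv ((b k : Fin r → K) j))
        (fun _ _ => inf.abv.nonneg _) (Finset.mem_univ j)
      have h4 := Finset.single_le_sum (f := fun k => ∑ j, inf.abv ((b k : Fin r → K) j))
        (fun _ _ => Finset.sum_nonneg fun _ _ => inf.abv.nonneg _) (Finset.mem_univ k)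
      linarith [h3, h4]
  calc c / M * inf.abv ((v : Fin r → K) j) ≤ c / M * (‖ω.i v‖ / c * M) := by gcongr
    _ = ‖ω.i v‖ := by field_simp

/-- A set of vectors in `K ^ r` with finitely many elements of bounded height. -/
def HasFiniteHeights (inf : Place F K) (N : Set (Fin r → K)) : Prop :=
  ∀ H : ℝ, {v | v ∈ N ∧ ∀ j, inf.abv (v j) ≤ H}.Finite

theorem hasFiniteHeights_of_denominator (hK : IsFunctionField F K) {N : Set (Fin r → K)} {d : K}
    (hd : d ≠ 0) (h : ∀ v ∈ N, ∀ j, d * v j ∈ regularRing inf) : HasFiniteHeights inf N := by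
  intro H
  refine Set.Finite.of_finite_image (f := fun v : Fin r → K => d • v)
    ((Set.Finite.pi' fun _ : Fin r =>
      finite_regularRing_abv_le (inf := inf) hK (inf.abv d * H)).subset ?_)
    ((smul_right_injective _ hd).injOn)
  rintro _ ⟨v, ⟨hv, hvH⟩, rfl⟩ j
  refine ⟨h v hv j, ?_⟩
  change inf.abv (d * v j) ≤ _
  rw [map_mul]
  exact mul_le_mul_of_nonneg_left (hvH j) (inf.abv.nonneg _)

theorem exists_denominator (hK : IsFunctionField F K) {t : K}
    (ht : t ∈ regularRing inf) (htr : Transcendental F t)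
    {N : Submodule (regularRing inf) (Fin r → K)} (hN : N.FG) :
    ∃ d : K, d ≠ 0 ∧ d ∈ regularRing inf ∧ ∀ v ∈ N, ∀ j, d * v j ∈ regularRing inf := by
  classical
  have := isFractionRing_regularRing hK ht htr
  obtain ⟨S, rfl⟩ := hN
  obtain ⟨b, hb⟩ := IsLocalization.exist_integer_multiples_of_finset
    (nonZeroDivisors (regularRing inf))
    ((S ×ˢ (Finset.univ : Finset (Fin r))).image fun p => p.1 p.2)
  refine ⟨(b : regularRing inf), fun h => nonZeroDivisors.coe_ne_zero b (Subtype.ext h),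
    Subtype.mem _, fun v hv j => ?_⟩
  induction hv using Submodule.span_induction with
  | mem x hx =>
    obtain ⟨y, hy⟩ := hb (x j) (Finset.mem_image.2 ⟨(x, j), by simpa using hx, rfl⟩)
    rw [Algebra.smul_def] at hy
    have : ((b : regularRing inf) : K) * x j = y := hy.symm
    rw [this]; exact y.2
  | zero => simp
  | add x y _ _ hx hy =>
    rw [Pi.add_apply, mul_add]; exact add_mem hx hy
  | smul a x _ hx =>
    have : ((b : regularRing inf) : K) * (a • x) j = a * ((b : regularRing inf) * x j) := by
      rw [Pi.smul_apply, Subalgebra.smul_def, smul_eq_mul]; ring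
    rw [this]; exact mul_mem a.2 hx

theorem exists_denominator_idealInv (hK : IsFunctionField F K) {t : K}
    (ht : t ∈ regularRing inf) (htr : Transcendental F t)
    {N : Submodule (regularRing inf) (Fin r → K)} (hN : N.FG) {n : Ideal (regularRing inf)}
    (hn : n ≠ ⊥) :
    ∃ d : K, d ≠ 0 ∧ d ∈ regularRing inf ∧ ∀ v ∈ idealInv n N, ∀ j, d * v j ∈ regularRing inf := by
  obtain ⟨d, hd0, hdA, hd⟩ := exists_denominator hK ht htr hN
  obtain ⟨a, han, ha⟩ := Submodule.exists_mem_ne_zero_of_ne_bot hn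
  refine ⟨d * a, mul_ne_zero hd0 fun h => ha (Subtype.ext h), mul_mem hdA a.2, fun v hv j => ?_⟩
  have := hd _ (hv a han) j
  rwa [Pi.smul_apply, Subalgebra.smul_def, smul_eq_mul, ← mul_assoc] at this

/-- The lower bound for `|i(v)|` turns bounded image into bounded height. This extends discreteness
from lattices of `U` to sets such as `Y ∩ U` and `n⁻¹Y ∩ U`, without showing that they are lattices
in `U`. -/
theorem PsiBar.finite_of_hasFiniteHeights (hK : IsFunctionField F K) {t : K}
    (ht : t ∈ regularRing inf) (htr : Transcendental F t) (ω : PsiBar inf r)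
    {N : Set (Fin r → K)} (hN : HasFiniteHeights inf N) :
    IsDiscreteSet {z | ∃ v : ω.U, (v : Fin r → K) ∈ N ∧ ω.i v = z} := by
  obtain ⟨c, hc, h⟩ := ω.exists_lower_bound hK ht htr
  intro R
  have h1 : {v : ω.U | (v : Fin r → K) ∈ N ∧ ∀ j, inf.abv ((v : Fin r → K) j) ≤ R / c}.Finite :=
    (hN (R / c)).preimage (f := fun v : ω.U => (v : Fin r → K)) Subtype.val_injective.injOn
  refine (h1.image ω.i).subset ?_
  rintro _ ⟨⟨v, hv, rfl⟩, hR⟩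
  refine ⟨v, ⟨hv, fun j => ?_⟩, rfl⟩
  rw [mem_closedBall_zero_iff] at hR
  rw [le_div_iff₀ hc, mul_comm]
  exact (h v j).trans hR

/-! ### The open stratum -/

theorem PsiBar.i_eq_sum_coord (ω : PsiBar inf r) (h : ω.U = ⊤) (v : ω.U) :
    ω.i v = ∑ k, algebraMap K (Cinf inf) ((v : Fin r → K) k) * ω.coord h k := by
  have hv : v = ∑ k, (v : Fin r → K) k • (⟨Pi.single k 1, h ▸ Submodule.mem_top⟩ : ω.U) := by
    apply Subtype.ext
    rw [Submodule.coe_sum]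
    exact pi_eq_sum_univ' _
  conv_lhs => rw [hv]
  rw [map_sum]
  refine Finset.sum_congr rfl fun k _ => ?_
  rw [map_smul, Algebra.smul_def]
  rfl

theorem one_lt_card_const (F : Type*) [Field F] [Finite F] : (1 : ℝ) < Nat.card F := by
  exact_mod_cast Finite.one_lt_card

theorem affinoid_mono {M N : ℕ} (h : M ≤ N) : affinoid inf r M ⊆ affinoid inf r N := by
  have hq := (one_lt_card_const F).le
  rintro w ⟨h1, h2⟩
  refine ⟨fun j => (h1 j).trans (pow_le_pow_right₀ hq h), fun a j => (h2 a j).trans ?_⟩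
  gcongr

/-- A large `N` accommodates both the coordinates and the constant of `PsiBar.exists_lower_bound`,
so the affinoids exhaust the open stratum. -/
theorem PsiBar.exists_mem_affinoid (hK : IsFunctionField F K) {t : K}
    (ht : t ∈ regularRing inf) (htr : Transcendental F t) (ω : PsiBar inf r) (h : ω.U = ⊤) :
    ∃ N, ω.coord h ∈ affinoid inf r N := by
  obtain ⟨c, hc, hlow⟩ := ω.exists_lower_bound hK ht htr
  obtain ⟨N, hN⟩ := pow_unbounded_of_one_lt (max c⁻¹ (∑ j, ‖ω.coord h j‖)) (one_lt_card_const F)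
  refine ⟨N, fun j => ?_, fun a j => ?_⟩
  · refine le_trans ?_ ((le_max_right _ _).trans hN.le)
    exact Finset.single_le_sum (f := fun j => ‖ω.coord h j‖) (fun _ _ => norm_nonneg _)
      (Finset.mem_univ j)
  · have h1 := hlow ⟨a, h ▸ Submodule.mem_top⟩ j
    rw [ω.i_eq_sum_coord h] at h1
    calc inf.abv (a j) = c⁻¹ * (c * inf.abv (a j)) := by field_simp
      _ ≤ _ := mul_le_mul ((le_max_left _ _).trans hN.le) h1
        (mul_nonneg hc.le (inf.abv.nonneg _)) (by positivity)

/-- The point of the open stratum with given coordinates in one of the standard affinoids. -/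
theorem exists_psiBar_coord (hK : IsFunctionField F K) {t : K} (ht : t ∈ regularRing inf)
    (htr : Transcendental F t) (hr : 0 < r) {N : ℕ} {w : Fin r → Cinf inf}
    (hw : w ∈ affinoid inf r N) : ∃ (ω : PsiBar inf r) (h : ω.U = ⊤), ω.coord h = w := by
  let i : (⊤ : Submodule K (Fin r → K)) →ₗ[K] Cinf inf :=
    ((Fintype.linearCombination K w)).comp (Submodule.subtype ⊤)
  have hi : ∀ v, i v = ∑ k, algebraMap K (Cinf inf) ((v : Fin r → K) k) * w k := by
    intro v
    change Fintype.linearCombination K w v = _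
    rw [Fintype.linearCombination_apply]
    exact Finset.sum_congr rfl fun k _ => Algebra.smul_def _ _
  have hnt : Nontrivial (Fin r → K) := by
    have : Nonempty (Fin r) := ⟨⟨0, hr⟩⟩
    infer_instance
  refine ⟨⟨⊤, top_ne_bot, i, ?_, ?_⟩, rfl, ?_⟩
  · rw [injective_iff_map_eq_zero]
    intro v hv
    apply Subtype.ext
    funext j
    have h1 := hw.2 v j
    rw [← hi, hv, norm_zero, mul_zero] at h1
    exact (AbsoluteValue.eq_zero _).1 (le_antisymm h1 (inf.abv.nonneg _))
  · intro L hL R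
    obtain ⟨d, hd0, -, hd⟩ := exists_denominator hK ht htr hL.fg
    have h1 := hasFiniteHeights_of_denominator (N := (L : Set (Fin r → K))) hK hd0 hd
      ((Nat.card F : ℝ) ^ N * R)
    refine ((h1.preimage (f := fun v : (⊤ : Submodule K (Fin r → K)) => (v : Fin r → K))
      Subtype.val_injective.injOn).image i).subset ?_
    rintro _ ⟨⟨v, hv, rfl⟩, hR⟩
    refine ⟨v, ⟨hv, fun j => ?_⟩, rfl⟩
    have h2 := hw.2 v j
    rw [← hi] at h2
    refine h2.trans ?_
    have : ‖i v‖ ≤ R := by simpa using hR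
    gcongr
  · funext j
    change i _ = _
    rw [hi]
    rw [Finset.sum_eq_single j]
    · simp
    · intro k _ hk; simp [hk]
    · intro h; exact absurd (Finset.mem_univ j) h

end Lattices

/-! ### The isogeny polynomial and the discriminant form -/

section Isogeny

open Polynomial

variable {F K : Type*} [Field F] [Finite F] [Field K] [Algebra F K] {inf : Place F K} {r : ℕ}

/-- `U` is a `K`-space, so dividing by one nonzero element of `n` stays inside it; forming `n⁻¹`
therefore commutes with `i`. -/
theorem PsiBar.mem_idealInv_lattice {ω : PsiBar inf r}
    {Y : Submodule (regularRing inf) (Fin r → K)} {n : Ideal (regularRing inf)} (hn : n ≠ ⊥)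
    {z : Cinf inf} : z ∈ idealInv n (ω.lattice Y) ↔
      ∃ v : ω.U, (v : Fin r → K) ∈ idealInv n Y ∧ ω.i v = z := by
  constructor
  · intro hz
    obtain ⟨a, han, ha⟩ := Submodule.exists_mem_ne_zero_of_ne_bot hn
    have ha0 : (a : K) ≠ 0 := fun h => ha (Subtype.ext h)
    obtain ⟨v, hv, hvz⟩ := hz a han
    have hz' : ω.i ((a : K)⁻¹ • v) = z := by
      rw [map_smul]
      have h1 : ω.i v = (a : K) • z := hvz
      rw [h1, smul_smul, inv_mul_cancel₀ ha0, one_smul]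
    refine ⟨(a : K)⁻¹ • v, fun b hb => ?_, hz'⟩
    obtain ⟨w, hw, hwz⟩ := hz b hb
    have h2 : ω.i w = ω.i ((b : K) • ((a : K)⁻¹ • v)) := by
      rw [map_smul, hz']; exact hwz
    have h3 := congrArg Subtype.val (ω.injective h2)
    have hw' : (w : Fin r → K) ∈ Y := hw
    rw [h3] at hw'
    exact hw'
  · rintro ⟨v, hv, rfl⟩ b hb
    exact ⟨(b : K) • v, hv b hb, map_smul ω.i (b : K) v⟩

theorem const_smul_mem {M : Type*} [AddCommGroup M] [Module K M]
    [Module F M] [IsScalarTower F K M]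
    (Y : Submodule (regularRing inf) M) (c : F) {y : M} (hy : y ∈ Y) : c • y ∈ Y := by
  have h : c • y = (algebraMap F (regularRing inf) c) • y := by
    rw [Subalgebra.smul_def]
    exact (algebraMap_smul K c y).symm
  rw [h]; exact Y.smul_mem _ hy

/-- The image in `C_∞` of the elements of `U` that are congruent to `u` modulo `Y`. -/
def PsiBar.cosetImage (ω : PsiBar inf r) (Y : Submodule (regularRing inf) (Fin r → K))
    (u : Fin r → K) : Set (Cinf inf) :=
  {z | ∃ v : ω.U, (v : Fin r → K) - u ∈ Y ∧ ω.i v = z}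

theorem PsiBar.cosetImage_eq (ω : PsiBar inf r) (Y : Submodule (regularRing inf) (Fin r → K))
    {u : Fin r → K} (hu : u ∉ Y) : ω.cosetImage Y u = ∅ ∨
      ∃ z, z ∉ (ω.lattice Y).toAddSubgroup ∧
        ω.cosetImage Y u = {x | x - z ∈ (ω.lattice Y).toAddSubgroup} := by
  rcases Set.eq_empty_or_nonempty (ω.cosetImage Y u) with h | ⟨z, v, hv, rfl⟩
  · exact Or.inl h
  · refine Or.inr ⟨ω.i v, ?_, ?_⟩
    · rintro ⟨w, hw, hwv⟩
      have hw' : (w : Fin r → K) ∈ Y := hw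
      have h2 : w = v := ω.injective hwv
      rw [h2] at hw'
      exact hu (by simpa using sub_mem hw' hv)
    · ext x
      constructor
      · rintro ⟨w, hw, rfl⟩
        refine ⟨w - v, ?_, map_sub _ _ _⟩
        have : (w : Fin r → K) - v ∈ Y := by simpa using sub_mem hw hv
        exact this
      · rintro ⟨w, hw, hwx⟩
        have hw' : (w : Fin r → K) ∈ Y := hw
        refine ⟨w + v, ?_, ?_⟩
        · have := add_mem hw' hv
          rw [← add_sub_assoc] at this
          exact this
        · have h1 : ω.i w = x - ω.i v := hwx
          rw [map_add, h1, sub_add_cancel]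

theorem partialEisenstein_eq_tsum_coset (ω : PsiBar inf r)
    (Y : Submodule (regularRing inf) (Fin r → K)) {u : Fin r → K} (hu : u ∉ Y) :
    partialEisenstein Y 1 u ω = ∑' z : ω.cosetImage Y u, (z : Cinf inf)⁻¹ := by
  let e : {v : ω.U // (v : Fin r → K) - u ∈ Y ∧ v ≠ 0} ≃ ω.cosetImage Y u :=
    Equiv.ofBijective (fun v => ⟨ω.i v, v, v.2.1, rfl⟩) <| by
      constructor
      · intro v w h
        exact Subtype.ext (ω.injective (congrArg Subtype.val h))
      · rintro ⟨_, v, hv, rfl⟩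
        refine ⟨⟨v, hv, ?_⟩, rfl⟩
        rintro rfl
        exact hu (by simpa using neg_mem hv)
  rw [← e.tsum_eq]
  exact tsum_congr fun v => by rw [pow_one]; rfl

theorem partialEisenstein_congr (ω : PsiBar inf r)
    (Y : Submodule (regularRing inf) (Fin r → K)) (k : ℕ) {u u' : Fin r → K} (h : u - u' ∈ Y) :
    partialEisenstein Y k u ω = partialEisenstein Y k u' ω := by
  have h1 : ∀ v : ω.U, ((v : Fin r → K) - u ∈ Y ∧ v ≠ 0) ↔ ((v : Fin r → K) - u' ∈ Y ∧ v ≠ 0) := by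
    intro v
    refine and_congr_left fun _ => ⟨fun h2 => ?_, fun h2 => ?_⟩
    · simpa using add_mem h2 h
    · simpa using sub_mem h2 h
  exact (Equiv.subtypeEquivRight h1).tsum_eq
    (fun v : {v : ω.U // (v : Fin r → K) - u' ∈ Y ∧ v ≠ 0} => (ω.i (v : ω.U) ^ k)⁻¹)

theorem partialEisenstein_smul (ω : PsiBar inf r)
    (Y : Submodule (regularRing inf) (Fin r → K)) (u : Fin r → K) {c : F} (hc : c ≠ 0) :
    partialEisenstein Y 1 (c • u) ω =
      (algebraMap F (Cinf inf) c)⁻¹ * partialEisenstein Y 1 u ω := by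
  have hc' : algebraMap F K c ≠ 0 := by simpa using hc
  have hmem : ∀ v : ω.U, ((v : Fin r → K) - u ∈ Y ∧ v ≠ 0) ↔
      (((algebraMap F K c • v : ω.U) : Fin r → K) - c • u ∈ Y ∧ algebraMap F K c • v ≠ 0) := by
    intro v
    have h1 : ((algebraMap F K c • v : ω.U) : Fin r → K) - c • u = c • ((v : Fin r → K) - u) := by
      rw [Submodule.coe_smul, algebraMap_smul, smul_sub]
    rw [h1, smul_ne_zero_iff]
    refine and_congr ⟨fun h => const_smul_mem Y c h, fun h => ?_⟩ ?_
    · have := const_smul_mem Y c⁻¹ h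
      rwa [smul_smul, inv_mul_cancel₀ hc, one_smul] at this
    · simp [hc]
  let e : {v : ω.U // (v : Fin r → K) - u ∈ Y ∧ v ≠ 0} ≃
      {v : ω.U // (v : Fin r → K) - c • u ∈ Y ∧ v ≠ 0} :=
    (LinearEquiv.smulOfNeZero K ω.U _ hc').toEquiv.subtypeEquiv hmem
  rw [partialEisenstein, ← e.tsum_eq, partialEisenstein, ← tsum_mul_left]
  refine tsum_congr fun v => ?_
  have h2 : ω.i (e v : ω.U) = algebraMap F (Cinf inf) c * ω.i v := by
    change ω.i (algebraMap F K c • (v : ω.U)) = _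
    rw [map_smul, Algebra.smul_def]
    rfl
  rw [h2, pow_one, pow_one, mul_inv]

/-! ### The isogeny polynomial -/

/-- The elements of `F^*` are the roots of `X^(q-1) - 1`; evaluate its factorization at `x⁻¹`. -/
theorem prod_units_one_sub [Fintype Fˣ] {R : Type*} [Field R] [Algebra F R] (x : R) :
    ∏ c : Fˣ, (1 - x * (algebraMap F R (c : F))⁻¹) = 1 - x ^ (Nat.card F - 1) := by
  classical
  have := Fintype.ofFinite F
  have hq : 1 < Fintype.card F := Fintype.one_lt_card
  have hcard : Fintype.card Fˣ = Fintype.card F - 1 := by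
    rw [← Nat.card_eq_fintype_card, ← Nat.card_eq_fintype_card, Nat.card_units]
  have h1 : ∏ c : Fˣ, (X - Polynomial.C (algebraMap F R (c : F))) = X ^ (Fintype.card F - 1) - 1 := by
    have hmon : (∏ c : Fˣ, (X - Polynomial.C (algebraMap F R (c : F)))).Monic :=
      monic_prod_of_monic _ _ fun c _ => monic_X_sub_C _
    have hmon' : ((X : R[X]) ^ (Fintype.card F - 1) - 1).Monic :=
      monic_X_pow_sub_C 1 (by omega)
    have hdeg : (∏ c : Fˣ, (X - Polynomial.C (algebraMap F R (c : F)))).natDegree =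
        Fintype.card F - 1 := by
      rw [natDegree_prod_of_monic _ _ fun c _ => monic_X_sub_C _]; simp [hcard]
    have hdeg' : ((X : R[X]) ^ (Fintype.card F - 1) - 1).natDegree = Fintype.card F - 1 :=
      natDegree_X_pow_sub_C (r := (1 : R))
    have hinj : Function.Injective fun c : Fˣ => algebraMap F R (c : F) :=
      (algebraMap F R).injective.comp Units.val_injective
    refine sub_eq_zero.1 (eq_zero_of_degree_lt_of_eval_finset_eq_zero
      (Finset.univ.image fun c : Fˣ => algebraMap F R (c : F)) ?_ ?_)
    · rw [Finset.card_image_of_injective _ hinj, Finset.card_univ, hcard]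
      refine (degree_sub_lt_left ?_ hmon.ne_zero ?_).trans_eq ?_
      · rw [degree_eq_natDegree hmon.ne_zero, degree_eq_natDegree hmon'.ne_zero, hdeg, hdeg']
      · rw [hmon.leadingCoeff, hmon'.leadingCoeff]
      · rw [degree_eq_natDegree hmon.ne_zero, hdeg]
    · intro z hz
      obtain ⟨c, -, rfl⟩ := Finset.mem_image.1 hz
      rw [eval_sub, eval_prod, Finset.prod_eq_zero (Finset.mem_univ c) (by simp), eval_sub,
        eval_pow, eval_X, eval_one, ← map_pow, FiniteField.pow_card_sub_one_eq_one _ c.ne_zero]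
      simp
  have hinv : ∏ c : Fˣ, (1 - x * (algebraMap F R (c : F))⁻¹) =
      ∏ c : Fˣ, (1 - x * algebraMap F R (c : F)) :=
    Fintype.prod_equiv (Equiv.inv Fˣ) _ _ fun c => by simp
  rw [hinv, Nat.card_eq_fintype_card]
  by_cases hx : x = 0
  · rw [hx, zero_pow (by omega)]; simp
  have h2 := congrArg (eval x⁻¹) h1
  rw [eval_prod, eval_sub, eval_pow, eval_X, eval_one] at h2
  have h3 : ∏ c : Fˣ, (1 - x * algebraMap F R (c : F)) =
      x ^ (Fintype.card F - 1) * ∏ c : Fˣ, eval x⁻¹ (X - Polynomial.C (algebraMap F R (c : F))) := by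
    rw [← hcard, ← Finset.card_univ, ← Finset.prod_const, ← Finset.prod_mul_distrib]
    refine Finset.prod_congr rfl fun c _ => ?_
    rw [eval_sub, eval_X, eval_C, mul_sub, mul_inv_cancel₀ hx]
  rw [h3, h2, mul_sub, ← mul_pow, mul_inv_cancel₀ hx, one_pow, mul_one]

/-- Two points of the unit ball with the same value differ by one of the finitely many elements of
`L` in that ball, while the ball contains arbitrarily large finite sets. Infinitely many values are
needed to determine the isogeny polynomial. -/
theorem discreteExp_infinite {L : AddSubgroup (Cinf inf)}
    (hL : IsDiscreteSet (L : Set (Cinf inf))) :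
    (Set.range (discreteExp (L : Set (Cinf inf)))).Infinite := by
  classical
  intro hfin
  set e := discreteExp (L : Set (Cinf inf)) with he
  set m := (hL.ball 1).card with hm
  obtain ⟨T, hTc, hT1, -⟩ := exists_separated_finset inf (m * hfin.toFinset.card + 1)
  have hfib : ∀ b ∈ T.image e, (T.filter fun a => e a = b).card ≤ m := by
    intro b hb
    obtain ⟨a₀, ha₀, rfl⟩ := Finset.mem_image.1 hb
    refine Finset.card_le_card_of_injOn (fun a => a - a₀) ?_ fun a _ b _ h => by simpa using h
    intro a ha
    have ha' := Finset.mem_filter.1 ha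
    refine hL.mem_ball.2 ⟨?_, (norm_sub_le_max_of_ultrametric _ _).trans
      (max_le (hT1 a ha'.1) (hT1 a₀ ha₀))⟩
    by_contra hn
    refine discreteExp_ne_zero hL hn ?_
    have h1 := discreteExp_add hL (a - a₀) a₀
    rw [sub_add_cancel] at h1
    have h2 := ha'.2
    rw [he] at h2
    rw [h2] at h1
    simpa using h1
  have h1 := Finset.card_le_mul_card_image T m hfib
  have h2 : (T.image e).card ≤ hfin.toFinset.card := Finset.card_le_card fun b hb => by
    obtain ⟨a, -, rfl⟩ := Finset.mem_image.1 hb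
    exact hfin.mem_toFinset.2 ⟨a, rfl⟩
  have h3 := Nat.mul_le_mul_left m h2
  omega

section

variable (hK : IsFunctionField F K) {t : K} (ht : t ∈ regularRing inf) (htr : Transcendental F t)
  {Y : Submodule (regularRing inf) (Fin r → K)} (hY : Y.FG) {n : Ideal (regularRing inf)}
  (hn : n ≠ ⊥)
include hK ht htr hY

theorem hasFiniteHeights_of_fg : HasFiniteHeights inf (Y : Set (Fin r → K)) := by
  obtain ⟨d, hd0, -, hd⟩ := exists_denominator hK ht htr hY
  exact hasFiniteHeights_of_denominator hK hd0 hd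

theorem isDiscreteSet_lattice (ω : PsiBar inf r) :
    IsDiscreteSet ((ω.lattice Y).toAddSubgroup : Set (Cinf inf)) :=
  ω.finite_of_hasFiniteHeights hK ht htr (hasFiniteHeights_of_fg hK ht htr hY)

include hn

theorem hasFiniteHeights_idealInv : HasFiniteHeights inf (idealInv n Y : Set (Fin r → K)) := by
  obtain ⟨d, hd0, -, hd⟩ := exists_denominator_idealInv hK ht htr hY hn
  exact hasFiniteHeights_of_denominator hK hd0 hd

theorem isDiscreteSet_idealInv (ω : PsiBar inf r) :
    IsDiscreteSet (idealInv n (ω.lattice Y) : Set (Cinf inf)) :=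
  (ω.finite_of_hasFiniteHeights hK ht htr (hasFiniteHeights_idealInv hK ht htr hY hn)).mono
    fun _ hz => (PsiBar.mem_idealInv_lattice hn).1 hz

/-- The nonzero classes of `n⁻¹Y / Y` are the `c s` with `(s, c) ∈ S × F^*`, each once. The factors
for fixed `s` multiply to `1 - (e E_{1,s})^(q-1)`. -/
theorem expLattice_idealInv {S : Finset (Fin r → K)} (hS : IsRepSystem Y n S)
    (ω : PsiBar inf r) (z : Cinf inf) :
    expLattice (idealInv n (ω.lattice Y)) z = expLattice (ω.lattice Y) z *
      ∏ s ∈ S, (1 - (expLattice (ω.lattice Y) z * partialEisenstein Y 1 s ω) ^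
        (Nat.card F - 1)) := by
  classical
  have := Fintype.ofFinite Fˣ
  set L := (ω.lattice Y).toAddSubgroup with hLdef
  have hL := isDiscreteSet_lattice hK ht htr hY ω
  have hYL : ∀ u ∈ idealInv n Y, u ∉ Y → ∀ c : F, c ≠ 0 → c • u ∉ Y := by
    intro u _ hu c hc h
    have := const_smul_mem Y c⁻¹ h
    rw [smul_smul, inv_mul_cancel₀ hc, one_smul] at this
    exact hu this
  have hsub : Y ≤ idealInv n Y := fun y hy a _ => Y.smul_mem a hy
  have key := discreteExp_eq_mul_prod (L := L) hL (isDiscreteSet_idealInv hK ht htr hY hn ω)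
    (J := S × Fˣ) (fun p => ω.cosetImage Y ((p.2 : F) • (p.1 : Fin r → K))) ?_ ?_ ?_ ?_ z
  · have h1 : ∀ p : S × Fˣ, ∑' g : ω.cosetImage Y ((p.2 : F) • (p.1 : Fin r → K)),
        (g : Cinf inf)⁻¹ = (algebraMap F (Cinf inf) (p.2 : F))⁻¹ *
          partialEisenstein Y 1 (p.1 : Fin r → K) ω := by
      intro p
      rw [← partialEisenstein_smul ω Y _ p.2.ne_zero, partialEisenstein_eq_tsum_coset]
      exact hYL _ (hS.mem _ p.1.2).1 (hS.mem _ p.1.2).2 _ p.2.ne_zero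
    simp only [h1] at key
    rw [Fintype.prod_prod_type] at key
    refine key.trans ?_
    congr 1
    refine Eq.trans ?_ (Finset.prod_coe_sort S fun s => 1 -
      (expLattice (ω.lattice Y) z * partialEisenstein Y 1 s ω) ^ (Nat.card F - 1))
    refine Finset.prod_congr rfl fun s _ => ?_
    rw [← prod_units_one_sub (F := F)]
    refine Finset.prod_congr rfl fun c _ => ?_
    change 1 - expLattice (ω.lattice Y) z * _ = _
    ring
  · rintro ⟨s, c⟩ ⟨s', c'⟩ hne
    rw [Set.disjoint_left]
    rintro _ ⟨v, hv, rfl⟩ ⟨w, hw, hwv⟩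
    have hwv' : w = v := ω.injective hwv
    subst hwv'
    have hs := hS.mem _ s.2
    have hs' := hS.mem _ s'.2
    have hcs : (c : F) • (s : Fin r → K) ∈ idealInv n Y := const_smul_mem _ _ hs.1
    have hwn : (w : Fin r → K) ∈ idealInv n Y := by
      have := add_mem (hsub hv) hcs
      simpa using this
    have hwY : (w : Fin r → K) ∉ Y := fun h => hYL _ hs.1 hs.2 _ c.ne_zero (by
      simpa using sub_mem h hv)
    have hss : (s : Fin r → K) = s' := (hS.existsUnique _ hwn hwY).unique
      ⟨s.2, c, c.ne_zero, hv⟩ ⟨s'.2, c', c'.ne_zero, hw⟩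
    have hcc : (c : F) = c' := by
      by_contra hcc
      have h1 := sub_mem hw hv
      rw [sub_sub_sub_cancel_left, ← hss, ← sub_smul] at h1
      exact hYL _ hs.1 hs.2 _ (sub_ne_zero.2 hcc) h1
    exact hne (Prod.ext (Subtype.ext hss) (Units.ext hcc))
  · rintro ⟨s, c⟩
    rw [Set.disjoint_left]
    rintro _ ⟨v, hv, rfl⟩ ⟨w, hw, hwv⟩
    have hwv' : w = v := ω.injective hwv
    subst hwv'
    have hs := hS.mem _ s.2
    have hv' : (w : Fin r → K) ∈ Y := hv
    exact hYL _ hs.1 hs.2 _ c.ne_zero (by simpa using sub_mem hv' hw)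
  · intro x
    refine (PsiBar.mem_idealInv_lattice hn).trans ⟨?_, ?_⟩
    · rintro ⟨v, hv, rfl⟩
      by_cases hvY : (v : Fin r → K) ∈ Y
      · exact Or.inl ⟨v, hvY, rfl⟩
      · obtain ⟨s, ⟨hs, c, hc, hcs⟩, -⟩ := hS.existsUnique _ hv hvY
        exact Or.inr ⟨(⟨s, hs⟩, Units.mk0 c hc), v, hcs, rfl⟩
    · rintro (⟨v, hv, rfl⟩ | ⟨⟨s, c⟩, v, hv, rfl⟩)
      · exact ⟨v, hsub hv, rfl⟩
      · refine ⟨v, ?_, rfl⟩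
        have hcs : (c : F) • (s : Fin r → K) ∈ idealInv n Y :=
          const_smul_mem _ _ (hS.mem _ s.2).1
        have := add_mem (hsub hv) hcs
        simpa using this
  · rintro ⟨s, c⟩
    have hs := hS.mem _ s.2
    exact ω.cosetImage_eq Y (hYL _ hs.1 hs.2 _ c.ne_zero)

/-- Any polynomial of the isogeny is determined by its values on the infinite range of `e^Λ`, so the
chosen one is the explicit product. -/
theorem isogenyPoly_eq {S : Finset (Fin r → K)} (hS : IsRepSystem Y n S) (ω : PsiBar inf r) :
    isogenyPoly n (ω.lattice Y) =
      X * ∏ s ∈ S, (1 - Polynomial.C (partialEisenstein Y 1 s ω ^ (Nat.card F - 1)) *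
        X ^ (Nat.card F - 1)) := by
  have hφ : IsIsogeny n (ω.lattice Y) (X * ∏ s ∈ S,
      (1 - Polynomial.C (partialEisenstein Y 1 s ω ^ (Nat.card F - 1)) *
        X ^ (Nat.card F - 1))) := by
    intro z
    rw [expLattice_idealInv hK ht htr hY hn hS ω z, eval_mul, eval_X, eval_prod]
    congr 1
    refine Finset.prod_congr rfl fun s _ => ?_
    simp only [eval_sub, eval_one, eval_mul, eval_C, eval_pow, eval_X]
    rw [mul_pow, mul_comm]
  have hex : ∃ φ, IsIsogeny n (ω.lattice Y) φ := ⟨_, hφ⟩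
  have hch : isogenyPoly n (ω.lattice Y) = hex.choose := by
    rw [isogenyPoly, dif_pos hex]
  rw [hch]
  refine eq_of_infinite_eval_eq _ _
    ((discreteExp_infinite (isDiscreteSet_lattice hK ht htr hY ω)).mono ?_)
  rintro _ ⟨z, rfl⟩
  exact (hex.choose_spec z).symm.trans (hφ z)

/-- By `hcard` the index is the largest degree the product can have, so the coefficient is the
product of the coefficients of `X^(q-1)` in the factors, also when some of these vanish. -/
theorem discriminantForm_eq {S : Finset (Fin r → K)} (hS : IsRepSystem Y n S)
    (hcard : S.card * (Nat.card F - 1) + 1 = Nat.card F ^ (r * degree n)) (ω : PsiBar inf r) :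
    discriminantForm Y n ω = (-1) ^ S.card * rootForm Y S ω ^ (Nat.card F - 1) := by
  have hq : Nat.card F - 1 ≠ 0 := by
    have : 1 < Nat.card F := Finite.one_lt_card
    omega
  rw [discriminantForm, isogenyPoly_eq hK ht htr hY hn hS ω, ← hcard, coeff_X_mul,
    coeff_prod_of_natDegree_le]
  · rw [rootForm, ← Finset.prod_pow, ← Finset.prod_const, ← Finset.prod_mul_distrib]
    refine Finset.prod_congr rfl fun s _ => ?_
    rw [coeff_sub, coeff_C_mul, coeff_X_pow_self, coeff_one, if_neg hq]
    ring
  · intro s _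
    refine (natDegree_sub_le _ _).trans (max_le (by simp) ?_)
    exact natDegree_C_mul_X_pow_le _ _

end

/-- `N = 1 + q + ... + q^(m-1)`, and `(-1)^(q^i) = -1` because Frobenius fixes `F`; this covers even
`q` too. -/
theorem neg_one_pow_geom_sum {R : Type*} [Field R] [Algebra F R] (m N : ℕ)
    (h : N * (Nat.card F - 1) + 1 = Nat.card F ^ m) : (-1 : R) ^ N = (-1) ^ m := by
  have := Fintype.ofFinite F
  have hq : 1 < Nat.card F := Finite.one_lt_card
  have hN : N = ∑ i ∈ Finset.range m, Nat.card F ^ i := by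
    rw [Nat.geomSum_eq hq, ← h, Nat.add_sub_cancel, Nat.mul_div_cancel _ (by omega)]
  have h1 : ∀ i : ℕ, (-1 : R) ^ Nat.card F ^ i = -1 := by
    intro i
    have h2 : (-1 : F) ^ Nat.card F ^ i = -1 := by
      rw [Nat.card_eq_fintype_card]; exact FiniteField.pow_card_pow i _
    have h3 := congrArg (algebraMap F R) h2
    simpa using h3
  rw [hN, ← Finset.prod_pow_eq_pow_sum, Finset.prod_congr rfl fun i _ => h1 i]
  simp

end Isogeny

/-! ### Products over lines and the determinant -/

section Projective

variable {F : Type*} [Field F] [Finite F]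

/-- `S` is a system of representatives for the nonzero vectors of `M` modulo scalars. -/
structure IsProjectiveSystem (F : Type*) [Field F] {M : Type*} [AddCommGroup M] [Module F M]
    (S : Finset M) : Prop where
  ne_zero : ∀ u ∈ S, u ≠ 0
  existsUnique : ∀ u : M, u ≠ 0 → ∃! s, s ∈ S ∧ ∃ c : F, c ≠ 0 ∧ u = c • s

variable {M : Type*} [AddCommGroup M] [Module F M] {S : Finset M} {C : Type*} [Field C]
  [Algebra F C]

/-- An injective `g` permutes the lines: `g u = c_u σ(u)` with a permutation `σ` of `S`. The factor
`∏ c_u` does not involve `e`, so it can be computed with any convenient function. -/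
theorem IsProjectiveSystem.exists_factor (hS : IsProjectiveSystem F S) {g : M →ₗ[F] M}
    (hg : Function.Injective g) : ∃ χ : F, ∀ e : M → C,
      (∀ (c : F) u, e (c • u) = algebraMap F C c * e u) →
      ∏ u ∈ S, e (g u) = algebraMap F C χ * ∏ u ∈ S, e u := by
  classical
  have hgu : ∀ u ∈ S, g u ≠ 0 := fun u hu h =>
    hS.ne_zero u hu (hg (h.trans (map_zero g).symm))
  choose! σ hσ using fun u (hu : u ∈ S) => (hS.existsUnique _ (hgu u hu)).exists
  choose! hσS c hc0 hc using hσ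
  have hinj : Set.InjOn σ S := by
    intro u hu v hv huv
    have h1 : u = (c u * (c v)⁻¹) • v := by
      apply hg
      rw [map_smul, hc u hu, hc v hv, huv, smul_smul, mul_assoc, inv_mul_cancel₀ (hc0 v hv),
        mul_one]
    exact (hS.existsUnique u (hS.ne_zero u hu)).unique ⟨hu, 1, one_ne_zero, (one_smul _ _).symm⟩
      ⟨hv, _, mul_ne_zero (hc0 u hu) (inv_ne_zero (hc0 v hv)), h1⟩
  have himg : S.image σ = S :=
    Finset.eq_of_subset_of_card_le (Finset.image_subset_iff.2 hσS)
      (Finset.card_image_of_injOn hinj).ge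
  refine ⟨∏ u ∈ S, c u, fun e he => ?_⟩
  have h1 : ∏ u ∈ S, e u = ∏ u ∈ S, e (σ u) := by
    conv_lhs => rw [← himg, Finset.prod_image hinj]
  rw [map_prod, h1, ← Finset.prod_mul_distrib]
  exact Finset.prod_congr rfl fun u hu => by rw [hc u hu, he]

/-- Take the coordinate of `u` with respect to the representative of its line. -/
theorem IsProjectiveSystem.exists_homogeneous (hS : IsProjectiveSystem F S) :
    ∃ e : M → F, (∀ (c : F) u, e (c • u) = c * e u) ∧ ∀ u, u ≠ 0 → e u ≠ 0 := by
  classical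
  choose! s hs using fun u (hu : u ≠ 0) => (hS.existsUnique u hu).exists
  choose! hsS c hc0 hc using hs
  refine ⟨fun u => if u = 0 then 0 else c u, fun a u => ?_, fun u hu => ?_⟩
  · by_cases hu : u = 0
    · simp [hu]
    by_cases ha : a = 0
    · simp [ha]
    have hau : a • u ≠ 0 := smul_ne_zero ha hu
    simp only [if_neg hau, if_neg hu]
    have h1 : s (a • u) = s u := (hS.existsUnique _ hau).unique
      ⟨hsS _ hau, _, hc0 _ hau, hc _ hau⟩
      ⟨hsS _ hu, a * c u, mul_ne_zero ha (hc0 u hu), by rw [mul_smul, ← hc u hu]⟩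
    have h2 : c (a • u) • s u = (a * c u) • s u := by
      rw [mul_smul, ← hc u hu, ← h1, ← hc _ hau]
    exact smul_left_injective F (hS.ne_zero _ (hsS u hu)) h2
  · simpa [hu] using hc0 u hu

variable {ι : Type*} [Fintype ι] [DecidableEq ι]

/-- Lines with nonzero `i`-th coordinate correspond to vectors with that coordinate equal to one, so
their number is a power of `q`, and raising to such a power is trivial on `F`. -/
theorem IsProjectiveSystem.card_filter {S : Finset (ι → F)} (hS : IsProjectiveSystem F S)
    (i : ι) [DecidablePred fun u : ι → F => u i ≠ 0] (a : F) :
    a ^ (S.filter fun u => u i ≠ 0).card = a := by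
  classical
  have := Fintype.ofFinite F
  have h1 : (S.filter fun u => u i ≠ 0).card = Fintype.card ({j : ι // j ≠ i} → F) := by
    rw [← Finset.card_univ]
    refine Finset.card_bij (fun u _ j => (u i)⁻¹ * u j) (fun _ _ => Finset.mem_univ _) ?_ ?_
    · intro u hu v hv huv
      rw [Finset.mem_filter] at hu hv
      have h2 : u = (u i * (v i)⁻¹) • v := by
        ext j
        rw [Pi.smul_apply, smul_eq_mul]
        by_cases hj : j = i
        · rw [hj, mul_assoc, inv_mul_cancel₀ hv.2, mul_one]
        · have := congrFun huv ⟨j, hj⟩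
          rw [mul_assoc, ← this, mul_inv_cancel_left₀ hu.2]
      exact (hS.existsUnique u (hS.ne_zero u hu.1)).unique
        ⟨hu.1, 1, one_ne_zero, (one_smul _ _).symm⟩
        ⟨hv.1, _, mul_ne_zero hu.2 (inv_ne_zero hv.2), h2⟩
    · intro w _
      let u : ι → F := fun j => if h : j = i then 1 else w ⟨j, h⟩
      have hui : u i = 1 := by simp [u]
      have hu0 : u ≠ 0 := fun h => one_ne_zero (hui.symm.trans (congrFun h i))
      obtain ⟨s, ⟨hs, c, hc, hcs⟩, -⟩ := hS.existsUnique u hu0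
      have hci : c * s i = 1 := by rw [← hui, hcs]; rfl
      have hsi : s i ≠ 0 := right_ne_zero_of_mul_eq_one hci
      refine ⟨s, Finset.mem_filter.2 ⟨hs, hsi⟩, funext fun j => ?_⟩
      have h2 : (s i)⁻¹ = c := (eq_inv_of_mul_eq_one_left hci).symm
      have h3 : u j = w j := by simp [u, j.2]
      rw [h2, ← h3, hcs]; rfl
  rw [h1, Fintype.card_fun]
  exact FiniteField.pow_card_pow _ _

/-- A test function without zeros on `S` reads off the universal factor of `exists_factor`. -/
theorem IsProjectiveSystem.prod_of_test {S : Finset (ι → F)} (hS : IsProjectiveSystem F S)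
    {A : Matrix ι ι F} (hA : A.det ≠ 0) (e₁ : (ι → F) → F)
    (he₁ : ∀ (c : F) u, e₁ (c • u) = c * e₁ u) (h0 : ∀ u, u ≠ 0 → e₁ u ≠ 0) {δ : F}
    (h1 : ∏ u ∈ S, e₁ (A *ᵥ u) = δ * ∏ u ∈ S, e₁ u) (e : (ι → F) → C)
    (he : ∀ (c : F) u, e (c • u) = algebraMap F C c * e u) :
    ∏ u ∈ S, e (A *ᵥ u) = algebraMap F C δ * ∏ u ∈ S, e u := by
  have hinj : Function.Injective A.mulVecLin :=
    Matrix.mulVec_injective_iff_isUnit.2 ((Matrix.isUnit_iff_isUnit_det A).2 hA.isUnit)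
  obtain ⟨χ, hχ⟩ := hS.exists_factor (C := C) hinj
  have h2 := hχ (fun u => algebraMap F C (e₁ u)) fun c u => by rw [he₁, map_mul]
  have h3 : ∏ u ∈ S, algebraMap F C (e₁ u) ≠ 0 := Finset.prod_ne_zero_iff.2 fun u hu =>
    (map_ne_zero _).2 (h0 u (hS.ne_zero u hu))
  have h4 := congrArg (algebraMap F C) h1
  rw [map_mul, map_prod, map_prod] at h4
  simp only [Matrix.mulVecLin_apply] at h2
  rw [h2] at h4
  rw [← mul_right_cancel₀ h3 h4]
  exact hχ e he

open Classical in
-- A test function adapted to elementary matrices: a coordinate wherever it is nonzero, patched to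
-- be nonzero elsewhere.
theorem IsProjectiveSystem.exists_homogeneous_coord {S : Finset (ι → F)}
    (hS : IsProjectiveSystem F S) (i : ι) :
    ∃ e : (ι → F) → F, (∀ (c : F) u, e (c • u) = c * e u) ∧ (∀ u, u ≠ 0 → e u ≠ 0) ∧
      ∀ u, u i ≠ 0 → e u = u i := by
  obtain ⟨e₀, he₀, h0⟩ := hS.exists_homogeneous
  refine ⟨fun u => if u i = 0 then e₀ u else u i, fun c u => ?_, fun u hu => ?_, fun u hu => ?_⟩
  · by_cases hc : c = 0
    · have := he₀ 0 0
      rw [zero_smul, zero_mul] at this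
      simp [hc, this]
    · by_cases hu : u i = 0
      · simp [hu, he₀]
      · simp [hu, hc]
  · by_cases hui : u i = 0
    · simpa [hui] using h0 u hu
    · simp [hui]
  · simp [hu]

/-- Both sides are multiplicative in `A`, so generators suffice. Scaling the `i`-th coordinate by
`a` scales the test function exactly on the lines with `u i ≠ 0` and fixes the other vectors, which
gives `a` by `card_filter`. A transvection from coordinate `j` preserves `u j` and is the identity
where `u j = 0`, which gives one. -/
theorem IsProjectiveSystem.prod_mulVec {S : Finset (ι → F)} (hS : IsProjectiveSystem F S)
    {A : Matrix ι ι F} (hA : A.det ≠ 0) : ∀ e : (ι → F) → C,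
    (∀ (c : F) u, e (c • u) = algebraMap F C c * e u) →
    ∏ u ∈ S, e (A *ᵥ u) = algebraMap F C A.det * ∏ u ∈ S, e u := by
  classical
  have hmul : ∀ A B : Matrix ι ι F, (∀ e : (ι → F) → C,
      (∀ (c : F) u, e (c • u) = algebraMap F C c * e u) →
      ∏ u ∈ S, e (A *ᵥ u) = algebraMap F C A.det * ∏ u ∈ S, e u) → (∀ e : (ι → F) → C,
      (∀ (c : F) u, e (c • u) = algebraMap F C c * e u) →
      ∏ u ∈ S, e (B *ᵥ u) = algebraMap F C B.det * ∏ u ∈ S, e u) → ∀ e : (ι → F) → C,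
      (∀ (c : F) u, e (c • u) = algebraMap F C c * e u) →
      ∏ u ∈ S, e ((A * B) *ᵥ u) = algebraMap F C (A * B).det * ∏ u ∈ S, e u := by
    intro A B hA hB e he
    simp only [← Matrix.mulVec_mulVec]
    rw [hB (fun u => e (A *ᵥ u)) fun c u => by rw [Matrix.mulVec_smul, he], hA e he,
      Matrix.det_mul, map_mul]
    ring
  refine Matrix.diagonal_transvection_induction_of_det_ne_zero
    (fun A : Matrix ι ι F => ∀ e : (ι → F) → C,
      (∀ (c : F) u, e (c • u) = algebraMap F C c * e u) →
      ∏ u ∈ S, e (A *ᵥ u) = algebraMap F C A.det * ∏ u ∈ S, e u) A hA ?_ ?_ ?_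
  · intro D hD
    rw [Matrix.det_diagonal] at hD
    have hD' : ∀ i, D i ≠ 0 := fun i => Finset.prod_ne_zero_iff.1 hD i (Finset.mem_univ i)
    have hsplit : Matrix.diagonal D =
        (Finset.univ.toList.map fun i => Matrix.diagonal (Pi.mulSingle i (D i))).prod := by
      have h1 : ∀ l : List ι, (l.map fun i => Matrix.diagonal (Pi.mulSingle i (D i))).prod =
          Matrix.diagonal ((l.map fun i => (Pi.mulSingle i (D i) : ι → F)).prod) := by
        intro l
        induction l with
        | nil => simp
        | cons i l ih => simp [ih, Matrix.diagonal_mul_diagonal, Pi.mul_def]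
      rw [h1, Finset.prod_map_toList, Finset.univ_prod_mulSingle]
    rw [hsplit]
    induction (Finset.univ : Finset ι).toList with
    | nil => intro e _; simp
    | cons i l ih =>
      rw [List.map_cons, List.prod_cons]
      refine hmul _ _ ?_ ih
      have hmv : ∀ u : ι → F, (Matrix.diagonal (Pi.mulSingle i (D i)) *ᵥ u) =
          Function.update u i (D i * u i) := by
        intro u
        ext j
        rw [Matrix.mulVec_diagonal]
        by_cases hj : j = i
        · subst hj; simp
        · simp [hj]
      have hdet : (Matrix.diagonal (Pi.mulSingle i (D i)) : Matrix ι ι F).det = D i := by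
        rw [Matrix.det_diagonal, Fintype.prod_pi_mulSingle' i (D i)]
      obtain ⟨e₁, he₁, h0, hei⟩ := hS.exists_homogeneous_coord i
      refine hS.prod_of_test (by rw [hdet]; exact hD' i) e₁ he₁ h0 ?_
      rw [hdet]
      conv_rhs => rw [← hS.card_filter i (D i)]
      rw [← Finset.prod_const, Finset.prod_filter, ← Finset.prod_mul_distrib]
      refine Finset.prod_congr rfl fun u _ => ?_
      rw [hmv]
      by_cases hui : u i = 0
      · rw [if_neg (not_not.2 hui), one_mul, hui, mul_zero, ← hui, Function.update_eq_self]
      · rw [if_pos hui, hei u hui, hei]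
        · simp
        · simpa using ⟨hD' i, hui⟩
  · intro τ
    obtain ⟨e₁, he₁, h0, hej⟩ := hS.exists_homogeneous_coord τ.j
    have hdet : τ.toMatrix.det = 1 := by simp
    refine hS.prod_of_test (by rw [hdet]; exact one_ne_zero) e₁ he₁ h0 ?_
    rw [hdet, one_mul]
    refine Finset.prod_congr rfl fun u _ => ?_
    have hmv : τ.toMatrix *ᵥ u = u + Pi.single τ.i (τ.c * u τ.j) := by
      rw [Matrix.TransvectionStruct.toMatrix, Matrix.transvection, Matrix.add_mulVec,
        Matrix.one_mulVec, Matrix.single_mulVec]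
      rfl
    rw [hmv]
    by_cases huj : u τ.j = 0
    · rw [huj, mul_zero, Pi.single_zero, add_zero]
    · have h1 : (u + Pi.single τ.i (τ.c * u τ.j) : ι → F) τ.j = u τ.j := by
        simp [τ.hij.symm]
      rw [hej u huj, hej _ (by rw [h1]; exact huj), h1]
  · intro A B _ _ hA hB
    exact hmul A B hA hB

/-- The product of the values of a homogeneous function over a system of representatives of the
lines transforms under linear automorphisms by their determinant. -/
theorem IsProjectiveSystem.prod_apply [Module.Finite F M] (hS : IsProjectiveSystem F S)
    {g : M →ₗ[F] M} (hg : LinearMap.det g ≠ 0) (e : M → C)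
    (he : ∀ (c : F) u, e (c • u) = algebraMap F C c * e u) :
    ∏ u ∈ S, e (g u) = algebraMap F C (LinearMap.det g) * ∏ u ∈ S, e u := by
  classical
  let b := Module.finBasis F M
  have hS' : IsProjectiveSystem F (S.map b.equivFun.toEquiv.toEmbedding) := by
    constructor
    · intro u hu
      obtain ⟨v, hv, rfl⟩ := Finset.mem_map.1 hu
      exact b.equivFun.map_ne_zero_iff.2 (hS.ne_zero v hv)
    · intro u hu
      obtain ⟨s, ⟨hs, c, hc, hcs⟩, huniq⟩ := hS.existsUnique (b.equivFun.symm u)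
        (b.equivFun.symm.map_ne_zero_iff.2 hu)
      refine ⟨b.equivFun s, ⟨Finset.mem_map.2 ⟨s, hs, rfl⟩, c, hc, ?_⟩, ?_⟩
      · rw [← map_smul, ← hcs, LinearEquiv.apply_symm_apply]
      · rintro _ ⟨ht, c', hc', hcs'⟩
        obtain ⟨t, ht', rfl⟩ := Finset.mem_map.1 ht
        refine congrArg b.equivFun (huniq t ⟨ht', c', hc', ?_⟩)
        rw [hcs', map_smul]
        exact congrArg _ (b.equivFun.symm_apply_apply t)
  have h1 := hS'.prod_mulVec (C := C) (A := LinearMap.toMatrix b b g)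
    (by rwa [LinearMap.det_toMatrix]) (fun u => e (b.equivFun.symm u))
    fun c u => by rw [map_smul, he]
  rw [Finset.prod_map, Finset.prod_map, LinearMap.det_toMatrix] at h1
  have h2 : ∀ u, b.equivFun.symm (LinearMap.toMatrix b b g *ᵥ b.equivFun u) = g u := by
    intro u
    rw [LinearEquiv.symm_apply_eq]
    exact LinearMap.toMatrix_mulVec_repr b b g u
  have h3 : ∀ u, b.equivFun.symm (b.equivFun.toEquiv.toEmbedding u) = u :=
    b.equivFun.symm_apply_apply
  have h4 : ∀ u, b.equivFun.symm (LinearMap.toMatrix b b g *ᵥ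
      b.equivFun.toEquiv.toEmbedding u) = g u := h2
  simpa only [h3, h4] using h1

end Projective

/-! ### Localization at the elements invertible modulo `n` -/

section SemilocalBasis

open nonZeroDivisors

variable {A : Type*} [CommRing A]

/-- The elements of a ring which are invertible modulo an ideal. -/
def invertibleMod (n : Ideal A) : Submonoid A :=
  (IsUnit.submonoid (A ⧸ n)).comap (Ideal.Quotient.mk n)

theorem mem_invertibleMod {n : Ideal A} {s : A} :
    s ∈ invertibleMod n ↔ IsUnit (Ideal.Quotient.mk n s) := Iff.rfl

theorem mem_invertibleMod_iff_exists {n : Ideal A} {s : A} :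
    s ∈ invertibleMod n ↔ ∃ a, s * a - 1 ∈ n := by
  rw [mem_invertibleMod, isUnit_iff_exists_inv]
  constructor
  · rintro ⟨b, hb⟩
    obtain ⟨a, rfl⟩ := Ideal.Quotient.mk_surjective b
    exact ⟨a, by rwa [← Ideal.Quotient.eq, map_mul, map_one]⟩
  · rintro ⟨a, ha⟩
    exact ⟨Ideal.Quotient.mk n a, by rwa [← map_mul, ← map_one (Ideal.Quotient.mk n),
      Ideal.Quotient.eq]⟩

variable [IsDomain A]

theorem invertibleMod_le {n : Ideal A} (hn1 : n ≠ ⊤) : invertibleMod n ≤ A⁰ := by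
  intro s hs
  refine mem_nonZeroDivisors_of_ne_zero ?_
  rintro rfl
  obtain ⟨a, ha⟩ := mem_invertibleMod_iff_exists.1 hs
  rw [zero_mul, zero_sub, neg_mem_iff] at ha
  exact hn1 ((Ideal.eq_top_iff_one n).2 ha)

/-- A Dedekind domain with finitely many primes is principal. A nonzero prime of the localization
contracts to a prime containing `n`: otherwise it would be comaximal with `n` and contain an element
invertible modulo `n`. The finite ring `A / n` has only finitely many ideals. -/
theorem isPrincipalIdealRing_of_isLocalization_invertibleMod [IsDedekindDomain A] {n : Ideal A}
    (hn1 : n ≠ ⊤) [Finite (A ⧸ n)] (R : Type*) [CommRing R] [IsDomain R] [Algebra A R]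
    [IsLocalization (invertibleMod n) R] : IsPrincipalIdealRing R := by
  have := IsLocalization.isDedekindDomain A (invertibleMod_le hn1) R
  refine IsPrincipalIdealRing.of_finite_primes ?_
  have hfin : (insert ⊥ (Set.range fun J : Ideal (A ⧸ n) => J.comap (Ideal.Quotient.mk n))).Finite :=
    (Set.finite_range _).insert _
  refine Set.Finite.of_injOn (f := fun I : Ideal R => I.comap (algebraMap A R)) ?_ ?_ hfin
  · intro I hI
    have hI' : I.IsPrime := hI
    have hp : (I.comap (algebraMap A R)).IsPrime := Ideal.comap_isPrime _ _
    by_cases hbot : I.comap (algebraMap A R) = ⊥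
    · exact Or.inl hbot
    right
    have hmax := hp.isMaximal hbot
    have hle : n ≤ I.comap (algebraMap A R) := by
      by_contra hle
      have hsup := hmax.eq_of_le (J := I.comap (algebraMap A R) ⊔ n)
        (I := I.comap (algebraMap A R))
      have htop : I.comap (algebraMap A R) ⊔ n = ⊤ := by
        by_contra hne
        exact hle ((hsup hne le_sup_left).symm ▸ le_sup_right)
      obtain ⟨x, hx, y, hy, hxy⟩ := Submodule.mem_sup.1 ((Ideal.eq_top_iff_one _).1 htop)
      have hxs : x ∈ invertibleMod n := mem_invertibleMod_iff_exists.2 ⟨1, by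
        rw [show x * 1 - 1 = -y by linear_combination hxy]; exact neg_mem hy⟩
      exact hI'.ne_top (Ideal.eq_top_of_isUnit_mem _ hx
        (IsLocalization.map_units R (⟨x, hxs⟩ : invertibleMod n)))
    refine ⟨(I.comap (algebraMap A R)).map (Ideal.Quotient.mk n), ?_⟩
    exact (Ideal.comap_map_of_surjective' _ Ideal.Quotient.mk_surjective _).trans
      (by rw [Ideal.mk_ker, sup_eq_left.2 hle])
  · intro I _ J _ h
    have h1 := congrArg (Ideal.map (algebraMap A R)) h
    simpa only [IsLocalization.map_under (invertibleMod n)] using h1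

variable {K : Type*} [Field K] [Algebra A K] [IsFractionRing A K] {n : Ideal A} (hn1 : n ≠ ⊤)

/-- The localization of `A` at the elements that are invertible modulo `n`, as a subring of its
field of fractions. -/
abbrev semilocalization (K : Type*) [Field K] [Algebra A K] [IsFractionRing A K] {n : Ideal A}
    (hn1 : n ≠ ⊤) : Subalgebra A K :=
  Localization.subalgebra.ofField K (invertibleMod n) (invertibleMod_le hn1)

theorem algebraMap_ne_zero_of_mem_invertibleMod (hn1 : n ≠ ⊤) {s : A} (hs : s ∈ invertibleMod n) :
    algebraMap A K s ≠ 0 := by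
  have h1 := nonZeroDivisors.ne_zero (invertibleMod_le hn1 hs)
  exact (map_ne_zero_iff _ (IsFractionRing.injective A K)).2 h1

theorem mem_semilocalization_iff {x : K} : x ∈ semilocalization K hn1 ↔
    ∃ s ∈ invertibleMod n, ∃ a : A, algebraMap A K s * x = algebraMap A K a := by
  constructor
  · rintro ⟨a, s, hs, rfl⟩
    refine ⟨s, hs, a, ?_⟩
    rw [mul_left_comm, mul_inv_cancel₀ (algebraMap_ne_zero_of_mem_invertibleMod hn1 hs), mul_one]
  · rintro ⟨s, hs, a, h⟩
    refine ⟨a, s, hs, ?_⟩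
    rw [← h, mul_comm _ x, mul_inv_cancel_right₀
      (algebraMap_ne_zero_of_mem_invertibleMod hn1 hs)]

variable {V : Type*} [AddCommGroup V] [Module A V] [Module K V] [IsScalarTower A K V]

theorem mem_span_semilocalization {N : Submodule A V} {w : V} :
    w ∈ Submodule.span (semilocalization K hn1) (N : Set V) ↔
      ∃ s ∈ invertibleMod n, s • w ∈ N := by
  constructor
  · intro hw
    induction hw using Submodule.span_induction with
    | mem x hx => exact ⟨1, one_mem _, by rwa [one_smul]⟩
    | zero => exact ⟨1, one_mem _, by rw [smul_zero]; exact zero_mem _⟩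
    | add x y _ _ hx hy =>
      obtain ⟨s, hs, hsx⟩ := hx
      obtain ⟨t, ht, hty⟩ := hy
      refine ⟨t * s, mul_mem ht hs, ?_⟩
      rw [smul_add, mul_smul, mul_comm t s, mul_smul s t y]
      exact add_mem (N.smul_mem _ hsx) (N.smul_mem _ hty)
    | smul ρ x _ hx =>
      obtain ⟨s, hs, hsx⟩ := hx
      obtain ⟨t, ht, a, hta⟩ := (mem_semilocalization_iff hn1).1 ρ.2
      refine ⟨t * s, mul_mem ht hs, ?_⟩
      have h1 : (t * s) • (ρ • x) = a • (s • x) := by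
        rw [← algebraMap_smul K (t * s), ← algebraMap_smul K a, ← hta, ← algebraMap_smul K s x]
        change _ • ((ρ : K) • x) = _
        rw [smul_smul, smul_smul, map_mul]
        congr 1; ring
      rw [h1]
      exact N.smul_mem _ hsx
  · rintro ⟨s, hs, hsw⟩
    have hs0 := algebraMap_ne_zero_of_mem_invertibleMod (K := K) hn1 hs
    have hmem : (algebraMap A K s)⁻¹ ∈ semilocalization K hn1 :=
      (mem_semilocalization_iff hn1).2 ⟨s, hs, 1, by rw [mul_inv_cancel₀ hs0, map_one]⟩
    have h1 : w = (⟨_, hmem⟩ : semilocalization K hn1) • (s • w) := by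
      change w = (algebraMap A K s)⁻¹ • (s • w)
      rw [← algebraMap_smul K s w, smul_smul, inv_mul_cancel₀ hs0, one_smul]
    rw [h1]
    exact Submodule.smul_mem _ _ (Submodule.subset_span hsw)

theorem exists_smul_mem_of_fg {P : Submodule A V} (hP : P.FG) {N : Submodule A V}
    (h : ∀ w ∈ P, ∃ s ∈ invertibleMod n, s • w ∈ N) :
    ∃ s ∈ invertibleMod n, ∀ w ∈ P, s • w ∈ N := by
  induction P, hP using Submodule.fg_induction with
  | singleton x =>
    obtain ⟨s, hs, hsx⟩ := h x (Submodule.mem_span_singleton_self x)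
    refine ⟨s, hs, fun w hw => ?_⟩
    obtain ⟨a, rfl⟩ := Submodule.mem_span_singleton.1 hw
    rw [smul_comm]
    exact N.smul_mem _ hsx
  | sup P Q _ _ hP hQ =>
    obtain ⟨s, hs, h1⟩ := hP fun w hw => h w (Submodule.mem_sup_left hw)
    obtain ⟨t, ht, h2⟩ := hQ fun w hw => h w (Submodule.mem_sup_right hw)
    refine ⟨t * s, mul_mem ht hs, fun w hw => ?_⟩
    obtain ⟨x, hx, y, hy, rfl⟩ := Submodule.mem_sup.1 hw
    rw [smul_add, mul_smul, mul_comm t s, mul_smul s t y]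
    exact add_mem (N.smul_mem _ (h1 x hx)) (N.smul_mem _ (h2 y hy))

/-- The localized lattice is finitely generated and torsion free over a principal ideal domain,
hence free, and a basis of it is a `K`-basis of `V`. -/
theorem exists_basis_semilocalization [IsDedekindDomain A] [Finite (A ⧸ n)] [Module.Finite K V]
    {Y : Submodule A V} (hY : Y.FG) (hspan : Submodule.span K (Y : Set V) = ⊤) :
    ∃ b : Module.Basis (Fin (Module.finrank K V)) K V, ∀ w : V,
      w ∈ Submodule.span (semilocalization K hn1) (Y : Set V) ↔
        ∀ j, b.repr w j ∈ semilocalization K hn1 := by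
  let R := semilocalization K hn1
  have : IsLocalization (invertibleMod n) R := Localization.subalgebra.isLocalization_ofField ..
  have : IsPrincipalIdealRing R := isPrincipalIdealRing_of_isLocalization_invertibleMod hn1 R
  let YR := Submodule.span R (Y : Set V)
  have hfg : YR.FG := by
    obtain ⟨T, hT⟩ := hY
    refine ⟨T, le_antisymm (Submodule.span_mono ?_) (Submodule.span_le.2 ?_)⟩
    · rw [← hT]; exact Submodule.subset_span
    · intro y hy
      rw [← hT] at hy
      exact Submodule.span_le_restrictScalars A R (T : Set V) hy
  have : Module.Finite R YR := Module.Finite.iff_fg.2 hfg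
  have : Module.IsTorsionFree R V := .trans_faithfulSMul R K V
  have : Module.IsTorsionFree R YR := inferInstance
  have : Module.Free R YR := Module.free_of_finite_type_torsion_free'
  let c := Module.finBasis R YR
  have hli : LinearIndependent K fun j => (c j : V) := by
    rw [← LinearIndependent.iff_fractionRing R K]
    exact c.linearIndependent.map' YR.subtype (Submodule.ker_subtype _)
  have hsp : ⊤ ≤ Submodule.span K (Set.range fun j => (c j : V)) := by
    rw [← hspan, Submodule.span_le]
    intro y hy
    have hy' : y ∈ YR := Submodule.subset_span hy
    have h1 := congrArg (YR.subtype) (c.sum_repr ⟨y, hy'⟩)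
    rw [map_sum] at h1
    have h2 : ∑ j, YR.subtype (c.repr ⟨y, hy'⟩ j • c j) = y := h1
    rw [← h2]
    refine Submodule.sum_mem _ fun j _ => ?_
    exact Submodule.smul_mem (Submodule.span K _) ((c.repr ⟨y, hy'⟩ j : R) : K)
      (Submodule.subset_span ⟨j, rfl⟩)
  let b₀ := Module.Basis.mk hli hsp
  have hrank : Module.finrank R YR = Module.finrank K V := by
    rw [Module.finrank_eq_card_basis b₀, Fintype.card_fin]
  refine ⟨b₀.reindex (finCongr hrank), fun w => ⟨fun hw j => ?_, fun hw => ?_⟩⟩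
  · have h1 := congrArg (YR.subtype) (c.sum_repr ⟨w, hw⟩)
    rw [map_sum] at h1
    have h2 : w = ∑ j, ((c.repr ⟨w, hw⟩ j : R) : K) • b₀ j := by
      refine h1.symm.trans (Finset.sum_congr rfl fun j _ => ?_)
      rw [Module.Basis.mk_apply]; rfl
    rw [Module.Basis.repr_reindex_apply, h2, b₀.repr_sum_self]
    exact SetLike.coe_mem _
  · rw [← (b₀.reindex (finCongr hrank)).sum_repr w]
    refine Submodule.sum_mem _ fun j _ => ?_
    refine Submodule.smul_mem _ (⟨_, hw j⟩ : R) ?_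
    rw [Module.Basis.reindex_apply, Module.Basis.mk_apply]
    exact SetLike.coe_mem _

/-- `π` generates the extension of `n` to the principal ideal domain; the left side of the
equivalence is membership in that extension. -/
theorem exists_generator_semilocalization [IsDedekindDomain A] [Finite (A ⧸ n)] (hn0 : n ≠ ⊥) :
    ∃ π : K, π ≠ 0 ∧ ∀ x : K, (∃ s ∈ invertibleMod n, ∃ a ∈ n,
      algebraMap A K s * x = algebraMap A K a) ↔ ∃ y ∈ semilocalization K hn1, x = π * y := by
  let R := semilocalization K hn1
  have : IsLocalization (invertibleMod n) R := Localization.subalgebra.isLocalization_ofField ..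
  have : IsPrincipalIdealRing R := isPrincipalIdealRing_of_isLocalization_invertibleMod hn1 R
  obtain ⟨π, hπ⟩ := (IsPrincipalIdealRing.principal (n.map (algebraMap A R))).principal
  have hmem : ∀ y : R, y ∈ n.map (algebraMap A R) ↔ ∃ s ∈ invertibleMod n, ∃ a ∈ n,
      algebraMap A K s * y = algebraMap A K a := by
    intro y
    rw [IsLocalization.mem_map_algebraMap_iff (invertibleMod n)]
    constructor
    · rintro ⟨⟨a, s⟩, h⟩
      have h1 := congrArg Subtype.val h
      exact ⟨s, s.2, a, a.2, by rw [mul_comm]; exact h1⟩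
    · rintro ⟨s, hs, a, ha, h⟩
      exact ⟨⟨⟨a, ha⟩, ⟨s, hs⟩⟩, Subtype.ext (by rw [mul_comm] at h; exact h)⟩
  refine ⟨(π : K), ?_, fun x => ⟨?_, ?_⟩⟩
  · intro h0
    obtain ⟨a, ha, ha0⟩ := Submodule.exists_mem_ne_zero_of_ne_bot hn0
    have h1 : algebraMap A R a ∈ n.map (algebraMap A R) := Ideal.mem_map_of_mem _ ha
    rw [hπ] at h1
    obtain ⟨c, hc⟩ := Submodule.mem_span_singleton.1 h1
    have h2 := congrArg Subtype.val hc
    have h3 : (c : K) * (π : K) = algebraMap A K a := h2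
    rw [h0, mul_zero] at h3
    exact ha0 ((map_eq_zero_iff _ (IsFractionRing.injective A K)).1 h3.symm)
  · rintro ⟨s, hs, a, ha, h⟩
    have hx : x ∈ R := (mem_semilocalization_iff hn1).2 ⟨s, hs, a, h⟩
    have h1 := (hmem ⟨x, hx⟩).2 ⟨s, hs, a, ha, h⟩
    rw [hπ] at h1
    obtain ⟨c, hc⟩ := Submodule.mem_span_singleton.1 h1
    exact ⟨c, c.2, by rw [mul_comm]; exact (congrArg Subtype.val hc).symm⟩
  · rintro ⟨y, hy, rfl⟩
    refine (hmem (π * ⟨y, hy⟩)).1 ?_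
    rw [hπ]
    exact Submodule.mem_span_singleton.2 ⟨⟨y, hy⟩, mul_comm _ _⟩

end SemilocalBasis

/-! ### The isomorphism of `n⁻¹Y / Y` with `(A / n)^r` -/

section Reduction

open nonZeroDivisors

variable {A : Type*} [CommRing A] [IsDomain A] {K : Type*} [Field K] [Algebra A K]
  [IsFractionRing A K] {n : Ideal A} (hn1 : n ≠ ⊤)

/-- Reduction modulo `n` on the localization at the elements invertible modulo `n`. -/
def semilocalReduction (K : Type*) [Field K] [Algebra A K] [IsFractionRing A K] {n : Ideal A}
    (hn1 : n ≠ ⊤) : semilocalization K hn1 →ₐ[A] A ⧸ n :=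
  IsLocalization.liftAlgHom (M := invertibleMod n) (f := Algebra.ofId A (A ⧸ n)) fun s => s.2

theorem semilocalReduction_eq_zero_iff {x : semilocalization K hn1} :
    semilocalReduction K hn1 x = 0 ↔ ∃ s ∈ invertibleMod n, ∃ a ∈ n,
      algebraMap A K s * x = algebraMap A K a := by
  have hρ : ∀ (s a : A), algebraMap A K s * (x : K) = algebraMap A K a →
      Ideal.Quotient.mk n s * semilocalReduction K hn1 x = Ideal.Quotient.mk n a := by
    intro s a h
    have h1 : algebraMap A (semilocalization K hn1) s * x =
        algebraMap A (semilocalization K hn1) a := Subtype.ext h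
    have h2 := congrArg (semilocalReduction K hn1) h1
    rw [map_mul, AlgHom.commutes, AlgHom.commutes] at h2
    exact h2
  constructor
  · intro h
    obtain ⟨s, hs, a, ha⟩ := (mem_semilocalization_iff hn1).1 x.2
    refine ⟨s, hs, a, ?_, ha⟩
    have := hρ s a ha
    rw [h, mul_zero] at this
    exact Ideal.Quotient.eq_zero_iff_mem.1 this.symm
  · rintro ⟨s, hs, a, ha, h⟩
    have := hρ s a h
    rw [Ideal.Quotient.eq_zero_iff_mem.2 ha] at this
    exact (IsUnit.mul_right_eq_zero (mem_invertibleMod.1 hs)).1 this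

variable [IsDedekindDomain A] [Finite (A ⧸ n)] {V : Type*} [AddCommGroup V] [Module A V]
  [Module K V] [IsScalarTower A K V] [Module.Finite K V] {Y : Submodule A V}

theorem map_mem_span_semilocalization {g : V →ₗ[K] V} (hg : ∀ y ∈ Y, g y ∈ Y) {w : V}
    (hw : w ∈ Submodule.span (semilocalization K hn1) (Y : Set V)) :
    g w ∈ Submodule.span (semilocalization K hn1) (Y : Set V) := by
  rw [mem_span_semilocalization] at hw ⊢
  obtain ⟨s, hs, hsw⟩ := hw
  refine ⟨s, hs, ?_⟩
  rw [← algebraMap_smul K s, ← map_smul, algebraMap_smul]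
  exact hg _ hsw

theorem toMatrix_mem_semilocalization {b : Module.Basis (Fin (Module.finrank K V)) K V}
    (hb : ∀ w : V, w ∈ Submodule.span (semilocalization K hn1) (Y : Set V) ↔
      ∀ j, b.repr w j ∈ semilocalization K hn1) {g : V →ₗ[K] V} (hg : ∀ y ∈ Y, g y ∈ Y)
    (i j : Fin (Module.finrank K V)) :
    LinearMap.toMatrix b b g i j ∈ semilocalization K hn1 := by
  rw [LinearMap.toMatrix_apply]
  refine (hb _).1 (map_mem_span_semilocalization hn1 hg ((hb _).2 fun k => ?_)) i
  rw [b.repr_self, Finsupp.single_apply]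
  split_ifs
  · exact one_mem _
  · exact zero_mem _

theorem det_mem_semilocalization (hY : Y.FG) (hspan : Submodule.span K (Y : Set V) = ⊤)
    {g : V →ₗ[K] V} (hg : ∀ y ∈ Y, g y ∈ Y) :
    LinearMap.det g ∈ semilocalization K hn1 := by
  obtain ⟨b, hb⟩ := exists_basis_semilocalization hn1 hY hspan
  rw [← LinearMap.det_toMatrix b, Matrix.det_apply]
  refine Subalgebra.sum_mem _ fun σ _ => ?_
  refine zsmul_mem (Subalgebra.prod_mem _ fun i _ => ?_) _
  exact toMatrix_mem_semilocalization hn1 hb hg _ _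

/-- Multiplication by the local generator `π` of `n` carries `n⁻¹Y` into the localized lattice,
which is free; `ψ` reduces the coordinates of `π v` modulo `n`. An endomorphism preserving `Y` has a
matrix over the localization, and `G` is the reduction of this matrix. -/
theorem exists_reduction (hn1 : n ≠ ⊤) (hn0 : n ≠ ⊥) (hY : Y.FG)
    (hspan : Submodule.span K (Y : Set V) = ⊤) {N : Submodule A V}
    (hN : ∀ x, x ∈ N ↔ ∀ a ∈ n, a • x ∈ Y) :
    ∃ ψ : N →ₗ[A] (Fin (Module.finrank K V) → A ⧸ n), Function.Surjective ψ ∧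
      (∀ v, ψ v = 0 ↔ (v : V) ∈ Y) ∧ ∀ g : V →ₗ[K] V, (∀ y ∈ Y, g y ∈ Y) →
        ∃ G : Matrix (Fin (Module.finrank K V)) (Fin (Module.finrank K V)) (A ⧸ n),
          (∀ v w : N, g v = w → ψ w = G *ᵥ ψ v) ∧
          ∀ δ : A, algebraMap A K δ = LinearMap.det g → G.det = Ideal.Quotient.mk n δ := by
  obtain ⟨b, hb⟩ := exists_basis_semilocalization hn1 hY hspan
  obtain ⟨π, hπ0, hπ⟩ := exists_generator_semilocalization (K := K) hn1 hn0
  let R := semilocalization K hn1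
  let ρ := semilocalReduction K hn1
  have hmem : ∀ (v : N) j, π * b.repr (v : V) j ∈ R := by
    intro v j
    obtain ⟨s, hs, a, ha, h⟩ := (hπ π).2 ⟨1, one_mem _, (mul_one π).symm⟩
    have h1 : π • (v : V) ∈ Submodule.span R (Y : Set V) := by
      rw [mem_span_semilocalization]
      refine ⟨s, hs, ?_⟩
      rw [← algebraMap_smul K s, smul_smul, h, algebraMap_smul]
      exact (hN _).1 v.2 a ha
    have h2 := (hb _).1 h1 j
    rwa [map_smul] at h2
  let ψ : N →ₗ[A] (Fin (Module.finrank K V) → A ⧸ n) :=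
    { toFun := fun v j => ρ ⟨_, hmem v j⟩
      map_add' := by
        intro v w
        ext j
        rw [Pi.add_apply, ← map_add]
        congr 1
        refine Subtype.ext ?_
        change π * b.repr ((v : V) + w) j = π * b.repr (v : V) j + π * b.repr (w : V) j
        rw [map_add, Finsupp.add_apply, mul_add]
      map_smul' := by
        intro a v
        ext j
        rw [RingHom.id_apply, Pi.smul_apply, ← map_smul]
        congr 1
        refine Subtype.ext ?_
        change π * b.repr (a • (v : V)) j = a • (π * b.repr (v : V) j)
        rw [← algebraMap_smul K a (v : V), map_smul, Finsupp.smul_apply, smul_eq_mul,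
          ← algebraMap_smul K a (π * _), smul_eq_mul]
        ring }
  have hψ : ∀ v j, ψ v j = ρ ⟨_, hmem v j⟩ := fun _ _ => rfl
  refine ⟨ψ, ?_, ?_, ?_⟩
  · intro c
    choose a ha using fun j => Ideal.Quotient.mk_surjective (c j)
    -- This preimage lies only in the localization of `N`. A multiple by some `s` invertible modulo
    -- `n` lies in `N`, and multiplication by an inverse `t` of `s` modulo `n` corrects the image.
    let w : V := ∑ j, (π⁻¹ * algebraMap A K (a j)) • b j
    have hw : ∀ j, π * b.repr w j = algebraMap A K (a j) := by
      intro j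
      rw [b.repr_sum_self, mul_inv_cancel_left₀ hπ0]
    have h1 : ∃ s ∈ invertibleMod n, s • w ∈ N := by
      have hfg : Submodule.FG (Submodule.map (LinearMap.toSpanSingleton A V w) n : Submodule A V) :=
        Submodule.FG.map _ (IsNoetherian.noetherian n)
      obtain ⟨s, hs, h⟩ := exists_smul_mem_of_fg (n := n) (N := Y)
        hfg (by
          rintro _ ⟨x, hx, rfl⟩
          rw [← mem_span_semilocalization (K := K) hn1]
          obtain ⟨y, hy, hxy⟩ := (hπ (algebraMap A K x)).1 ⟨1, one_mem _, x, hx, by simp⟩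
          rw [LinearMap.toSpanSingleton_apply, hb]
          intro j
          rw [← algebraMap_smul K x, map_smul, Finsupp.smul_apply, smul_eq_mul, hxy, mul_comm π,
            mul_assoc, hw]
          exact mul_mem hy (Subalgebra.algebraMap_mem _ _))
      refine ⟨s, hs, (hN _).2 fun x hx => ?_⟩
      rw [smul_comm]
      exact h _ ⟨x, hx, rfl⟩
    obtain ⟨s, hs, hsw⟩ := h1
    obtain ⟨t, ht⟩ := mem_invertibleMod_iff_exists.1 hs
    refine ⟨t • ⟨s • w, hsw⟩, funext fun j => ?_⟩
    have h2 : (⟨_, hmem (t • ⟨s • w, hsw⟩) j⟩ : R) = algebraMap A R (s * t * a j) := by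
      refine Subtype.ext ?_
      change π * b.repr (t • (s • w)) j = algebraMap A K (s * t * a j)
      rw [smul_smul, ← algebraMap_smul K (t * s), map_smul, Finsupp.smul_apply, smul_eq_mul,
        mul_left_comm, hw, ← map_mul, mul_comm t s]
    have hst : Ideal.Quotient.mk n (s * t) = 1 := by
      rw [← map_one (Ideal.Quotient.mk n)]; exact Ideal.Quotient.eq.2 ht
    rw [hψ, h2, AlgHom.commutes, Ideal.Quotient.algebraMap_eq, map_mul, hst, one_mul, ha]
  · intro v
    have h1 : ψ v = 0 ↔ (v : V) ∈ Submodule.span R (Y : Set V) := by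
      rw [hb, funext_iff]
      refine forall_congr' fun j => ?_
      rw [hψ, Pi.zero_apply, semilocalReduction_eq_zero_iff, hπ]
      constructor
      · rintro ⟨y, hy, h⟩
        rwa [mul_left_cancel₀ hπ0 h]
      · intro h
        exact ⟨_, h, rfl⟩
    rw [h1, mem_span_semilocalization]
    constructor
    · rintro ⟨s, hs, hsv⟩
      obtain ⟨t, ht⟩ := mem_invertibleMod_iff_exists.1 hs
      -- Both `t s v` and `(s t - 1) v` lie in `Y`, the latter because `s t - 1 ∈ n` and `v ∈ n⁻¹Y`;
      -- their difference is `v`.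
      have h2 := sub_mem (Y.smul_mem t hsv) ((hN _).1 v.2 _ ht)
      rw [smul_smul, ← sub_smul] at h2
      rwa [show t * s - (s * t - 1) = 1 by ring, one_smul] at h2
    · intro h
      exact ⟨1, one_mem _, by rwa [one_smul]⟩
  · intro g hg
    let M : Matrix (Fin (Module.finrank K V)) (Fin (Module.finrank K V)) R :=
      fun i j => ⟨_, toMatrix_mem_semilocalization hn1 hb hg i j⟩
    have hM : M.map R.val = LinearMap.toMatrix b b g := rfl
    refine ⟨M.map ρ, ?_, ?_⟩
    · intro v w hvw
      ext i
      rw [hψ, Matrix.mulVec, dotProduct]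
      simp only [hψ, Matrix.map_apply]
      rw [Finset.sum_congr rfl fun j _ => (map_mul ρ _ _).symm, ← map_sum]
      congr 1
      refine Subtype.ext ?_
      rw [AddSubmonoidClass.coe_finsetSum]
      change π * b.repr (w : V) i = ∑ j, LinearMap.toMatrix b b g i j * (π * b.repr (v : V) j)
      rw [← hvw, ← LinearMap.toMatrix_mulVec_repr b b g, Matrix.mulVec, dotProduct,
        Finset.mul_sum]
      exact Finset.sum_congr rfl fun j _ => mul_left_comm _ _ _
    · intro δ hδ
      have h1 : M.det = algebraMap A R δ := by
        refine Subtype.ext ?_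
        change R.val M.det = algebraMap A K δ
        rw [hδ, ← LinearMap.det_toMatrix b, ← hM]
        exact AlgHom.map_det R.val M
      have h2 : (M.map ρ).det = ρ M.det := (AlgHom.map_det ρ M).symm
      rw [h2, h1, AlgHom.commutes, Ideal.Quotient.algebraMap_eq]

end Reduction

/-! ### Existence and size of systems of representatives of lines -/

section ProjectiveSystem

variable {F : Type*} [Field F] [Finite F] {M : Type*} [AddCommGroup M] [Module F M]

theorem IsProjectiveSystem.card_mul_add_one [Finite M] {S : Finset M}
    (hS : IsProjectiveSystem F S) : S.card * (Nat.card F - 1) + 1 = Nat.card M := by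
  classical
  have := Fintype.ofFinite M
  let f : S × Fˣ → {u : M // u ≠ 0} := fun p =>
    ⟨(p.2 : F) • (p.1 : M), smul_ne_zero p.2.ne_zero (hS.ne_zero _ p.1.2)⟩
  have hf : Function.Bijective f := by
    constructor
    · rintro ⟨s, c⟩ ⟨s', c'⟩ h
      have h1 : (c : F) • (s : M) = (c' : F) • (s' : M) := congrArg Subtype.val h
      have h2 : (s : M) = s' := (hS.existsUnique _ (f (s, c)).2).unique
        ⟨s.2, c, c.ne_zero, rfl⟩ ⟨s'.2, c', c'.ne_zero, h1⟩
      rw [← h2] at h1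
      exact Prod.ext (Subtype.ext h2)
        (Units.ext (smul_left_injective F (hS.ne_zero _ s.2) h1))
    · rintro ⟨u, hu⟩
      obtain ⟨s, ⟨hs, c, hc, hcs⟩, -⟩ := hS.existsUnique u hu
      exact ⟨(⟨s, hs⟩, Units.mk0 c hc), Subtype.ext hcs.symm⟩
  have h1 := Nat.card_congr (Equiv.ofBijective f hf)
  rw [Nat.card_prod, Nat.card_units, Nat.card_eq_fintype_card, Fintype.card_coe] at h1
  rw [h1, Nat.card_eq_fintype_card, Nat.card_eq_fintype_card, Fintype.card_subtype_compl,
    Fintype.card_subtype_eq]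
  exact Nat.sub_add_cancel Fintype.card_pos

theorem exists_isProjectiveSystem (F : Type*) [Field F] (M : Type*) [AddCommGroup M] [Module F M]
    [Finite M] : ∃ S : Finset M, IsProjectiveSystem F S := by
  classical
  have : Finite (Projectivization F M) := Quotient.finite _
  have := Fintype.ofFinite (Projectivization F M)
  refine ⟨Finset.univ.image fun p : Projectivization F M => p.rep, ?_, ?_⟩
  · intro u hu
    obtain ⟨p, -, rfl⟩ := Finset.mem_image.1 hu
    exact p.rep_nonzero
  · intro u hu
    have key : ∀ p : Projectivization F M, (∃ c : F, c ≠ 0 ∧ u = c • p.rep) ↔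
        p = Projectivization.mk F u hu := by
      intro p
      rw [← p.mk_rep, Projectivization.mk_eq_mk_iff', p.mk_rep]
      constructor
      · rintro ⟨c, hc, h⟩
        exact ⟨c⁻¹, by rw [h, smul_smul, inv_mul_cancel₀ hc, one_smul]⟩
      · rintro ⟨a, ha⟩
        have ha0 : a ≠ 0 := by
          rintro rfl
          exact p.rep_nonzero (by rw [← ha, zero_smul])
        exact ⟨a⁻¹, inv_ne_zero ha0, by rw [← ha, smul_smul, inv_mul_cancel₀ ha0, one_smul]⟩
    refine ⟨(Projectivization.mk F u hu).rep,
      ⟨Finset.mem_image_of_mem _ (Finset.mem_univ _), (key _).2 rfl⟩, ?_⟩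
    rintro _ ⟨hs, hc⟩
    obtain ⟨p, -, rfl⟩ := Finset.mem_image.1 hs
    rw [(key p).1 hc]

end ProjectiveSystem

/-! ### The determinant of an element of `Γ` -/

section Determinant

/-- The determinant is integral locally: a proper ideal `D` of denominators would lie in a maximal
ideal `p`, but near `p` the lattice is free, so the determinant has a denominator outside `p`. -/
theorem det_mem_range_algebraMap {A : Type*} [CommRing A] [IsDomain A] [IsDedekindDomain A]
    {K : Type*} [Field K] [Algebra A K] [IsFractionRing A K]
    (hfin : ∀ p : Ideal A, p ≠ ⊥ → Finite (A ⧸ p)) {V : Type*} [AddCommGroup V] [Module A V]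
    [Module K V] [IsScalarTower A K V] [Module.Finite K V] {Y : Submodule A V} (hY : Y.FG)
    (hspan : Submodule.span K (Y : Set V) = ⊤) {g : V →ₗ[K] V} (hg : ∀ y ∈ Y, g y ∈ Y) :
    ∃ a : A, algebraMap A K a = LinearMap.det g := by
  let D : Ideal A := (1 : Submodule A K).comap (LinearMap.toSpanSingleton A K (LinearMap.det g))
  have hD : ∀ s : A, s ∈ D ↔ ∃ a : A, algebraMap A K a = s • LinearMap.det g := by
    intro s
    rw [Submodule.mem_comap, LinearMap.toSpanSingleton_apply, Submodule.mem_one]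
  by_cases htop : D = ⊤
  · obtain ⟨a, ha⟩ := (hD 1).1 (htop ▸ Submodule.mem_top)
    exact ⟨a, by rw [ha, one_smul]⟩
  exfalso
  obtain ⟨p, hp, hDp⟩ := Ideal.exists_le_maximal D htop
  have hp0 : p ≠ ⊥ := by
    rintro rfl
    obtain ⟨a, b, hb, h⟩ := IsFractionRing.div_surjective A (LinearMap.det g)
    have hb0 := nonZeroDivisors.ne_zero hb
    refine hb0 ((Submodule.mem_bot A).1 (hDp ((hD b).2 ⟨a, ?_⟩)))
    rw [← h, Algebra.smul_def, mul_div_cancel₀]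
    exact (map_ne_zero_iff _ (IsFractionRing.injective A K)).2 hb0
  have := hfin p hp0
  obtain ⟨s, hs, a, h⟩ := (mem_semilocalization_iff hp.ne_top).1
    (det_mem_semilocalization hp.ne_top hY hspan hg)
  have hsp : s ∈ p := hDp ((hD s).2 ⟨a, by rw [Algebra.smul_def, h]⟩)
  obtain ⟨b, hb⟩ := mem_invertibleMod_iff_exists.1 hs
  refine hp.ne_top ((Ideal.eq_top_iff_one p).2 ?_)
  have := sub_mem (p.mul_mem_right b hsp) hb
  rwa [sub_sub_cancel] at this

variable {F K : Type*} [Field F] [Finite F] [Field K] [Algebra F K] {inf : Place F K} {r : ℕ}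

theorem finite_quotient_regularRing (hK : IsFunctionField F K) {p : Ideal (regularRing inf)}
    (hp : p ≠ ⊥) : Finite (regularRing inf ⧸ p) := by
  obtain ⟨f, hfp, hf⟩ := Submodule.exists_mem_ne_zero_of_ne_bot hp
  have := hK.finite_quotient (B := regularRing inf) Subtype.val_injective hf
  exact Finite.of_surjective _ (Ideal.Quotient.factor_surjective
    ((Ideal.span_singleton_le_iff_mem p).2 hfp))

theorem det_rightMul (γ : GL (Fin r) K) :
    LinearMap.det (rightMul γ) = (γ : Matrix (Fin r) (Fin r) K).det := by
  have h : rightMul γ = Matrix.toLin' (γ : Matrix (Fin r) (Fin r) K)ᵀ := by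
    refine LinearMap.ext fun v => ?_
    rw [Matrix.toLin'_apply, Matrix.mulVec_transpose]
    rfl
  rw [h, LinearMap.det_toLin', Matrix.det_transpose]

theorem MemGamma.map_mem {Y : Submodule (regularRing inf) (Fin r → K)} {γ : GL (Fin r) K}
    (hγ : MemGamma Y γ) {y : Fin r → K} (hy : y ∈ Y) : rightMul γ y ∈ Y := by
  have h : rightMul γ y ∈ Y.map ((rightMul γ).restrictScalars (regularRing inf)) := ⟨y, hy, rfl⟩
  rwa [hγ] at h

theorem MemGamma.inv {Y : Submodule (regularRing inf) (Fin r → K)} {γ : GL (Fin r) K}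
    (hγ : MemGamma Y γ) : MemGamma Y γ⁻¹ := by
  refine le_antisymm ?_ fun y hy => ⟨_, hγ.map_mem hy, rightMul_inv_rightMul γ y⟩
  rintro _ ⟨y, hy, rfl⟩
  rw [SetLike.mem_coe, ← hγ] at hy
  obtain ⟨x, hx, rfl⟩ := hy
  change rightMul γ⁻¹ (rightMul γ x) ∈ Y
  rwa [rightMul_inv_rightMul]

theorem MemGamma.map_mem_iff {Y : Submodule (regularRing inf) (Fin r → K)} {γ : GL (Fin r) K}
    (hγ : MemGamma Y γ) {y : Fin r → K} : rightMul γ y ∈ Y ↔ y ∈ Y :=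
  ⟨fun h => by simpa only [rightMul_inv_rightMul] using hγ.inv.map_mem h, hγ.map_mem⟩

/-- The determinant of an element of `Γ` is a constant. -/
theorem MemGamma.exists_det_eq (hK : IsFunctionField F K) {t : K} (ht : t ∈ regularRing inf)
    (htr : Transcendental F t) {Y : Submodule (regularRing inf) (Fin r → K)}
    (hY : IsLattice Y ⊤) {γ : GL (Fin r) K} (hγ : MemGamma Y γ) :
    ∃ δ : F, δ ≠ 0 ∧ algebraMap F K δ = (γ : Matrix (Fin r) (Fin r) K).det := by
  have := isFractionRing_regularRing hK ht htr
  have := isDedekindDomain_regularRing hK ht htr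
  have hfin : ∀ p : Ideal (regularRing inf), p ≠ ⊥ → Finite (regularRing inf ⧸ p) :=
    fun p hp => finite_quotient_regularRing hK hp
  obtain ⟨a, ha⟩ := det_mem_range_algebraMap hfin hY.fg hY.span_eq fun y hy => hγ.map_mem hy
  obtain ⟨b, hb⟩ := det_mem_range_algebraMap hfin hY.fg hY.span_eq fun y hy => hγ.inv.map_mem hy
  rw [det_rightMul] at ha hb
  have hab : (γ : Matrix (Fin r) (Fin r) K).det *
      ((γ⁻¹ : GL (Fin r) K) : Matrix (Fin r) (Fin r) K).det = 1 := by
    rw [← Matrix.det_mul, ← Units.val_mul, mul_inv_cancel, Units.val_one, Matrix.det_one]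
  have ha' : (γ : Matrix (Fin r) (Fin r) K).det ∈ regularRing inf := ha ▸ a.2
  have hb' : ((γ⁻¹ : GL (Fin r) K) : Matrix (Fin r) (Fin r) K).det ∈ regularRing inf := hb ▸ b.2
  have hne := left_ne_zero_of_mul_eq_one hab
  -- The determinant and its inverse both lie in `A`, and one of them has absolute value at most one
  -- at infinity, so it has no pole and is constant.
  have key : ∃ δ : F, algebraMap F K δ = (γ : Matrix (Fin r) (Fin r) K).det := by
    rcases le_total (inf.abv (γ : Matrix (Fin r) (Fin r) K).det) 1 with h | h
    · exact mem_range_of_abv_le_one hK ha' h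
    · have h1 := congrArg inf.abv hab
      rw [map_mul, map_one] at h1
      have h2 : inf.abv ((γ⁻¹ : GL (Fin r) K) : Matrix (Fin r) (Fin r) K).det ≤ 1 := by
        have h3 := AbsoluteValue.nonneg inf.abv ((γ⁻¹ : GL (Fin r) K) : Matrix (Fin r) (Fin r) K).det
        nlinarith
      obtain ⟨c, hc⟩ := mem_range_of_abv_le_one hK hb' h2
      refine ⟨c⁻¹, ?_⟩
      rw [map_inv₀, hc]
      exact (eq_inv_of_mul_eq_one_left hab).symm
  obtain ⟨δ, hδ⟩ := key
  refine ⟨δ, ?_, hδ⟩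
  rintro rfl
  rw [map_zero] at hδ
  exact hne hδ.symm

end Determinant

/-! ### Systems of representatives, and the weight and type of the root -/

section RepSystem

variable {F K : Type*} [Field F] [Finite F] [Field K] [Algebra F K] {inf : Place F K} {r : ℕ}
  {Y : Submodule (regularRing inf) (Fin r → K)} {n : Ideal (regularRing inf)}

theorem le_idealInv : Y ≤ idealInv n Y := fun _ hy a _ => Y.smul_mem a hy

/-- Right multiplication by `γ` matches the two index sets, because it preserves `Y`. -/
theorem partialEisenstein_act {γ : GL (Fin r) K} (hγ : MemGamma Y γ) (k : ℕ) (u : Fin r → K)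
    (ω : PsiBar inf r) :
    partialEisenstein Y k u (ω.act γ) = partialEisenstein Y k (rightMul γ u) ω := by
  let f : (ω.act γ).U → ω.U := fun v => ⟨rightMul γ v, v.2⟩
  have hf : Function.Injective f := fun v w h => Subtype.ext
    ((rightMulEquiv γ).injective (congrArg Subtype.val h))
  have hf0 : ∀ v, f v = 0 ↔ v = 0 := fun v =>
    ⟨fun h => hf (h.trans (Subtype.ext (map_zero (rightMul γ))).symm),
      fun h => Subtype.ext (by rw [h]; exact map_zero (rightMul γ))⟩
  have hfm : ∀ v : (ω.act γ).U, (f v : Fin r → K) - rightMul γ u ∈ Y ↔ (v : Fin r → K) - u ∈ Y := by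
    intro v
    have h : (f v : Fin r → K) - rightMul γ u = rightMul γ (v - u) := (map_sub _ _ _).symm
    rw [h]
    exact hγ.map_mem_iff
  let e : {v : (ω.act γ).U // (v : Fin r → K) - u ∈ Y ∧ v ≠ 0} ≃
      {v : ω.U // (v : Fin r → K) - rightMul γ u ∈ Y ∧ v ≠ 0} :=
    Equiv.ofBijective (fun v => ⟨f v, (hfm _).2 v.2.1, fun h => v.2.2 ((hf0 _).1 h)⟩) <| by
      constructor
      · intro v w h
        exact Subtype.ext (hf (congrArg Subtype.val h))
      · rintro ⟨w, hw, hw0⟩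
        have hwU : rightMul γ⁻¹ (w : Fin r → K) ∈ (ω.act γ).U := by
          change rightMul γ (rightMul γ⁻¹ w) ∈ ω.U
          rw [rightMul_rightMul_inv]
          exact w.2
        have hfw : f ⟨_, hwU⟩ = w := Subtype.ext (rightMul_rightMul_inv γ _)
        refine ⟨⟨⟨_, hwU⟩, (hfm _).1 (by rw [hfw]; exact hw), fun h => hw0 ?_⟩, Subtype.ext hfw⟩
        rw [← hfw, h]
        exact (hf0 0).2 rfl
  rw [partialEisenstein, partialEisenstein, ← e.tsum_eq]
  rfl

/-- Under restriction of scalars the determinant becomes its norm, and the norm of a constant is its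
power by the dimension of `B`. For `B = A / n` this exponent is the type `d`. -/
theorem exists_linearMap_det_eq_pow {B ι : Type*} [CommRing B] [Algebra F B] [Fintype ι]
    [DecidableEq ι] {G : Matrix ι ι B} (δ : F) (hG : G.det = algebraMap F B δ) :
    ∃ g : (ι → B) →ₗ[F] (ι → B), (∀ w, g w = G *ᵥ w) ∧
      LinearMap.det g = δ ^ Module.finrank F B := by
  refine ⟨(Matrix.toLin' G).restrictScalars F, fun w => rfl, ?_⟩
  rw [LinearMap.det_restrictScalars, LinearMap.det_toLin', hG, Algebra.norm_algebraMap]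

section Image

variable {W : Type*} [AddCommGroup W] [Module (regularRing inf) W] [Module F W]
  [IsScalarTower F (regularRing inf) W] {ψ : idealInv n Y →ₗ[regularRing inf] W}

theorem map_const_smul (ψ : idealInv n Y →ₗ[regularRing inf] W) (c : F) (v : idealInv n Y) :
    ψ (c • v) = c • ψ v := by
  have h1 : c • v = algebraMap F (regularRing inf) c • v := (algebraMap_smul _ c v).symm
  rw [h1, map_smul, algebraMap_smul]

open Classical in
theorem IsRepSystem.isProjectiveSystem {S : Finset (Fin r → K)} (hS : IsRepSystem Y n S)
    (hψ : Function.Surjective ψ) (hker : ∀ v, ψ v = 0 ↔ (v : Fin r → K) ∈ Y) :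
    IsProjectiveSystem F (S.attach.image fun s : S => ψ ⟨s, (hS.mem _ s.2).1⟩) ∧
      Function.Injective fun s : S => ψ ⟨s, (hS.mem _ s.2).1⟩ := by
  have hmk : ∀ {u : Fin r → K} (hu : u ∈ idealInv n Y) (s : S) (c : F),
      u - c • (s : Fin r → K) ∈ Y ↔ ψ ⟨u, hu⟩ = c • ψ ⟨s, (hS.mem _ s.2).1⟩ := by
    intro u hu s c
    rw [← sub_eq_zero (a := ψ ⟨u, hu⟩), ← map_const_smul, ← map_sub, hker]
    rfl
  refine ⟨⟨?_, ?_⟩, ?_⟩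
  · intro w hw
    obtain ⟨s, -, rfl⟩ := Finset.mem_image.1 hw
    exact fun h => (hS.mem _ s.2).2 ((hker _).1 h)
  · intro w hw
    obtain ⟨⟨u, hu⟩, rfl⟩ := hψ w
    have huY : u ∉ Y := fun h => hw ((hker _).2 h)
    obtain ⟨s, ⟨hs, c, hc, hcs⟩, huniq⟩ := hS.existsUnique u hu huY
    refine ⟨_, ⟨Finset.mem_image.2 ⟨⟨s, hs⟩, Finset.mem_attach _ _, rfl⟩, c, hc,
      (hmk hu ⟨s, hs⟩ c).1 hcs⟩, ?_⟩
    rintro _ ⟨hw', c', hc', h'⟩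
    obtain ⟨s', -, rfl⟩ := Finset.mem_image.1 hw'
    have := huniq s' ⟨s'.2, c', hc', (hmk hu s' c').2 h'⟩
    congr 2
  · intro s s' h
    have hs := hS.mem _ s.2
    refine Subtype.ext ((hS.existsUnique s hs.1 hs.2).unique ⟨s.2, 1, one_ne_zero, ?_⟩
      ⟨s'.2, 1, one_ne_zero, ?_⟩)
    · rw [one_smul, sub_self]; exact zero_mem Y
    · rw [hmk hs.1 s' 1, one_smul]; exact h

theorem exists_isRepSystem_of_isProjectiveSystem {T : Finset W} (hT : IsProjectiveSystem F T)
    (hψ : Function.Surjective ψ) (hker : ∀ v, ψ v = 0 ↔ (v : Fin r → K) ∈ Y) :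
    ∃ S : Finset (Fin r → K), IsRepSystem Y n S := by
  classical
  choose l hl using hψ
  have hmk : ∀ {u : Fin r → K} (hu : u ∈ idealInv n Y) (w : W) (c : F),
      u - c • (l w : Fin r → K) ∈ Y ↔ ψ ⟨u, hu⟩ = c • w := by
    intro u hu w c
    rw [← sub_eq_zero (a := ψ ⟨u, hu⟩)]
    conv_rhs => rw [← hl w, ← map_const_smul, ← map_sub, hker]
    rfl
  refine ⟨T.image fun w => (l w : Fin r → K), ?_, ?_⟩
  · intro u hu
    obtain ⟨w, hw, rfl⟩ := Finset.mem_image.1 hu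
    refine ⟨(l w).2, fun h => hT.ne_zero w hw ?_⟩
    rw [← hl w]
    exact (hker _).2 h
  · intro u hu huY
    obtain ⟨w, ⟨hw, c, hc, hcw⟩, huniq⟩ := hT.existsUnique (ψ ⟨u, hu⟩) fun h => huY ((hker _).1 h)
    refine ⟨l w, ⟨Finset.mem_image_of_mem _ hw, c, hc, (hmk hu w c).2 hcw⟩, ?_⟩
    rintro _ ⟨hs, c', hc', h⟩
    obtain ⟨w', hw', rfl⟩ := Finset.mem_image.1 hs
    rw [huniq w' ⟨hw', c', hc', (hmk hu w' c').1 h⟩]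

theorem IsRepSystem.card_mul_add_one_of_reduction [Finite W] {S : Finset (Fin r → K)}
    (hS : IsRepSystem Y n S) (hψ : Function.Surjective ψ)
    (hker : ∀ v, ψ v = 0 ↔ (v : Fin r → K) ∈ Y) :
    S.card * (Nat.card F - 1) + 1 = Nat.card W := by
  classical
  obtain ⟨hT, hinj⟩ := hS.isProjectiveSystem hψ hker
  have h1 := hT.card_mul_add_one
  rwa [Finset.card_image_of_injective _ hinj, Finset.card_attach] at h1

/-- `E_{1,u}` depends only on the class of `u` and is homogeneous of degree minus one, so
`IsProjectiveSystem.prod_apply` applies to its inverse; this accounts for the inverse of the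
determinant. -/
theorem rootForm_act_of_reduction [Module.Finite F W] (hψ : Function.Surjective ψ)
    (hker : ∀ v, ψ v = 0 ↔ (v : Fin r → K) ∈ Y) {S : Finset (Fin r → K)}
    (hS : IsRepSystem Y n S) {γ : GL (Fin r) K} (hγ : MemGamma Y γ) (ω : PsiBar inf r)
    {g : W →ₗ[F] W} (hgψ : ∀ v w : idealInv n Y, rightMul γ v = w → ψ w = g (ψ v))
    (hg : LinearMap.det g ≠ 0) :
    rootForm Y S (ω.act γ) =
      (algebraMap F (Cinf inf) (LinearMap.det g))⁻¹ * rootForm Y S ω := by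
  classical
  obtain ⟨hT, hinj⟩ := hS.isProjectiveSystem hψ hker
  choose l hl using hψ
  -- At boundary points some `E_{1,u}` vanish; with the inverse of zero equal to zero, `e` is still
  -- homogeneous and no case distinction is needed.
  let e : W → Cinf inf := fun w =>
    if w = 0 then 0 else (partialEisenstein Y 1 (l w : Fin r → K) ω)⁻¹
  have he : ∀ v : idealInv n Y, (v : Fin r → K) ∉ Y →
      e (ψ v) = (partialEisenstein Y 1 (v : Fin r → K) ω)⁻¹ := by
    intro v hv
    have h0 : ψ v ≠ 0 := fun h => hv ((hker v).1 h)
    simp only [e, if_neg h0]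
    rw [partialEisenstein_congr ω Y 1 (u' := (v : Fin r → K))]
    have h1 : ψ (l (ψ v) - v) = 0 := by rw [map_sub, hl, sub_self]
    exact (hker _).1 h1
  have heh : ∀ (c : F) (w : W), e (c • w) = algebraMap F (Cinf inf) c * e w := by
    intro c w
    by_cases hc : c = 0
    · simp [hc, e]
    by_cases hw : w = 0
    · simp [hw, e]
    have h1 : (l w : Fin r → K) ∉ Y := fun h => hw (by rw [← hl w]; exact (hker _).2 h)
    have h2 : ((c • l w : idealInv n Y) : Fin r → K) ∉ Y := fun h => smul_ne_zero hc hw (by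
      rw [← hl w, ← map_const_smul]; exact (hker _).2 h)
    have h3 := he (c • l w) h2
    have h4 := he (l w) h1
    rw [map_const_smul, hl] at h3
    rw [hl] at h4
    rw [h3, h4]
    change (partialEisenstein Y 1 (c • (l w : Fin r → K)) ω)⁻¹ = _
    rw [partialEisenstein_smul ω Y _ hc, mul_inv, inv_inv]
  have key := hT.prod_apply (g := g) hg e heh
  rw [Finset.prod_image hinj.injOn, Finset.prod_image hinj.injOn] at key
  have hmem : ∀ {u : Fin r → K}, u ∈ idealInv n Y → rightMul γ u ∈ idealInv n Y := by
    intro u hu a ha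
    have h1 := hγ.map_mem (hu a ha)
    have h2 : rightMul γ (a • u) = a • rightMul γ u := map_smul (rightMul γ) (a : K) u
    rwa [h2] at h1
  have h1 : ∀ s : S, e (g (ψ ⟨s, (hS.mem _ s.2).1⟩)) =
      (partialEisenstein Y 1 (s : Fin r → K) (ω.act γ))⁻¹ := by
    intro s
    have hs := hS.mem _ s.2
    rw [partialEisenstein_act hγ,
      ← he ⟨_, hmem hs.1⟩ fun h => hs.2 (hγ.map_mem_iff.1 h)]
    congr 1
    exact (hgψ ⟨s, hs.1⟩ ⟨_, hmem hs.1⟩ rfl).symm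
  have h2 : ∀ s : S, e (ψ ⟨s, (hS.mem _ s.2).1⟩) =
      (partialEisenstein Y 1 (s : Fin r → K) ω)⁻¹ := fun s => he _ (hS.mem _ s.2).2
  rw [Finset.prod_congr rfl fun s _ => h1 s, Finset.prod_congr rfl fun s _ => h2 s,
    Finset.prod_inv_distrib, Finset.prod_inv_distrib,
    Finset.prod_attach S fun s => partialEisenstein Y 1 s (ω.act γ),
    Finset.prod_attach S fun s => partialEisenstein Y 1 s ω] at key
  have h3 := congrArg (·⁻¹) key
  simp only [mul_inv, inv_inv] at h3
  rw [rootForm, rootForm, h3]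

end Image

theorem partialEisenstein_scale (c : (Cinf inf)ˣ) (u : Fin r → K) (ω : PsiBar inf r) :
    partialEisenstein Y 1 u (ω.scale c) = (c : Cinf inf)⁻¹ * partialEisenstein Y 1 u ω := by
  rw [partialEisenstein, partialEisenstein, ← tsum_mul_left]
  refine tsum_congr fun v => ?_
  rw [pow_one, pow_one, ← mul_inv]
  rfl

variable (hK : IsFunctionField F K) {t : K} (ht : t ∈ regularRing inf) (htr : Transcendental F t)
  (hY : IsLattice Y ⊤) (hn0 : n ≠ ⊥) (hn1 : n ≠ ⊤)
include hK ht htr hY hn0 hn1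

theorem exists_reduction_idealInv :
    ∃ ψ : idealInv n Y →ₗ[regularRing inf]
        (Fin (Module.finrank K (Fin r → K)) → regularRing inf ⧸ n),
      Function.Surjective ψ ∧ (∀ v, ψ v = 0 ↔ (v : Fin r → K) ∈ Y) ∧
      ∀ g : (Fin r → K) →ₗ[K] (Fin r → K), (∀ y ∈ Y, g y ∈ Y) →
        ∃ G : Matrix (Fin (Module.finrank K (Fin r → K))) (Fin (Module.finrank K (Fin r → K)))
            (regularRing inf ⧸ n),
          (∀ v w : idealInv n Y, g v = w → ψ w = G *ᵥ ψ v) ∧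
          ∀ δ : regularRing inf, algebraMap (regularRing inf) K δ = LinearMap.det g →
            G.det = Ideal.Quotient.mk n δ := by
  have := isFractionRing_regularRing hK ht htr
  have := isDedekindDomain_regularRing hK ht htr
  have := finite_quotient_regularRing hK hn0
  exact exists_reduction hn1 hn0 hY.fg hY.span_eq fun _ => Iff.rfl

theorem exists_isRepSystem : ∃ S : Finset (Fin r → K), IsRepSystem Y n S := by
  have := finite_quotient_regularRing hK hn0
  obtain ⟨ψ, hψ, hker, -⟩ := exists_reduction_idealInv hK ht htr hY hn0 hn1
  obtain ⟨T, hT⟩ := exists_isProjectiveSystem F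
    (Fin (Module.finrank K (Fin r → K)) → regularRing inf ⧸ n)
  exact exists_isRepSystem_of_isProjectiveSystem hT hψ hker

theorem IsRepSystem.card_mul_add_one {S : Finset (Fin r → K)} (hS : IsRepSystem Y n S) :
    S.card * (Nat.card F - 1) + 1 = Nat.card F ^ (r * degree n) := by
  have := finite_quotient_regularRing hK hn0
  obtain ⟨ψ, hψ, hker, -⟩ := exists_reduction_idealInv hK ht htr hY hn0 hn1
  have h1 := hS.card_mul_add_one_of_reduction hψ hker
  have : Module.Finite F (regularRing inf ⧸ n) := Module.Finite.of_finite
  rw [h1, Nat.card_fun, Module.natCard_eq_pow_finrank (K := F), ← pow_mul, mul_comm, Nat.card_fin,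
    Module.finrank_fin_fun, degree]

theorem rootForm_act {S : Finset (Fin r → K)} (hS : IsRepSystem Y n S) {γ : GL (Fin r) K}
    (hγ : MemGamma Y γ) (ω : PsiBar inf r) :
    rootForm Y S (ω.act γ) = algebraMap K (Cinf inf) (γ : Matrix (Fin r) (Fin r) K).det ^
      (-(degree n : ℤ)) * rootForm Y S ω := by
  have := finite_quotient_regularRing hK hn0
  have : Module.Finite F (regularRing inf ⧸ n) := Module.Finite.of_finite
  obtain ⟨ψ, hψ, hker, hG⟩ := exists_reduction_idealInv hK ht htr hY hn0 hn1
  obtain ⟨δ, hδ0, hδ⟩ := hγ.exists_det_eq hK ht htr hY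
  obtain ⟨G, hGψ, hGdet⟩ := hG (rightMul γ) fun y hy => hγ.map_mem hy
  have hdet := hGdet (algebraMap F (regularRing inf) δ) (by rw [det_rightMul, ← hδ]; rfl)
  obtain ⟨g, hg, hgdet⟩ := exists_linearMap_det_eq_pow δ hdet
  rw [rootForm_act_of_reduction (ψ := ψ) hψ hker hS hγ ω (g := g)
    (fun v w hvw => by rw [hg]; exact hGψ v w hvw) (by rw [hgdet]; exact pow_ne_zero _ hδ0),
    hgdet, ← hδ, zpow_neg, zpow_natCast, map_pow, ← IsScalarTower.algebraMap_apply, degree]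

theorem rootForm_scale {S : Finset (Fin r → K)} (hS : IsRepSystem Y n S) (c : (Cinf inf)ˣ)
    (ω : PsiBar inf r) : rootForm Y S (ω.scale c) = (c : Cinf inf) ^
      (-(((Nat.card F ^ (r * degree n) - 1) / (Nat.card F - 1) : ℕ) : ℤ)) * rootForm Y S ω := by
  have hq : 1 < Nat.card F := Finite.one_lt_card
  have h1 : (Nat.card F ^ (r * degree n) - 1) / (Nat.card F - 1) = S.card := by
    rw [← hS.card_mul_add_one hK ht htr hY hn0 hn1, Nat.add_sub_cancel,
      Nat.mul_div_cancel _ (by omega)]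
  rw [h1, rootForm, rootForm, Finset.prod_congr rfl fun u _ => partialEisenstein_scale c u ω,
    Finset.prod_mul_distrib, Finset.prod_const, zpow_neg, zpow_natCast, inv_pow]

end RepSystem

/-! ### Zeros of the root: exactly the boundary -/

section Boundary

variable {F K : Type*} [Field F] [Finite F] [Field K] [Algebra F K] {inf : Place F K} {r : ℕ}
  {Y : Submodule (regularRing inf) (Fin r → K)} {n : Ideal (regularRing inf)}
  (hK : IsFunctionField F K) {t : K} (ht : t ∈ regularRing inf) (htr : Transcendental F t)
  (hY : IsLattice Y ⊤)
include hK ht htr hY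

/-- Otherwise `n⁻¹Y ⊆ U + Y`. A nonzero functional `l` vanishing on `U` then makes every `x` in the
fractional ideal `n⁻¹` stabilize the nonzero finitely generated module `l(Y)`, so `x` is integral
over `A` and lies in `A`, although `n⁻¹` is not contained in `A` for a proper ideal. -/
theorem exists_mem_idealInv_notMem_sup (hn0 : n ≠ ⊥) (hn1 : n ≠ ⊤)
    {U : Submodule K (Fin r → K)} (hU : U ≠ ⊤) :
    ∃ u ∈ idealInv n Y, ∀ v ∈ U, v - u ∉ Y := by
  by_contra hcon
  push Not at hcon
  have := isFractionRing_regularRing hK ht htr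
  have := isDedekindDomain_regularRing hK ht htr
  obtain ⟨l, hl0, hl⟩ := U.exists_le_ker_of_lt_top hU.lt_top
  obtain ⟨x, hxn, hx1⟩ := FractionalIdeal.exists_notMem_one_of_ne_bot (K := K) hn0 hn1
  rw [FractionalIdeal.mem_inv_iff (FractionalIdeal.coeIdeal_ne_zero.2 hn0)] at hxn
  let J := Y.map (l.restrictScalars (regularRing inf))
  have hJ0 : J ≠ ⊥ := by
    intro hJ
    refine hl0 (LinearMap.ker_eq_top.1 (top_le_iff.1 ?_))
    rw [← hY.span_eq, Submodule.span_le]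
    intro y hy
    have h1 : l y ∈ J := ⟨y, hy, rfl⟩
    rw [hJ] at h1
    exact h1
  have hint : IsIntegral (regularRing inf) x := by
    refine isIntegral_of_smul_mem_submodule J hJ0 (hY.fg.map _) x ?_
    rintro _ ⟨y, hy, rfl⟩
    obtain ⟨v, hv, hvy⟩ := hcon (x • y) fun a ha => by
      obtain ⟨b, hb⟩ := (FractionalIdeal.mem_one_iff _).1
        (hxn (algebraMap _ K a) ((FractionalIdeal.mem_coeIdeal _).2 ⟨a, ha, rfl⟩))
      have h1 : a • x • y = b • y := by
        rw [← algebraMap_smul K a, smul_smul, mul_comm, ← hb, algebraMap_smul]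
      rw [h1]
      exact Y.smul_mem b hy
    refine ⟨-(v - x • y), neg_mem hvy, ?_⟩
    have h2 : l v = 0 := hl hv
    change l (-(v - x • y)) = x • l y
    rw [neg_sub, map_sub, h2, sub_zero, map_smul]
  refine hx1 ((FractionalIdeal.mem_one_iff _).2 ?_)
  exact IsIntegrallyClosed.isIntegral_iff.1 hint

/-- Some class misses `U`; so do its `F^*`-multiples, and the series of its representative is empty.
-/
theorem rootForm_eq_zero (hn0 : n ≠ ⊥) (hn1 : n ≠ ⊤) {S : Finset (Fin r → K)}
    (hS : IsRepSystem Y n S) {ω : PsiBar inf r} (hω : ω.U ≠ ⊤) : rootForm Y S ω = 0 := by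
  obtain ⟨u, hu, huU⟩ := exists_mem_idealInv_notMem_sup hK ht htr hY hn0 hn1 hω
  have huY : u ∉ Y := fun h => huU 0 (zero_mem _) (by rw [zero_sub]; exact neg_mem h)
  obtain ⟨s, ⟨hs, c, hc, hcs⟩, -⟩ := hS.existsUnique u hu huY
  refine Finset.prod_eq_zero hs ?_
  have : IsEmpty {v : ω.U // (v : Fin r → K) - s ∈ Y ∧ v ≠ 0} := by
    refine ⟨fun v => huU (algebraMap F K c • (v : ω.U)) (ω.U.smul_mem _ (v : ω.U).2) ?_⟩
    have h1 := sub_mem (const_smul_mem Y c v.2.1) hcs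
    rw [smul_sub] at h1
    rw [algebraMap_smul]
    simpa using h1
  rw [partialEisenstein, tsum_empty]

/-- On the open stratum each factor is the inverse of a value of `e^Λ`. -/
theorem rootForm_ne_zero {S : Finset (Fin r → K)} (hS : IsRepSystem Y n S) {ω : PsiBar inf r}
    (hω : ω.U = ⊤) : rootForm Y S ω ≠ 0 := by
  refine Finset.prod_ne_zero_iff.2 fun u hu => ?_
  have hs := hS.mem u hu
  rw [partialEisenstein_eq_tsum_coset ω Y hs.2]
  rcases ω.cosetImage_eq Y hs.2 with h | ⟨z, hz, h⟩
  · have h1 : ω.i ⟨u, hω ▸ Submodule.mem_top⟩ ∈ ω.cosetImage Y u :=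
      ⟨⟨u, hω ▸ Submodule.mem_top⟩, by rw [sub_self]; exact zero_mem Y, rfl⟩
    rw [h] at h1
    exact h1.elim
  · rw [h]
    have h1 := discreteExp_mul_tsum_inv (isDiscreteSet_lattice hK ht htr hY.fg ω) hz
    exact right_ne_zero_of_mul_eq_one h1

end Boundary

/-! ### The terms `1 / i(v)` as functions of the point -/

section InvAt

open Filter Topology

variable {F K : Type*} [Field F] [Finite F] [Field K] [Algebra F K] {inf : Place F K} {r : ℕ}

open Classical in
/-- The reciprocal `1 / i(v)`, extended by zero to all of `K ^ r`. -/
def PsiBar.invAt (ω : PsiBar inf r) (v : Fin r → K) : Cinf inf :=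
  if h : v ∈ ω.U then (ω.i ⟨v, h⟩)⁻¹ else 0

theorem PsiBar.invAt_of_mem (ω : PsiBar inf r) {v : Fin r → K} (h : v ∈ ω.U) :
    ω.invAt v = (ω.i ⟨v, h⟩)⁻¹ := dif_pos h

theorem PsiBar.invAt_of_notMem (ω : PsiBar inf r) {v : Fin r → K} (h : v ∉ ω.U) :
    ω.invAt v = 0 := dif_neg h

theorem PsiBar.norm_invAt_le (ω : PsiBar inf r) {c M : ℝ} (hc : 0 < c)
    (hlow : ∀ (v : ω.U) (j : Fin r), c * inf.abv ((v : Fin r → K) j) ≤ ‖ω.i v‖) (hM : 0 < M)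
    {v : Fin r → K} {j : Fin r} (hj : M ≤ inf.abv (v j)) : ‖ω.invAt v‖ ≤ (c * M)⁻¹ := by
  by_cases h : v ∈ ω.U
  · rw [ω.invAt_of_mem h, norm_inv]
    exact inv_anti₀ (by positivity) (le_trans (by gcongr) (hlow ⟨v, h⟩ j))
  · rw [ω.invAt_of_notMem h, norm_zero]
    positivity

theorem HasFiniteHeights.mono {N N' : Set (Fin r → K)} (hN : HasFiniteHeights inf N)
    (h : N' ⊆ N) : HasFiniteHeights inf N' :=
  fun H => (hN H).subset fun _ hv => ⟨h hv.1, hv.2⟩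

theorem HasFiniteHeights.finite_subtype {N : Set (Fin r → K)} (hN : HasFiniteHeights inf N)
    (H : ℝ) : {v : N | ∀ j, inf.abv ((v : Fin r → K) j) ≤ H}.Finite :=
  ((hN H).preimage (f := fun v : N => (v : Fin r → K)) Subtype.val_injective.injOn).subset
    fun v hv => ⟨v.2, hv⟩

variable (hK : IsFunctionField F K) {t : K} (ht : t ∈ regularRing inf) (htr : Transcendental F t)
include hK ht htr

theorem PsiBar.tendsto_invAt (ω : PsiBar inf r) {N : Set (Fin r → K)}
    (hN : HasFiniteHeights inf N) : Tendsto (fun v : N => ω.invAt v) cofinite (𝓝 0) := by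
  obtain ⟨c, hc, hlow⟩ := ω.exists_lower_bound hK ht htr
  rw [tendsto_zero_iff_norm_tendsto_zero]
  refine (tendsto_order.2 ⟨fun a ha => .of_forall fun _ => ha.trans_le (norm_nonneg _),
    fun ε hε => ?_⟩)
  refine (hN.finite_subtype (c * (ε / 2))⁻¹).subset fun v hv => ?_
  by_contra hcon
  rw [Set.mem_ofPred_eq] at hcon
  push Not at hcon
  obtain ⟨j, hj⟩ := hcon
  have h1 := ω.norm_invAt_le hc hlow (by positivity) hj.le
  refine hv (show ‖ω.invAt v‖ < ε from ?_)
  calc ‖ω.invAt v‖ ≤ (c * (c * (ε / 2))⁻¹)⁻¹ := h1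
    _ = ε / 2 := by field_simp
    _ < ε := by linarith

theorem PsiBar.summable_invAt (ω : PsiBar inf r) {N : Set (Fin r → K)}
    (hN : HasFiniteHeights inf N) : Summable fun v : N => ω.invAt v :=
  NonarchimedeanAddGroup.summable_of_tendsto_cofinite_zero (ω.tendsto_invAt hK ht htr hN)

end InvAt

/-! ### Partial Eisenstein series are strongly continuous -/

section Eisenstein

open Filter Topology

variable {F K : Type*} [Field F] [Finite F] [Field K] [Algebra F K] {inf : Place F K} {r : ℕ}
  {Y : Submodule (regularRing inf) (Fin r → K)} {n : Ideal (regularRing inf)}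

/-- The index set no longer depends on `ω`, which allows termwise comparison of different points. -/
theorem partialEisenstein_eq_tsum_invAt (ω : PsiBar inf r) (u : Fin r → K) :
    partialEisenstein Y 1 u ω = ∑' v : {v : Fin r → K | v - u ∈ Y}, ω.invAt v := by
  let f : {v : ω.U // (v : Fin r → K) - u ∈ Y ∧ v ≠ 0} → {v : Fin r → K | v - u ∈ Y} :=
    fun v => ⟨(v : ω.U), v.2.1⟩
  have hf : Function.Injective f := fun v w h =>
    Subtype.ext (Subtype.ext (congrArg (fun x : {v : Fin r → K | v - u ∈ Y} => (x : Fin r → K)) h))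
  rw [← hf.tsum_eq (f := fun v : {v : Fin r → K | v - u ∈ Y} => ω.invAt v)]
  · refine tsum_congr fun v => ?_
    rw [pow_one]
    exact (ω.invAt_of_mem (v : ω.U).2).symm
  · intro v hv
    have hvU : (v : Fin r → K) ∈ ω.U := by
      by_contra h
      exact hv (ω.invAt_of_notMem h)
    refine ⟨⟨⟨v, hvU⟩, v.2, fun h => hv ?_⟩, rfl⟩
    change ω.invAt v = 0
    rw [ω.invAt_of_mem hvU, h, map_zero, inv_zero]

variable (hK : IsFunctionField F K) {t : K} (ht : t ∈ regularRing inf) (htr : Transcendental F t)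
  (hY : Y.FG) (hn : n ≠ ⊥)
include hK ht htr hY hn

theorem hasFiniteHeights_coset {u : Fin r → K} (hu : u ∈ idealInv n Y) :
    HasFiniteHeights inf {v : Fin r → K | v - u ∈ Y} :=
  (hasFiniteHeights_idealInv hK ht htr hY hn).mono fun v hv => by
    have h1 : v - u ∈ idealInv n Y := le_idealInv hv
    simpa using add_mem h1 hu

/-! ### Strong continuity -/

/-- For `v ∈ U` expand `v` in a basis of `U`: closeness on the basis, together with the lower bound
for `|i(v)|`, controls the relative error uniformly in `v`. For `v ∉ U` a fixed multiple of `v` lies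
in `A^r`, so `1 / i(v)` is small at nearby points. By ultrametricity uniform smallness of the terms
bounds the sum. -/
theorem PsiBar.exists_nhd_invAt_sub_le (ω : PsiBar inf r) {u : Fin r → K}
    (hu : u ∈ idealInv n Y) {ε : ℝ} (hε : 0 < ε) :
    ∃ S : Finset ω.U, ∃ δ > 0, ∃ R : ℝ, ∀ η ∈ ω.nhd S δ R, ∀ v : Fin r → K, v - u ∈ Y →
      ‖η.invAt v - ω.invAt v‖ ≤ ε := by
  classical
  have hN := hasFiniteHeights_coset hK ht htr hY hn hu
  obtain ⟨B, hB⟩ : ∃ B : ℝ, ∀ v : Fin r → K, v - u ∈ Y → ‖ω.invAt v‖ ≤ B := by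
    obtain ⟨B, hB⟩ := (ω.tendsto_invAt hK ht htr hN).norm.bddAbove_range_of_cofinite
    exact ⟨B, fun v hv => hB ⟨⟨v, hv⟩, rfl⟩⟩
  obtain ⟨d, hd0, hdA, hd⟩ := exists_denominator_idealInv hK ht htr hY hn
  let b := Module.finBasis K ω.U
  obtain ⟨c, hc, hlow⟩ := ω.exists_lower_bound_basis hK ht htr b
  have hB' : 0 < max B 1 := lt_max_of_lt_right one_pos
  -- The relative error `τ` is below one to keep `|i(v)|` unchanged, and below `ε / B` because the
  -- error of the inverse is at most `τ / |i(v)| ≤ τ B`.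
  set τ := min (1 / 2) (ε / max B 1) with hτ
  have hτ0 : 0 < τ := by positivity
  -- The radius compensates for the denominator `d`: the neighbourhood controls `d v ∈ A^r`, not `v`
  -- itself.
  refine ⟨Finset.univ.image b, c * τ, by positivity, inf.abv d / ε, ?_⟩
  rintro η ⟨hUU, hclose, hfar⟩ v hv
  have hdpos : 0 < inf.abv d := inf.abv.pos hd0
  by_cases hvU : v ∈ ω.U
  · rw [ω.invAt_of_mem hvU, η.invAt_of_mem (hUU hvU)]
    set x := ω.i ⟨v, hvU⟩ with hx
    set y := η.i ⟨v, hUU hvU⟩ with hy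
    have hBx : ‖x‖⁻¹ ≤ B := by
      have := hB v hv
      rwa [ω.invAt_of_mem hvU, norm_inv] at this
    have hxy : ‖y - x‖ ≤ τ * ‖x‖ := by
      have h1 : y = ∑ k, algebraMap K (Cinf inf) (b.repr ⟨v, hvU⟩ k) *
          η.i (Submodule.inclusion hUU (b k)) := by
        have h2 : (⟨v, hUU hvU⟩ : η.U) = Submodule.inclusion hUU (∑ k, b.repr ⟨v, hvU⟩ k • b k) := by
          rw [b.sum_repr]; rfl
        rw [hy, h2, map_sum, map_sum]
        refine Finset.sum_congr rfl fun k _ => ?_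
        rw [map_smul, map_smul, Algebra.smul_def]
      rw [h1, hx, ω.i_eq_sum b, ← Finset.sum_sub_distrib]
      refine IsUltrametricDist.norm_sum_le_of_forall_le_of_nonneg (by positivity) fun k _ => ?_
      rw [← mul_sub, norm_mul, norm_algebraMap_Cinf, ← ω.i_eq_sum b]
      have h3 := hclose (b k) (Finset.mem_image_of_mem _ (Finset.mem_univ k))
      have h4 := hlow ⟨v, hvU⟩ k
      calc inf.abv (b.repr ⟨v, hvU⟩ k) * ‖η.i (Submodule.inclusion hUU (b k)) - ω.i (b k)‖
          ≤ inf.abv (b.repr ⟨v, hvU⟩ k) * (c * τ) :=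
            mul_le_mul_of_nonneg_left h3.le (inf.abv.nonneg _)
        _ = τ * (c * inf.abv (b.repr ⟨v, hvU⟩ k)) := by ring
        _ ≤ τ * ‖ω.i ⟨v, hvU⟩‖ := by gcongr
    -- The vector zero occurs when `u ∈ Y`; both inverses are then zero.
    by_cases hx0 : x = 0
    · have h5 : y = 0 := by
        rw [hx0, norm_zero, mul_zero, sub_zero] at hxy
        exact norm_le_zero_iff.1 hxy
      rw [hx0, h5, sub_self, norm_zero]
      exact hε.le
    have hxpos : 0 < ‖x‖ := norm_pos_iff.2 hx0
    have hlt : ‖y - x‖ < ‖x‖ := by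
      have : τ ≤ 1 / 2 := min_le_left _ _
      nlinarith
    have hyx : ‖y‖ = ‖x‖ := by
      have h6 := IsUltrametricDist.norm_add_eq_max_of_norm_ne_norm hlt.ne
      rwa [sub_add_cancel, max_eq_right hlt.le] at h6
    have hy0 : y ≠ 0 := norm_pos_iff.1 (hyx ▸ hxpos)
    rw [inv_sub_inv hy0 hx0, norm_div, norm_mul, hyx, norm_sub_rev]
    calc ‖y - x‖ / (‖x‖ * ‖x‖) ≤ τ * ‖x‖ / (‖x‖ * ‖x‖) := by gcongr
      _ = τ * ‖x‖⁻¹ := by field_simp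
      _ ≤ ε / max B 1 * max B 1 := by
          gcongr
          · exact min_le_right _ _
          · exact hBx.trans (le_max_left _ _)
      _ = ε := by field_simp
  · rw [ω.invAt_of_notMem hvU, sub_zero]
    by_cases hvη : v ∈ η.U
    · rw [η.invAt_of_mem hvη, norm_inv]
      have h1 := hfar (d • ⟨v, hvη⟩) (fun j => hd v (by
        have h1 : v - u ∈ idealInv n Y := le_idealInv hv
        simpa using add_mem h1 hu) j) (fun h => hvU (by
          have := ω.U.smul_mem d⁻¹ h
          rwa [Submodule.coe_smul, smul_smul, inv_mul_cancel₀ hd0, one_smul] at this))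
      rw [map_smul, Algebra.smul_def, norm_mul, norm_algebraMap_Cinf, div_lt_iff₀ hε] at h1
      have h2 : 1 < ‖η.i ⟨v, hvη⟩‖ * ε := by
        refine lt_of_mul_lt_mul_left ?_ hdpos.le
        rw [mul_one, ← mul_assoc]; exact h1
      have h3 : 0 < ‖η.i ⟨v, hvη⟩‖ := by
        by_contra h
        have := norm_nonneg (η.i ⟨v, hvη⟩)
        nlinarith
      rw [inv_le_iff_one_le_mul₀ h3, mul_comm]
      exact h2.le
    · rw [η.invAt_of_notMem hvη, norm_zero]
      exact hε.le

theorem continuous_partialEisenstein {u : Fin r → K} (hu : u ∈ idealInv n Y) :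
    Continuous (partialEisenstein Y 1 u : PsiBar inf r → Cinf inf) := by
  have hN := hasFiniteHeights_coset hK ht htr hY hn hu
  refine continuous_def.2 fun W hW ω hω => ?_
  obtain ⟨ε, hε, hball⟩ := Metric.isOpen_iff.1 hW _ hω
  obtain ⟨S, δ, hδ, R, h⟩ := ω.exists_nhd_invAt_sub_le hK ht htr hY hn hu (half_pos hε)
  refine ⟨S, δ, hδ, R, fun η hη => hball ?_⟩
  rw [mem_ball_iff_norm, partialEisenstein_eq_tsum_invAt, partialEisenstein_eq_tsum_invAt,
    ← (η.summable_invAt hK ht htr hN).tsum_sub (ω.summable_invAt hK ht htr hN)]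
  refine lt_of_le_of_lt (IsUltrametricDist.norm_tsum_le_of_forall_le_of_nonneg (half_pos hε).le
    fun v => h η hη v v.2) (half_lt_self hε)

end Eisenstein

/-! ### Partial Eisenstein series are holomorphic -/

section Holomorphic

variable {F K : Type*} [Field F] [Finite F] [Field K] [Algebra F K] {inf : Place F K} {r : ℕ}

/-- Bounded uniform limits of rational functions on the affinoid with index `N`. -/
def IsRationalLimit (N : ℕ) (f : PsiBar inf r → Cinf inf) : Prop :=
  (∃ B : ℝ, 0 < B ∧ ∀ (ω : PsiBar inf r) (h : ω.U = ⊤), ω.coord h ∈ affinoid inf r N → ‖f ω‖ ≤ B) ∧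
  ∀ ε > (0 : ℝ), ∃ P Q : MvPolynomial (Fin r) (Cinf inf),
    ∀ (ω : PsiBar inf r) (h : ω.U = ⊤), ω.coord h ∈ affinoid inf r N →
      MvPolynomial.eval (ω.coord h) Q ≠ 0 ∧
      ‖f ω - MvPolynomial.eval (ω.coord h) P / MvPolynomial.eval (ω.coord h) Q‖ < ε

variable {N : ℕ} {f g : PsiBar inf r → Cinf inf}

theorem IsRationalLimit.const (c : Cinf inf) :
    IsRationalLimit (r := r) N fun _ => c := by
  refine ⟨⟨‖c‖ + 1, by positivity, fun _ _ _ => by linarith⟩, fun ε hε => ⟨MvPolynomial.C c, 1,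
    fun ω h _ => ⟨by simp, by simpa using hε⟩⟩⟩

theorem IsRationalLimit.add (hf : IsRationalLimit N f) (hg : IsRationalLimit N g) :
    IsRationalLimit N fun ω => f ω + g ω := by
  obtain ⟨⟨B, hB, hfB⟩, hf⟩ := hf
  obtain ⟨⟨B', hB', hgB⟩, hg⟩ := hg
  refine ⟨⟨B + B', by positivity, fun ω h hω => (norm_add_le _ _).trans
    (add_le_add (hfB ω h hω) (hgB ω h hω))⟩, fun ε hε => ?_⟩
  obtain ⟨P, Q, hPQ⟩ := hf ε hε
  obtain ⟨P', Q', hPQ'⟩ := hg ε hε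
  refine ⟨P * Q' + P' * Q, Q * Q', fun ω h hω => ?_⟩
  obtain ⟨h1, h2⟩ := hPQ ω h hω
  obtain ⟨h1', h2'⟩ := hPQ' ω h hω
  simp only [map_mul, map_add]
  refine ⟨mul_ne_zero h1 h1', ?_⟩
  have h3 : ∀ a b p q p' q' : Cinf inf, q ≠ 0 → q' ≠ 0 →
      a + b - (p * q' + p' * q) / (q * q') = (a - p / q) + (b - p' / q') := by
    intro a b p q p' q' hq hq'
    field_simp
    ring
  rw [h3 _ _ _ _ _ _ h1 h1']
  exact (IsUltrametricDist.norm_add_le_max _ _).trans_lt (max_lt h2 h2')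

theorem IsRationalLimit.mul (hf : IsRationalLimit N f) (hg : IsRationalLimit N g) :
    IsRationalLimit N fun ω => f ω * g ω := by
  obtain ⟨⟨B, hB, hfB⟩, hf⟩ := hf
  obtain ⟨⟨B', hB', hgB⟩, hg⟩ := hg
  refine ⟨⟨B * B', by positivity, fun ω h hω => (norm_mul_le _ _).trans
    (mul_le_mul (hfB ω h hω) (hgB ω h hω) (norm_nonneg _) hB.le)⟩, fun ε hε => ?_⟩
  obtain ⟨P, Q, hPQ⟩ := hf (ε / B') (by positivity)
  -- `B + ε / B'` bounds the approximant of `f`, which multiplies the error of `g`.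
  obtain ⟨P', Q', hPQ'⟩ := hg (min B' (ε / (B + ε / B'))) (by positivity)
  refine ⟨P * P', Q * Q', fun ω h hω => ?_⟩
  obtain ⟨h1, h2⟩ := hPQ ω h hω
  obtain ⟨h1', h2'⟩ := hPQ' ω h hω
  simp only [map_mul]
  refine ⟨mul_ne_zero h1 h1', ?_⟩
  rw [← div_mul_div_comm]
  set a := f ω
  set b := g ω
  set p := MvPolynomial.eval (ω.coord h) P / MvPolynomial.eval (ω.coord h) Q
  set p' := MvPolynomial.eval (ω.coord h) P' / MvPolynomial.eval (ω.coord h) Q'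
  have h3 : a * b - p * p' = (a - p) * b + p * (b - p') := by ring
  have hp : ‖p‖ ≤ B + ε / B' := by
    have : p = a - (a - p) := by ring
    rw [this]
    exact (norm_sub_le _ _).trans (add_le_add (hfB ω h hω) h2.le)
  rw [h3]
  refine (IsUltrametricDist.norm_add_le_max _ _).trans_lt (max_lt ?_ ?_)
  · rw [norm_mul]
    calc ‖a - p‖ * ‖b‖ ≤ ‖a - p‖ * B' := by gcongr; exact hgB ω h hω
      _ < ε / B' * B' := by gcongr
      _ = ε := by field_simp
  · rw [norm_mul]
    have h4 : ‖b - p'‖ < ε / (B + ε / B') := h2'.trans_le (min_le_right _ _)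
    calc ‖p‖ * ‖b - p'‖ ≤ (B + ε / B') * ‖b - p'‖ := by gcongr
      _ < (B + ε / B') * (ε / (B + ε / B')) := by gcongr
      _ = ε := by field_simp

theorem IsRationalLimit.sum {ι : Type*} (s : Finset ι) {f : ι → PsiBar inf r → Cinf inf}
    (hf : ∀ i ∈ s, IsRationalLimit N (f i)) : IsRationalLimit N fun ω => ∑ i ∈ s, f i ω := by
  classical
  induction s using Finset.induction_on with
  | empty => simpa using IsRationalLimit.const 0
  | insert i s hi ih =>
    simp only [Finset.sum_insert hi]
    exact (hf i (Finset.mem_insert_self _ _)).add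
      (ih fun j hj => hf j (Finset.mem_insert_of_mem hj))

theorem IsRationalLimit.prod {ι : Type*} (s : Finset ι) {f : ι → PsiBar inf r → Cinf inf}
    (hf : ∀ i ∈ s, IsRationalLimit N (f i)) : IsRationalLimit N fun ω => ∏ i ∈ s, f i ω := by
  classical
  induction s using Finset.induction_on with
  | empty => simpa using IsRationalLimit.const 1
  | insert i s hi ih =>
    simp only [Finset.prod_insert hi]
    exact (hf i (Finset.mem_insert_self _ _)).mul
      (ih fun j hj => hf j (Finset.mem_insert_of_mem hj))

theorem IsRationalLimit.of_approx (h : ∀ ε > 0, ∃ g, IsRationalLimit N g ∧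
    ∀ (ω : PsiBar inf r) (h : ω.U = ⊤), ω.coord h ∈ affinoid inf r N → ‖f ω - g ω‖ < ε) :
    IsRationalLimit N f := by
  refine ⟨?_, fun ε hε => ?_⟩
  · obtain ⟨g, ⟨⟨B, hB, hgB⟩, -⟩, hfg⟩ := h 1 one_pos
    refine ⟨1 + B, by positivity, fun ω hU hω => ?_⟩
    have : f ω = (f ω - g ω) + g ω := by ring
    rw [this]
    exact (norm_add_le _ _).trans (add_le_add (hfg ω hU hω).le (hgB ω hU hω))
  · obtain ⟨g, ⟨-, hg⟩, hfg⟩ := h ε hε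
    obtain ⟨P, Q, hPQ⟩ := hg ε hε
    refine ⟨P, Q, fun ω hU hω => ⟨(hPQ ω hU hω).1, ?_⟩⟩
    rw [← sub_add_sub_cancel _ (g ω)]
    exact (IsUltrametricDist.norm_add_le_max _ _).trans_lt
      (max_lt (hfg ω hU hω) (hPQ ω hU hω).2)

theorem PsiBar.lower_bound_of_mem_affinoid {ω : PsiBar inf r} {h : ω.U = ⊤}
    (hω : ω.coord h ∈ affinoid inf r N) (v : ω.U) (j : Fin r) :
    ((Nat.card F : ℝ) ^ N)⁻¹ * inf.abv ((v : Fin r → K) j) ≤ ‖ω.i v‖ := by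
  have hq : (0 : ℝ) < (Nat.card F : ℝ) ^ N := pow_pos (one_pos.trans (one_lt_card_const F)) N
  rw [inv_mul_le_iff₀ hq, ω.i_eq_sum_coord h]
  exact hω.2 v j

theorem isRationalLimit_invAt (v : Fin r → K) :
    IsRationalLimit N fun ω : PsiBar inf r => ω.invAt v := by
  have hq : (0 : ℝ) < (Nat.card F : ℝ) ^ N := pow_pos (one_pos.trans (one_lt_card_const F)) N
  by_cases hv : v = 0
  · have h1 : (fun ω : PsiBar inf r => ω.invAt v) = fun _ => 0 := by
      funext ω
      have h0 : v ∈ ω.U := hv ▸ zero_mem _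
      have h2 : (⟨v, h0⟩ : ω.U) = 0 := Subtype.ext hv
      rw [ω.invAt_of_mem h0, h2, map_zero, inv_zero]
    rw [h1]
    exact IsRationalLimit.const 0
  obtain ⟨j, hj⟩ := Function.ne_iff.1 hv
  have hpos : 0 < inf.abv (v j) := inf.abv.pos hj
  refine ⟨⟨((((Nat.card F : ℝ) ^ N)⁻¹) * inf.abv (v j))⁻¹, by positivity, fun ω h hω =>
    ω.norm_invAt_le (inv_pos.2 hq) (PsiBar.lower_bound_of_mem_affinoid hω) hpos le_rfl⟩,
    fun ε hε => ⟨1, ∑ k, MvPolynomial.C (algebraMap K (Cinf inf) (v k)) * MvPolynomial.X k,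
      fun ω h hω => ?_⟩⟩
  have hvU : v ∈ ω.U := h ▸ Submodule.mem_top
  have h1 : MvPolynomial.eval (ω.coord h)
      (∑ k, MvPolynomial.C (algebraMap K (Cinf inf) (v k)) * MvPolynomial.X k) =
      ω.i ⟨v, hvU⟩ := by
    rw [ω.i_eq_sum_coord h, map_sum]
    exact Finset.sum_congr rfl fun k _ => by
      rw [map_mul, MvPolynomial.eval_C, MvPolynomial.eval_X]
  rw [h1, map_one]
  simp only [ω.invAt_of_mem hvU, one_div, sub_self, norm_zero]
  refine ⟨fun h0 => hv ?_, hε⟩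
  exact congrArg Subtype.val (ω.injective (h0.trans (map_zero ω.i).symm))

variable {Y : Submodule (regularRing inf) (Fin r → K)} {n : Ideal (regularRing inf)}
  (hK : IsFunctionField F K) {t : K} (ht : t ∈ regularRing inf) (htr : Transcendental F t)
  (hY : Y.FG) (hn : n ≠ ⊥)
include hK ht htr hY hn

/-- On an affinoid the lower bound for `|i(v)|` in terms of the height of `v` is uniform, so the
terms of large height are uniformly small and finitely many rational terms remain. -/
theorem isRationalLimit_partialEisenstein {u : Fin r → K} (hu : u ∈ idealInv n Y) :
    IsRationalLimit N (partialEisenstein Y 1 u : PsiBar inf r → Cinf inf) := by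
  classical
  have hq : (0 : ℝ) < (Nat.card F : ℝ) ^ N := pow_pos (one_pos.trans (one_lt_card_const F)) N
  have hN := hasFiniteHeights_coset hK ht htr hY hn hu
  refine IsRationalLimit.of_approx fun ε hε => ?_
  let H := (hN.finite_subtype ((((Nat.card F : ℝ) ^ N)⁻¹) * (ε / 2))⁻¹).toFinset
  refine ⟨fun ω => ∑ v ∈ H, ω.invAt v, .sum _ fun v _ => isRationalLimit_invAt (v : Fin r → K),
    fun ω h hω => ?_⟩
  rw [partialEisenstein_eq_tsum_invAt,
    ← (ω.summable_invAt hK ht htr hN).sum_add_tsum_subtype_compl H, add_sub_cancel_left]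
  refine lt_of_le_of_lt (IsUltrametricDist.norm_tsum_le_of_forall_le_of_nonneg (half_pos hε).le
    fun v => ?_) (half_lt_self hε)
  have hv : ¬ ∀ j, inf.abv (((v : {v : Fin r → K | v - u ∈ Y}) : Fin r → K) j) ≤
      ((((Nat.card F : ℝ) ^ N)⁻¹) * (ε / 2))⁻¹ := fun h => v.2 ((Set.Finite.mem_toFinset _).2 h)
  push Not at hv
  obtain ⟨j, hj⟩ := hv
  refine (ω.norm_invAt_le (inv_pos.2 hq) (PsiBar.lower_bound_of_mem_affinoid hω)
    (by positivity) hj.le).trans_eq ?_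
  field_simp

theorem isHolomorphic_rootForm {S : Finset (Fin r → K)} (hS : IsRepSystem Y n S) :
    IsHolomorphic (rootForm Y S : PsiBar inf r → Cinf inf) := fun _ =>
  (IsRationalLimit.prod S fun u hu =>
    isRationalLimit_partialEisenstein hK ht htr hY hn (hS.mem u hu).1).2

theorem continuous_rootForm {S : Finset (Fin r → K)} (hS : IsRepSystem Y n S) :
    Continuous (rootForm Y S : PsiBar inf r → Cinf inf) :=
  continuous_finsetProd _ fun u hu =>
    continuous_partialEisenstein hK ht htr hY hn (hS.mem u hu).1

end Holomorphic

/-! ### Lower bounds for the root on affinoids -/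

section LowerBound

open Filter Topology

/-- Factors with `|l| ≥ |z|` have norm at most one; the others are indexed by a subset of `T` and
are at most `D`. -/
theorem norm_discreteExp_le {C : Type*} [NormedField C] [IsUltrametricDist C] [CompleteSpace C]
    {L : Set C} (hL : IsDiscreteSet L) {z : C} {D : ℝ} (hD : 1 ≤ D) (T : Finset C)
    (hT : ∀ l ∈ L, l ≠ 0 → ‖l‖ < ‖z‖ → l ∈ T ∧ ‖z‖ / ‖l‖ ≤ D) :
    ‖discreteExp L z‖ ≤ ‖z‖ * D ^ T.card := by
  classical
  rw [discreteExp, norm_mul]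
  refine mul_le_mul_of_nonneg_left ?_ (norm_nonneg _)
  refine le_of_tendsto' (hL.multipliable z).hasProd.norm fun s => ?_
  have h1 : ∀ l : {l : C // l ∈ L ∧ l ≠ 0},
      ‖1 - z / (l : C)‖ ≤ if ‖(l : C)‖ < ‖z‖ then D else 1 := by
    intro l
    refine (norm_sub_le_max_of_ultrametric _ _).trans ?_
    have hl : 0 < ‖(l : C)‖ := norm_pos_iff.2 l.2.2
    rw [norm_one, norm_div]
    split_ifs with h
    · exact max_le hD (hT l l.2.1 l.2.2 h).2
    · exact max_le le_rfl ((div_le_one hl).2 (not_lt.1 h))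
  refine (Finset.prod_le_prod (fun _ _ => norm_nonneg _) fun l _ => h1 l).trans ?_
  rw [← Finset.prod_filter, Finset.prod_const]
  refine pow_le_pow_right₀ hD (Finset.card_le_card_of_injOn (fun l => (l : C)) ?_
    Subtype.val_injective.injOn)
  intro l hl
  exact (hT l l.2.1 l.2.2 (Finset.mem_filter.1 hl).2).1

variable {F K : Type*} [Field F] [Finite F] [Field K] [Algebra F K] {inf : Place F K} {r : ℕ}
  {Y : Submodule (regularRing inf) (Fin r → K)} {n : Ideal (regularRing inf)}
  (hK : IsFunctionField F K) {t : K} (ht : t ∈ regularRing inf) (htr : Transcendental F t)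
  (hY : Y.FG)
include hK ht htr hY

/-- On the affinoid `|i(u)| ≤ Z`, and lattice vectors with image smaller than `i(u)` have height at
most `Q Z`. They lie in a finite set `H` independent of the point, and each of their factors is
bounded uniformly. -/
theorem exists_norm_expLattice_le (N : ℕ) (u : Fin r → K) :
    ∃ B : ℝ, 0 < B ∧ ∀ (ω : PsiBar inf r) (h : ω.U = ⊤), ω.coord h ∈ affinoid inf r N →
      ‖discreteExp ((ω.lattice Y).toAddSubgroup : Set (Cinf inf))
        (ω.i ⟨u, h ▸ Submodule.mem_top⟩)‖ ≤ B := by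
  classical
  set Q : ℝ := (Nat.card F : ℝ) ^ N with hQ
  have hQ0 : 0 < Q := pow_pos (one_pos.trans (one_lt_card_const F)) N
  set Z : ℝ := Q * (1 + ∑ j, inf.abv (u j)) with hZ
  have hsum : 0 ≤ ∑ j, inf.abv (u j) := Finset.sum_nonneg fun _ _ => inf.abv.nonneg _
  have hZ0 : 0 < Z := by positivity
  have hfin := hasFiniteHeights_of_fg hK ht htr hY (Q * Z)
  let H := hfin.toFinset
  let D : ℝ := 1 + ∑ v ∈ H, ∑ j, Z * Q * (inf.abv (v j))⁻¹
  have hterm : ∀ (v : Fin r → K) j, 0 ≤ Z * Q * (inf.abv (v j))⁻¹ := fun v j =>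
    mul_nonneg (by positivity) (inv_nonneg.2 (inf.abv.nonneg _))
  have hD : 1 ≤ D := le_add_of_nonneg_right
    (Finset.sum_nonneg fun v _ => Finset.sum_nonneg fun j _ => hterm v j)
  refine ⟨Z * D ^ H.card, by positivity, fun ω h hω => ?_⟩
  have hlow := PsiBar.lower_bound_of_mem_affinoid hω
  set z := ω.i ⟨u, h ▸ Submodule.mem_top⟩ with hz
  have hzZ : ‖z‖ ≤ Z := by
    rw [hz, ω.i_eq_sum_coord h]
    refine IsUltrametricDist.norm_sum_le_of_forall_le_of_nonneg hZ0.le fun k _ => ?_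
    rw [norm_mul, norm_algebraMap_Cinf, hZ, mul_comm]
    refine mul_le_mul (hω.1 k) ?_ (inf.abv.nonneg _) hQ0.le
    have := Finset.single_le_sum (f := fun j => inf.abv (u j)) (fun _ _ => inf.abv.nonneg _)
      (Finset.mem_univ k)
    linarith
  let ev : (Fin r → K) → Cinf inf := fun v => ω.i ⟨v, h ▸ Submodule.mem_top⟩
  refine (norm_discreteExp_le (isDiscreteSet_lattice hK ht htr hY ω) hD (H.image ev) ?_).trans ?_
  · rintro _ ⟨v, hv, rfl⟩ hl0 hlz
    have hv' : (v : Fin r → K) ∈ Y := hv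
    have hvH : (v : Fin r → K) ∈ H := by
      refine hfin.mem_toFinset.2 ⟨hv', fun j => ?_⟩
      have h1 := hlow v j
      rw [inv_mul_le_iff₀ hQ0] at h1
      exact h1.trans (mul_le_mul_of_nonneg_left (hlz.le.trans hzZ) hQ0.le)
    refine ⟨Finset.mem_image.2 ⟨v, hvH, rfl⟩, ?_⟩
    have hv0 : (v : Fin r → K) ≠ 0 := fun h0 => hl0 (by
      have : v = 0 := Subtype.ext h0
      rw [this]; exact map_zero ω.i)
    obtain ⟨j, hj⟩ := Function.ne_iff.1 hv0
    have hpos : 0 < inf.abv ((v : Fin r → K) j) := inf.abv.pos hj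
    have h1 : ‖z‖ / ‖ω.i v‖ ≤ Z * Q * (inf.abv ((v : Fin r → K) j))⁻¹ := by
      have h2 : 0 < Q⁻¹ * inf.abv ((v : Fin r → K) j) := by positivity
      calc ‖z‖ / ‖ω.i v‖ ≤ Z / (Q⁻¹ * inf.abv ((v : Fin r → K) j)) :=
            div_le_div₀ hZ0.le hzZ h2 (hlow v j)
        _ = _ := by field_simp
    refine h1.trans ?_
    have h3 := Finset.single_le_sum (f := fun j => Z * Q * (inf.abv ((v : Fin r → K) j))⁻¹)
      (fun j _ => hterm v j) (Finset.mem_univ j)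
    have h4 := Finset.single_le_sum (f := fun v : Fin r → K => ∑ j, Z * Q * (inf.abv (v j))⁻¹)
      (fun v _ => Finset.sum_nonneg fun j _ => hterm v j) hvH
    change _ ≤ 1 + _
    linarith [h3, h4]
  · refine mul_le_mul hzZ (pow_le_pow_right₀ hD Finset.card_image_le) (by positivity) hZ0.le

/-- The series is the inverse of `e^Λ(i(u))`, so the upper bound for the exponential becomes a lower
bound. -/
theorem exists_le_norm_partialEisenstein (N : ℕ) {u : Fin r → K} (hu : u ∉ Y) :
    ∃ B : ℝ, 0 < B ∧ ∀ (ω : PsiBar inf r) (h : ω.U = ⊤), ω.coord h ∈ affinoid inf r N →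
      B ≤ ‖partialEisenstein Y 1 u ω‖ := by
  obtain ⟨B, hB, hle⟩ := exists_norm_expLattice_le hK ht htr hY N u
  refine ⟨B⁻¹, inv_pos.2 hB, fun ω h hω => ?_⟩
  have huU : u ∈ ω.U := h ▸ Submodule.mem_top
  have hL := isDiscreteSet_lattice hK ht htr hY ω
  have hz : ω.i ⟨u, huU⟩ ∉ (ω.lattice Y).toAddSubgroup := by
    rintro ⟨w, hw, hwv⟩
    have h2 : w = ⟨u, huU⟩ := ω.injective hwv
    rw [h2] at hw
    exact hu hw
  have hset : ω.cosetImage Y u = {x | x - ω.i ⟨u, huU⟩ ∈ (ω.lattice Y).toAddSubgroup} := by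
    ext x
    constructor
    · rintro ⟨v, hv, rfl⟩
      exact ⟨v - ⟨u, huU⟩, hv, map_sub _ _ _⟩
    · rintro ⟨w, hw, hwx⟩
      refine ⟨w + ⟨u, huU⟩, ?_, ?_⟩
      · have hw' : (w : Fin r → K) ∈ Y := hw
        simpa using hw'
      · have h1 : ω.i w = x - ω.i ⟨u, huU⟩ := hwx
        rw [map_add, h1, sub_add_cancel]
  have h1 := discreteExp_mul_tsum_inv hL hz
  rw [partialEisenstein_eq_tsum_coset ω Y hu, hset]
  have h2 := congrArg norm h1
  rw [norm_mul, norm_one] at h2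
  rw [inv_le_iff_one_le_mul₀ hB, ← h2, mul_comm]
  exact mul_le_mul_of_nonneg_left (hle ω h hω) (norm_nonneg _)

theorem exists_le_norm_rootForm {S : Finset (Fin r → K)} (hS : ∀ u ∈ S, u ∉ Y) (N : ℕ) :
    ∃ B : ℝ, 0 < B ∧ ∀ (ω : PsiBar inf r) (h : ω.U = ⊤), ω.coord h ∈ affinoid inf r N →
      B ≤ ‖rootForm Y S ω‖ := by
  choose! B hB hle using fun u (hu : u ∈ S) =>
    exists_le_norm_partialEisenstein hK ht htr hY N (hS u hu)
  refine ⟨∏ u ∈ S, B u, Finset.prod_pos fun u hu => hB u hu, fun ω h hω => ?_⟩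
  rw [rootForm, norm_prod]
  exact Finset.prod_le_prod (fun u hu => (hB u hu).le) fun u hu => hle u hu ω h hω

end LowerBound

/-! ### A connectedness property of the open stratum -/

section Connectedness

open Polynomial

variable {F K : Type*} [Field F] [Finite F] [Field K] [Algebra F K] {inf : Place F K} {r : ℕ}

/-- The points of an affinoid are recognized by finitely many linear forms. -/
theorem mem_affinoid_of_net {N : ℕ} {η : ℝ} (hη1 : η < 1)
    (hη : η * (Nat.card F : ℝ) ^ N < ((Nat.card F : ℝ) ^ N)⁻¹) {T : Finset K}
    (hT : ∀ x : K, inf.abv x ≤ 1 → ∃ a ∈ T, inf.abv (x - a) ≤ η) {w₀ w : Fin r → Cinf inf}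
    (hw₀ : w₀ ∈ affinoid inf r N) (hw : ∀ j, ‖w j‖ ≤ (Nat.card F : ℝ) ^ N)
    (hle : ∀ a : Fin r → T, ‖∑ k, algebraMap K (Cinf inf) (a k) * w₀ k‖ ≤
      ‖∑ k, algebraMap K (Cinf inf) (a k) * w k‖) : w ∈ affinoid inf r N := by
  refine ⟨hw, fun a j => ?_⟩
  set Q : ℝ := (Nat.card F : ℝ) ^ N with hQ
  have hQ0 : 0 < Q := pow_pos (one_pos.trans (one_lt_card_const F)) N
  obtain ⟨l, -, hl⟩ := Finset.exists_max_image Finset.univ (fun k => inf.abv (a k))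
    ⟨j, Finset.mem_univ j⟩
  by_cases hal : a l = 0
  · have h1 := hl j (Finset.mem_univ j)
    rw [hal, map_zero] at h1
    exact h1.trans (by positivity)
  have hpos : 0 < inf.abv (a l) := inf.abv.pos hal
  have hb : ∀ k, inf.abv (a k / a l) ≤ 1 := fun k => by
    rw [map_div₀]
    exact (div_le_one hpos).2 (hl k (Finset.mem_univ k))
  -- After dividing by the largest entry, `a` is replaced by net points. The combination of `α` is
  -- at least `Q⁻¹` by comparison with `w₀`, and the error, at most `η Q < Q⁻¹`, cannot account for
  -- it.
  choose α hαT hα using fun k => hT _ (hb k)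
  have hαl : 1 ≤ inf.abv (α l) := by
    have h1 := inf.abv_add_le (a l / a l - α l) (α l)
    rw [sub_add_cancel, div_self hal, map_one] at h1
    have h2 := hα l
    rw [div_self hal] at h2
    rcases le_max_iff.1 h1 with h3 | h3
    · linarith
    · exact h3
  have h1 : Q⁻¹ ≤ ‖∑ k, algebraMap K (Cinf inf) (α k) * w k‖ := by
    have h2 := (hαl.trans (hw₀.2 α l)).trans
      (mul_le_mul_of_nonneg_left (hle fun k => ⟨α k, hαT k⟩) hQ0.le)
    rwa [inv_le_iff_one_le_mul₀ hQ0, mul_comm]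
  have hη0 : 0 ≤ η := (inf.abv.nonneg _).trans (hα l)
  have h2 : ‖∑ k, algebraMap K (Cinf inf) (α k - a k / a l) * w k‖ < Q⁻¹ := by
    refine lt_of_le_of_lt (IsUltrametricDist.norm_sum_le_of_forall_le_of_nonneg
      (mul_nonneg hη0 hQ0.le) fun k _ => ?_) hη
    rw [norm_mul, norm_algebraMap_Cinf, inf.abv.map_sub]
    exact mul_le_mul (hα k) (hw k) (norm_nonneg _) hη0
  have h3 : ∑ k, algebraMap K (Cinf inf) (α k) * w k =
      ∑ k, algebraMap K (Cinf inf) (α k - a k / a l) * w k +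
      (algebraMap K (Cinf inf) (a l))⁻¹ * ∑ k, algebraMap K (Cinf inf) (a k) * w k := by
    rw [Finset.mul_sum, ← Finset.sum_add_distrib]
    refine Finset.sum_congr rfl fun k _ => ?_
    rw [map_sub, map_div₀]
    ring
  have h4 : Q⁻¹ ≤ (inf.abv (a l))⁻¹ * ‖∑ k, algebraMap K (Cinf inf) (a k) * w k‖ := by
    rw [h3] at h1
    have h5 := h1.trans (IsUltrametricDist.norm_add_le_max _ _)
    rw [norm_mul, norm_inv, norm_algebraMap_Cinf] at h5
    rcases le_max_iff.1 h5 with h6 | h6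
    · exact absurd h6 (not_le.2 h2)
    · exact h6
  refine (hl j (Finset.mem_univ j)).trans ?_
  rw [inv_mul_eq_div, le_div_iff₀ hpos, inv_mul_le_iff₀ hQ0] at h4
  exact h4

theorem eval_aeval_eq_eval {C σ : Type*} [Field C] (l : σ → C[X]) (P : MvPolynomial σ C) (t : C) :
    (MvPolynomial.aeval l P).eval t = MvPolynomial.eval (fun j => (l j).eval t) P := by
  induction P using MvPolynomial.induction_on with
  | C a => simp
  | add p q hp hq => simp [hp, hq]
  | mul_X p j hp => simp [hp]

variable (hK : IsFunctionField F K) {t : K} (ht : t ∈ regularRing inf) (htr : Transcendental F t)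
include hK ht htr

/-- A holomorphic function on `Ψ ^ r` which on every affinoid is bounded away from zero outside of
its zeros vanishes everywhere if it vanishes somewhere. -/
theorem IsHolomorphic.eq_zero_of_eq_zero {f : PsiBar inf r → Cinf inf} (hf : IsHolomorphic f)
    (hlow : ∀ N, ∃ B > 0, ∀ (ω : PsiBar inf r) (h : ω.U = ⊤), ω.coord h ∈ affinoid inf r N →
      f ω = 0 ∨ B ≤ ‖f ω‖)
    {ω₀ ω₁ : PsiBar inf r} (h₀ : ω₀.U = ⊤) (h₁ : ω₁.U = ⊤) (h0 : f ω₀ = 0) : f ω₁ = 0 := by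
  classical
  have hr : 0 < r := by
    by_contra hr
    obtain rfl : r = 0 := by omega
    exact ω₀.ne_bot (Subsingleton.elim _ _)
  obtain ⟨N₀, hN₀⟩ := ω₀.exists_mem_affinoid hK ht htr h₀
  obtain ⟨N₁, hN₁⟩ := ω₁.exists_mem_affinoid hK ht htr h₁
  set N := max N₀ N₁
  have hw₀ : ω₀.coord h₀ ∈ affinoid inf r N := affinoid_mono (le_max_left _ _) hN₀
  have hw₁ : ω₁.coord h₁ ∈ affinoid inf r N := affinoid_mono (le_max_right _ _) hN₁
  set w₀ := ω₀.coord h₀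
  set w₁ := ω₁.coord h₁
  set q : ℝ := (Nat.card F : ℝ) ^ N with hq
  have hq1 : 1 ≤ q := one_le_pow₀ (one_lt_card_const F).le
  have hq0 : 0 < q := one_pos.trans_le hq1
  obtain ⟨B, hB, hfB⟩ := hlow N
  -- With precision `B / 2`, the alternative `f = 0` or `|f| ≥ B` becomes `|P / Q| ≤ B / 2` or `|P /
  -- Q| ≥ B`.
  obtain ⟨P, Q, hPQ⟩ := hf N (B / 2) (half_pos hB)
  have hη1 : (2 * q * q)⁻¹ < 1 := inv_lt_one_of_one_lt₀ (by nlinarith)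
  have hη : (2 * q * q)⁻¹ * q < q⁻¹ := by
    have : (2 * q * q)⁻¹ * q = q⁻¹ / 2 := by field_simp
    rw [this]
    exact half_lt_self (inv_pos.2 hq0)
  obtain ⟨T, -, hT⟩ := inf.exists_finite_net (η := (2 * q * q)⁻¹) (by positivity)
  -- The line through the two points, at parameters `0` and `1`. It may leave the affinoid in
  -- between; only generic points of discs around the two ends are used.
  let l : Fin r → (Cinf inf)[X] := fun j => C (w₀ j) + X * C (w₁ j - w₀ j)
  have hl : ∀ (s : Cinf inf) j, (l j).eval s = w₀ j + s * (w₁ j - w₀ j) := fun s j => by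
    simp [l]
  have hl0 : (fun j => (l j).eval 0) = w₀ := funext fun j => by rw [hl]; ring
  have hl1 : (fun j => (l j).eval 1) = w₁ := funext fun j => by rw [hl]; ring
  -- Restricted to the line, the finitely many linear forms of `mem_affinoid_of_net`: a point where
  -- none of them is smaller than at the centre lies in the affinoid.
  let L : (Fin r → T) → (Cinf inf)[X] := fun a => ∑ k, C (algebraMap K (Cinf inf) (a k)) * l k
  have hL : ∀ a s, (L a).eval s = ∑ k, algebraMap K (Cinf inf) (a k) * (l k).eval s := by
    intro a s
    rw [eval_finsetSum]
    exact Finset.sum_congr rfl fun k _ => by rw [eval_mul, eval_C]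
  have hlq : ∀ s : Cinf inf, ‖s‖ ≤ 1 → ∀ j, ‖(l j).eval s‖ ≤ q := by
    intro s hs j
    rw [hl]
    refine (IsUltrametricDist.norm_add_le_max _ _).trans (max_le (hw₀.1 j) ?_)
    rw [norm_mul]
    calc ‖s‖ * ‖w₁ j - w₀ j‖ ≤ 1 * q := mul_le_mul hs
          ((norm_sub_le_max_of_ultrametric _ _).trans (max_le (hw₁.1 j) (hw₀.1 j)))
          (norm_nonneg _) zero_le_one
      _ = q := one_mul q
  have hpt : ∀ s : Cinf inf, (fun j => (l j).eval s) ∈ affinoid inf r N →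
      ‖(MvPolynomial.aeval l P).eval s‖ ≤ B / 2 * ‖(MvPolynomial.aeval l Q).eval s‖ ∨
      B * ‖(MvPolynomial.aeval l Q).eval s‖ ≤ ‖(MvPolynomial.aeval l P).eval s‖ := by
    intro s hs
    obtain ⟨ω, h, hω⟩ := exists_psiBar_coord hK ht htr hr hs
    rw [← hω] at hs
    obtain ⟨hQ, hfPQ⟩ := hPQ ω h hs
    rw [eval_aeval_eq_eval, eval_aeval_eq_eval, ← hω]
    have hQ' := norm_pos_iff.2 hQ
    rw [← div_le_iff₀ hQ', ← le_div_iff₀ hQ', ← norm_div]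
    rcases hfB ω h hs with h2 | h2
    · left
      rw [h2, zero_sub, norm_neg] at hfPQ
      exact hfPQ.le
    · right
      have h3 : ‖f ω - MvPolynomial.eval (ω.coord h) P / MvPolynomial.eval (ω.coord h) Q‖ <
          ‖f ω‖ := by linarith
      have h4 := norm_sub_le_max_of_ultrametric (f ω)
        (f ω - MvPolynomial.eval (ω.coord h) P / MvPolynomial.eval (ω.coord h) Q)
      have h5 := IsUltrametricDist.norm_add_le_max
        (f ω - MvPolynomial.eval (ω.coord h) P / MvPolynomial.eval (ω.coord h) Q)
        (MvPolynomial.eval (ω.coord h) P / MvPolynomial.eval (ω.coord h) Q)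
      rw [sub_add_cancel] at h5
      rcases le_max_iff.1 h5 with h6 | h6
      · exact absurd h6 (not_le.2 h3)
      · exact h2.trans h6
  obtain ⟨hQ₀, hPQ₀⟩ := hPQ ω₀ h₀ hw₀
  obtain ⟨hQ₁, hPQ₁⟩ := hPQ ω₁ h₁ hw₁
  have hmain := norm_eval_le_of_line (MvPolynomial.aeval l P) (MvPolynomial.aeval l Q) L
    (half_lt_self hB) (x := 0) (y := 1) (by simp)
    (by rw [eval_aeval_eq_eval, hl0]; exact hQ₀) (by rw [eval_aeval_eq_eval, hl1]; exact hQ₁)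
    (by
      intro z hz s hs hLs
      have hz1 : ‖z‖ ≤ 1 := by rcases hz with rfl | rfl <;> simp
      have hz0 : (fun j => (l j).eval z) ∈ affinoid inf r N := by
        rcases hz with rfl | rfl
        · rw [hl0]; exact hw₀
        · rw [hl1]; exact hw₁
      refine hpt _ (mem_affinoid_of_net hη1 hη hT hz0 (hlq _
        ((IsUltrametricDist.norm_add_le_max _ _).trans (max_le hs hz1))) fun a => ?_)
      have h2 := hLs a
      rwa [hL, hL] at h2)
    (by
      rw [eval_aeval_eq_eval, eval_aeval_eq_eval, hl0]
      rw [h0, zero_sub, norm_neg, norm_div, div_lt_iff₀ (norm_pos_iff.2 hQ₀)] at hPQ₀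
      exact hPQ₀.le)
  rw [eval_aeval_eq_eval, eval_aeval_eq_eval, hl1, ← div_le_iff₀ (norm_pos_iff.2 hQ₁),
    ← norm_div] at hmain
  refine (hfB ω₁ h₁ hw₁).resolve_right fun h2 => ?_
  have h3 := IsUltrametricDist.norm_add_le_max
    (f ω₁ - MvPolynomial.eval w₁ P / MvPolynomial.eval w₁ Q)
    (MvPolynomial.eval w₁ P / MvPolynomial.eval w₁ Q)
  rw [sub_add_cancel] at h3
  have h4 := h3.trans (max_le hPQ₁.le hmain)
  linarith

end Connectedness

/-! ### Uniqueness of the root -/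

section Uniqueness

variable {F K : Type*} [Field F] [Finite F] [Field K] [Algebra F K] {inf : Place F K} {r : ℕ}

/-- The `(q-1)`-th roots of unity are the constants `F^*`, and a nonzero difference of constants has
norm one. -/
theorem norm_sub_eq_one_of_pow_eq_one {x y : Cinf inf} (hx : x ^ (Nat.card F - 1) = 1)
    (hy : y ^ (Nat.card F - 1) = 1) (hxy : x ≠ y) : ‖x - y‖ = 1 := by
  classical
  have := Fintype.ofFinite Fˣ
  have key : ∀ z : Cinf inf, z ^ (Nat.card F - 1) = 1 → ∃ c : F, algebraMap F (Cinf inf) c = z := by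
    intro z hz
    have h1 := prod_units_one_sub (F := F) z
    rw [hz, sub_self, Finset.prod_eq_zero_iff] at h1
    obtain ⟨c, -, hc⟩ := h1
    have hc0 : algebraMap F (Cinf inf) (c : F) ≠ 0 := by simp
    refine ⟨c, ?_⟩
    rw [sub_eq_zero, eq_comm, mul_inv_eq_one₀ hc0] at hc
    exact hc.symm
  obtain ⟨a, rfl⟩ := key x hx
  obtain ⟨b, rfl⟩ := key y hy
  rw [← map_sub]
  exact norm_algebraMap_const fun h => hxy (by rw [sub_eq_zero.1 h])

variable {Y : Submodule (regularRing inf) (Fin r → K)} {n : Ideal (regularRing inf)}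
  (hK : IsFunctionField F K) {t : K} (ht : t ∈ regularRing inf) (htr : Transcendental F t)
  (hY : IsLattice Y ⊤) (hn0 : n ≠ ⊥) (hn1 : n ≠ ⊤)
include hK ht htr hY hn0 hn1

/-- With `ζ` the ratio at one point of the open stratum, `g - ζ h` is at each point zero or of norm
`|h|`, which is bounded below on affinoids. It vanishes at the chosen point, hence everywhere by
`IsHolomorphic.eq_zero_of_eq_zero`. -/
theorem exists_eq_mul_rootForm {S : Finset (Fin r → K)} (hS : IsRepSystem Y n S)
    {g : PsiBar inf r → Cinf inf} (hg : IsHolomorphic g)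
    (hgS : ∀ ω, g ω ^ (Nat.card F - 1) = rootForm Y S ω ^ (Nat.card F - 1)) :
    ∃ ζ : Cinf inf, ζ ^ (Nat.card F - 1) = 1 ∧ ∀ ω, g ω = ζ * rootForm Y S ω := by
  have hq : Nat.card F - 1 ≠ 0 := by
    have : 1 < Nat.card F := Finite.one_lt_card
    omega
  -- At the boundary both functions vanish, so any `ζ` serves and no continuity of `g` is needed.
  have hbd : ∀ ω : PsiBar inf r, ω.U ≠ ⊤ → ∀ ζ : Cinf inf, g ω = ζ * rootForm Y S ω := by
    intro ω hω ζ
    have h0 := rootForm_eq_zero hK ht htr hY hn0 hn1 hS hω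
    have h1 := hgS ω
    rw [h0, zero_pow hq] at h1
    rw [h0, mul_zero, eq_zero_of_pow_eq_zero h1]
  -- Existence of points of the open stratum is not needed: without them `ζ = 1` works.
  by_cases hex : ∃ ω₀ : PsiBar inf r, ω₀.U = ⊤
  swap
  · exact ⟨1, one_pow _, fun ω => hbd ω (fun h => hex ⟨ω, h⟩) 1⟩
  obtain ⟨ω₀, h₀⟩ := hex
  have hratio : ∀ ω : PsiBar inf r, ω.U = ⊤ →
      (g ω / rootForm Y S ω) ^ (Nat.card F - 1) = 1 := by
    intro ω hω
    rw [div_pow, hgS, div_self (pow_ne_zero _ (rootForm_ne_zero hK ht htr hY hS hω))]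
  set ζ := g ω₀ / rootForm Y S ω₀ with hζ
  refine ⟨ζ, hratio ω₀ h₀, fun ω => ?_⟩
  by_cases hω : ω.U = ⊤
  swap
  · exact hbd ω hω ζ
  have hhol : IsHolomorphic fun ω => g ω + -ζ * rootForm Y S ω := by
    intro N
    have h1 : IsRationalLimit N (rootForm Y S : PsiBar inf r → Cinf inf) :=
      IsRationalLimit.prod S fun u hu =>
        isRationalLimit_partialEisenstein hK ht htr hY.fg hn0 (hS.mem u hu).1
    have h2 : IsRationalLimit N g := by
      -- Holomorphy alone does not record boundedness; here it comes from `|g| = |h|`.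
      refine ⟨?_, hg N⟩
      obtain ⟨B, hB, hle⟩ := h1.1
      refine ⟨B, hB, fun ω h hω => ?_⟩
      have h3 := congrArg norm (hgS ω)
      rw [norm_pow, norm_pow] at h3
      rw [(pow_left_inj₀ (norm_nonneg _) (norm_nonneg _) hq).1 h3]
      exact hle ω h hω
    exact (h2.add ((IsRationalLimit.const (-ζ)).mul h1)).2
  have h1 := hhol.eq_zero_of_eq_zero hK ht htr ?_ h₀ hω ?_
  · rw [neg_mul, ← sub_eq_add_neg] at h1
    exact sub_eq_zero.1 h1
  · intro N
    obtain ⟨B, hB, hle⟩ := exists_le_norm_rootForm hK ht htr hY.fg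
      (fun u hu => (hS.mem u hu).2) N
    refine ⟨B, hB, fun ω h hω => ?_⟩
    have hne := rootForm_ne_zero hK ht htr hY hS h
    have h2 : g ω + -ζ * rootForm Y S ω = (g ω / rootForm Y S ω - ζ) * rootForm Y S ω := by
      field_simp
      ring
    rw [h2]
    by_cases hρ : g ω / rootForm Y S ω = ζ
    · left; rw [hρ, sub_self, zero_mul]
    · right
      rw [norm_mul, norm_sub_eq_one_of_pow_eq_one (hratio ω h) (hratio ω₀ h₀) hρ, one_mul]
      exact hle ω h hω
  · have hne := rootForm_ne_zero hK ht htr hY hS h₀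
    rw [hζ]
    field_simp
    ring

end Uniqueness

end DrinfeldForms

end

/-! ### The main theorem -/

theorem mainTheorem12 {F K : Type*} [Field F] [Finite F] [Field K] [Algebra F K]
    (hK : DrinfeldForms.IsFunctionField F K) (inf : DrinfeldForms.Place F K)
    (r : ℕ) (hr : 2 ≤ r)
    (Y : Submodule (DrinfeldForms.regularRing inf) (Fin r → K))
    (hY : DrinfeldForms.IsLattice Y ⊤)
    (n : Ideal (DrinfeldForms.regularRing inf)) (hn0 : n ≠ ⊥) (hn1 : n ≠ ⊤) :
    (∃ S : Finset (Fin r → K), DrinfeldForms.IsRepSystem Y n S) ∧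
    ∀ S : Finset (Fin r → K), DrinfeldForms.IsRepSystem Y n S →
      (∀ ω : DrinfeldForms.PsiBar inf r,
        DrinfeldForms.rootForm Y S ω ^ (Nat.card F - 1) =
          (-1) ^ (r * DrinfeldForms.degree n) * DrinfeldForms.discriminantForm Y n ω) ∧
      DrinfeldForms.IsModularForm Y
        (((Nat.card F ^ (r * DrinfeldForms.degree n) - 1) / (Nat.card F - 1) : ℕ) : ℤ)
        (DrinfeldForms.degree n : ℤ) (DrinfeldForms.rootForm Y S) ∧
      ∀ g : DrinfeldForms.PsiBar inf r → DrinfeldForms.Cinf inf,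
        DrinfeldForms.IsHolomorphic g →
        (∀ ω, g ω ^ (Nat.card F - 1) =
          (-1) ^ (r * DrinfeldForms.degree n) * DrinfeldForms.discriminantForm Y n ω) →
        ∃ ζ : DrinfeldForms.Cinf inf, ζ ^ (Nat.card F - 1) = 1 ∧
          ∀ ω, g ω = ζ * DrinfeldForms.rootForm Y S ω := by
  obtain ⟨t, ht, htr⟩ := DrinfeldForms.exists_transcendental_of_ideal hK hn0 hn1
  refine ⟨DrinfeldForms.exists_isRepSystem hK ht htr hY hn0 hn1, fun S hS => ?_⟩
  have hcard := hS.card_mul_add_one hK ht htr hY hn0 hn1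
  have hroot : ∀ ω : DrinfeldForms.PsiBar inf r,
      DrinfeldForms.rootForm Y S ω ^ (Nat.card F - 1) =
        (-1) ^ (r * DrinfeldForms.degree n) * DrinfeldForms.discriminantForm Y n ω := by
    intro ω
    rw [DrinfeldForms.discriminantForm_eq hK ht htr hY.fg hn0 hS hcard,
      DrinfeldForms.neg_one_pow_geom_sum (F := F) _ _ hcard, ← mul_assoc, ← mul_pow, neg_one_mul,
      neg_neg, one_pow, one_mul]
  refine ⟨hroot, ?_, fun g hg hgΔ => ?_⟩
  · exact
      { holomorphic := DrinfeldForms.isHolomorphic_rootForm hK ht htr hY.fg hn0 hS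
        weight := DrinfeldForms.rootForm_scale hK ht htr hY hn0 hn1 hS
        type := fun γ hγ => DrinfeldForms.rootForm_act hK ht htr hY hn0 hn1 hS hγ
        continuous := DrinfeldForms.continuous_rootForm hK ht htr hY.fg hn0 hS }
  · exact DrinfeldForms.exists_eq_mul_rootForm hK ht htr hY hn0 hn1 hS hg fun ω => by
      rw [hgΔ, hroot]
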